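/- **Theorem (Existence and uniqueness of solutions).** Let $\varepsilon\neq0$, $\sigma>0$ and $\alpha,\gamma,\chi\in\mathbb R$, let $y\in\mathbb R^2$, and let $\mathbf C_y:\mathbb R^2\to\mathbb R^2$ be bounded, uniformly continuous and of class $C^1$, with bounded and uniformly continuous partial derivatives. Put $g(x)=\frac1{2\pi\sigma^2}e^{-|x|^2/(2\sigma^2)}$ and consider $$\left\{\begin{array}{l} \partial_t u=\chi\int_{\mathbb R^2}w(t,x)\,dx-\gamma u,\\ \partial_t v=\varepsilon^2\Delta_x v-\nabla_x\cdot(v\,\mathbf C_y)-\alpha v+\gamma\, g(x-y)\,u,\\ \partial_t w=\alpha v-\chi w \end{array}\right.$$ on $X=\mathbb R\times L^1(\mathbb R^2)\times L^1(\mathbb R^2)$. Let $A$ be the infinitesimal generator on $L^1(\mathbb R^2)$ of the heat semigroup, given for $t>0$ by convolution with $\frac1{4\pi\varepsilon^2t}e^{-|x|^2/(4\varepsilon^2t)}$. Let $\Pi_y$ be the flow of $\mathbf C_y$, and let $B_y$ be the infinitesimal generator on $L^1(\mathbb R^2)$ of $$(T_{B_y}(t)v)(x)=\exp\Big(-\int_0^t(\nabla\cdot\mathbf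 C_y)(\Pi_y(-s)x)\,ds\Big)\,v(\Pi_y(-t)x).$$ Define $$\mathcal A_y(u,v,w)=\big(-\gamma u,\ (A+B_y)v-\alpha v,\ \alpha v-\chi w\big),\qquad \mathcal C_y(u,v,w)=\Big(\chi\int_{\mathbb R^2} w\,dx,\ \gamma\, g(\cdot-y)\,u,\ 0\Big).$$ Then: 1. $D(A)\subset D(B_y)$, so $A+B_y$ is defined on $D(A)$ and $D(\mathcal A_y)=\mathbb R\times D(A)\times L^1(\mathbb R^2)$. The operator $\mathcal C_y$ is bounded and linear on $X$. For $u\in\mathbb R$, $v\in C^2_c(\mathbb R^2)$ and $w\in L^1(\mathbb R^2)$, the state $(u,v,w)$ lies in $D(\mathcal A_y)$, and $(\mathcal A_y+\mathcal C_y)(u,v,w)$ is the right-hand side of the system. 2. $A+B_y$ generates a strongly continuous semigroup $T_{A+B_y}$ of bounded linear operators on $L^1(\mathbb R^2)$. With $T_{A+B_y-\alpha I}(t)=e^{-\alpha t}T_{A+B_y}(t)$, the operator $\mathcal A_y$ generates the strongly continuous semigroup on $X$ $$T_{\mathcal A_y}(t)(u_0,v_0,w_0)=\Big(e^{-\gamma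 t}u_0,\ T_{A+B_y-\alpha I}(t)v_0,\ e^{-\chi t}w_0+\int_0^te^{-\chi(t-s)}\alpha\,T_{A+B_y-\alpha I}(s)v_0\,ds\Big).$$ 3. The bounded perturbation $\mathcal A_y+\mathcal C_y$, with domain $D(\mathcal A_y)$, generates a unique strongly continuous semigroup $T_{\mathcal A_y+\mathcal C_y}$ of bounded linear operators on $X$. 4. For every $x_0=(u_0,v_0,w_0)\in X$, the map $z(t)=(u(t),v(t),w(t))=T_{\mathcal A_y+\mathcal C_y}(t)x_0$ is the unique mild solution, that is, the unique continuous $z:[0,\infty)\to X$ such that for all $t\ge0$, $\int_0^tz(s)\,ds\in D(\mathcal A_y)$ and $z(t)=x_0+(\mathcal A_y+\mathcal C_y)\int_0^tz(s)\,ds$. It is also the unique continuous solution of the variation of constants formula $$z(t)=T_{\mathcal A_y}(t)x_0+\int_0^tT_{\mathcal A_y}(t-s)\,\mathcal C_y z(s)\,ds,\qquad t\ge0.$$ For continuous $z=(u,v,w):[0,\infty)\to X$ this formula is equivalent to the system, for all $t\ge0$, $$\left\{\begin{array}{l} u(t)=e^{-\gamma t}u_0+\int_0^te^{-\gamma(t-s)}\chi\int_{\mathbb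 R^2}w(s,x)\,dx\,ds,\\ v(t)=T_{A+B_y-\alpha I}(t)v_0+\int_0^tT_{A+B_y-\alpha I}(t-s)\,\gamma\, g(\cdot-y)\,u(s)\,ds,\\ w(t)=e^{-\chi t}w_0+\int_0^te^{-\chi(t-s)}\alpha\, v(s)\,ds. \end{array}\right.$$ -/

import Mathlib

open MeasureTheory Set Filter Topology

namespace ReturnHome

noncomputable section

/-! ### Strongly continuous semigroups and their generators

Unbounded operators on a Banach space are represented by their graphs, as subsets of `X × X`. -/

section Abstract

variable {X : Type*} [NormedAddCommGroup X] [NormedSpace ℝ X]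

/-- `{T t}`, `t ≥ 0`, is a strongly continuous semigroup of bounded linear operators on `X`.
Values at negative times play no role. -/
structure IsC0Semigroup (T : ℝ → X →L[ℝ] X) : Prop where
  map_zero : T 0 = ContinuousLinearMap.id ℝ X
  map_add : ∀ s t : ℝ, 0 ≤ s → 0 ≤ t → T (s + t) = (T s).comp (T t)
  continuousOn : ∀ x : X, ContinuousOn (fun t => T t x) (Ici 0)

/-- The graph of the infinitesimal generator of a family `T t : X → X`, `t ≥ 0`: the pairs `(x, f)`
with `(T t x - x) / t → f` as `t ↘ 0`. -/
def generator (T : ℝ → X → X) : Set (X × X) :=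
  {p | Tendsto (fun t : ℝ => t⁻¹ • (T t p.1 - p.1)) (𝓝[>] 0) (𝓝 p.2)}

/-- The domain of the operator with graph `G`. -/
def dom (G : Set (X × X)) : Set X := {x | ∃ f, (x, f) ∈ G}

/-- The sum of two operators, on the intersection of the two domains. -/
def opAdd (G H : Set (X × X)) : Set (X × X) :=
  {p | ∃ a b, (p.1, a) ∈ G ∧ (p.1, b) ∈ H ∧ p.2 = a + b}

/-- The graph of an everywhere defined map. -/
def graphOf (F : X → X) : Set (X × X) := {p | p.2 = F p.1}

/-- The strongly continuous semigroup `T` is generated by the operator with graph `G`. -/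
def Generates (G : Set (X × X)) (T : ℝ → X →L[ℝ] X) : Prop :=
  IsC0Semigroup T ∧ generator (fun t x => T t x) = G

/-- Mild solutions on `[0, ∞)` of `z' = G z`, `z 0 = x₀`: `z` is continuous, and for all `t ≥ 0` the
integral `∫ s in 0..t, z s` lies in the domain and `z t = x₀ + G (∫ s in 0..t, z s)`. -/
def IsMildSolution (G : Set (X × X)) (x₀ : X) (z : ℝ → X) : Prop :=
  ContinuousOn z (Ici 0) ∧ ∀ t : ℝ, 0 ≤ t → (∫ s in (0 : ℝ)..t, z s, z t - x₀) ∈ G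

end Abstract

/-! ### The plane, `L¹` and the velocity field -/

/-- The Euclidean plane. -/
abbrev Plane : Type := EuclideanSpace ℝ (Fin 2)

/-- The real space `L¹(ℝ²)`. -/
abbrev L1 : Type := Lp ℝ 1 (volume : Measure Plane)

open Classical in
/-- The class in `L¹(ℝ²)` of an integrable function (`0` if the function is not integrable). -/
def toL1 (f : Plane → ℝ) : L1 :=
  if h : Integrable f volume then h.toL1 f else 0

/-- The partial derivative `∂F / ∂xᵢ`. -/
def partialDeriv (i : Fin 2) (F : Plane → Plane) (x : Plane) : Plane :=
  fderiv ℝ F x (EuclideanSpace.single i 1)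

/-- The divergence `∂₁ F₁ + ∂₂ F₂`. -/
def divergence (F : Plane → Plane) (x : Plane) : ℝ := ∑ i, partialDeriv i F x i

/-- The standing assumption on a velocity field `F : ℝ² → ℝ²`: it is bounded, uniformly continuous
and `C¹`, with bounded and uniformly continuous first partial derivatives. -/
structure Admissible (F : Plane → Plane) : Prop where
  uniformContinuous : UniformContinuous F
  bounded : ∃ M : ℝ, ∀ x, ‖F x‖ ≤ M
  contDiff : ContDiff ℝ 1 F
  bounded_deriv : ∀ i, ∃ M : ℝ, ∀ x, ‖partialDeriv i F x‖ ≤ M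
  uniformContinuous_deriv : ∀ i, UniformContinuous (partialDeriv i F)

/-! ### Diffusion -/

/-- The heat kernel `K(t, x) = exp (-|x|² / (4 ε² t)) / (4 π ε² t)` on the plane. -/
def heatKernel (ε t : ℝ) (x : Plane) : ℝ :=
  1 / (4 * Real.pi * ε ^ 2 * t) * Real.exp (-‖x‖ ^ 2 / (4 * ε ^ 2 * t))

/-- The heat semigroup on `L¹(ℝ²)`: convolution with the heat kernel for `t > 0`, and the identity
for `t = 0`. -/
def heatSemigroup (ε t : ℝ) (v : L1) : L1 :=
  if 0 < t then toL1 (fun x => ∫ z, heatKernel ε t (x - z) * v z) else v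

/-- The operator `A`, the realization of `ε² Δ` in `L¹(ℝ²)`: the generator of the heat semigroup. -/
def diffusionOp (ε : ℝ) : Set (L1 × L1) := generator (heatSemigroup ε)

/-! ### Convection -/

/-- `Φ` is the global flow of the velocity field `F`. -/
def IsFlow (F : Plane → Plane) (Φ : ℝ → Plane → Plane) : Prop :=
  ∀ z, Φ 0 z = z ∧ ∀ t, HasDerivAt (fun s => Φ s z) (F (Φ t z)) t

open Classical in
/-- The flow of `F`. It exists and is unique for Lipschitz fields, in particular for admissible
ones; the default value is irrelevant. -/
def flow (F : Plane → Plane) : ℝ → Plane → Plane :=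
  if h : ∃ Φ, IsFlow F Φ then h.choose else fun _ z => z

/-- The transport semigroup on `L¹(ℝ²)`: integration of `∂ₜ v = - ∇ · (v F)` along the
characteristics. -/
def transportSemigroup (F : Plane → Plane) (t : ℝ) (v : L1) : L1 :=
  toL1 (fun x => Real.exp (-∫ s in (0 : ℝ)..t, divergence F (flow F (-s) x)) * v (flow F (-t) x))

/-- The operator `B`, the realization of `v ↦ - ∇ · (v F)` in `L¹(ℝ²)`: the generator of the
transport semigroup. -/
def convectionOp (F : Plane → Plane) : Set (L1 × L1) := generator (transportSemigroup F)

/-- The operator `A + B` for the motion of travelers. -/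
def travelOp (ε : ℝ) (F : Plane → Plane) : Set (L1 × L1) :=
  opAdd (diffusionOp ε) (convectionOp F)

/-! ### The three-compartment model -/

/-- The Gaussian density centered at `0` with standard deviation `σ` on the plane. -/
def gaussian (σ : ℝ) (x : Plane) : ℝ :=
  1 / (2 * Real.pi * σ ^ 2) * Real.exp (-‖x‖ ^ 2 / (2 * σ ^ 2))

/-- The phase space `X = ℝ × L¹(ℝ²) × L¹(ℝ²)`. The norm is the maximum of the three norms, which is
equivalent to their sum. -/
abbrev State : Type := ℝ × L1 × L1

/-- The operator `𝒜 (u, v, w) = (-γ u, (A + B) v - α v, α v - χ w)`. -/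
def uncoupledOp (ε α γ χ : ℝ) (F : Plane → Plane) : Set (State × State) :=
  {p | ∃ f : L1, (p.1.2.1, f) ∈ travelOp ε F ∧
    p.2 = (-γ * p.1.1, f - α • p.1.2.1, α • p.1.2.1 - χ • p.1.2.2)}

/-- The operator `𝒞 (u, v, w) = (χ ∫ w(x) dx, γ g(· - y) u, 0)`. -/
def couplingOp (σ γ χ : ℝ) (y : Plane) (p : State) : State :=
  (χ * ∫ x, p.2.2 x, (γ * p.1) • toL1 (fun x => gaussian σ (x - y)), 0)

/-- The operator `𝒜 + 𝒞`. -/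
def fullOp (ε σ α γ χ : ℝ) (F : Plane → Plane) (y : Plane) : Set (State × State) :=
  opAdd (uncoupledOp ε α γ χ F) (graphOf (couplingOp σ γ χ y))

/-- The right-hand side of the differential system, at a state `(u, v, w)` whose second component is
a `C²` function with compact support:
`(χ ∫ w - γ u, ε² Δ v - ∇ · (v F) - α v + γ g(· - y) u, α v - χ w)`. -/
def systemRHS (ε σ α γ χ : ℝ) (F : Plane → Plane) (y : Plane)
    (u : ℝ) (v : Plane → ℝ) (w : L1) : State :=
  (χ * (∫ x, w x) - γ * u,
    toL1 (fun x => ε ^ 2 * Laplacian.laplacian v x - divergence (fun x' => v x' • F x') x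
      - α * v x + γ * gaussian σ (x - y) * u),
    α • toL1 v - χ • w)

/-- The variation of constants formula, for a semigroup `T` perturbed by the map `K`. -/
def VariationOfConstants (T : ℝ → State →L[ℝ] State) (K : State → State) (x₀ : State)
    (z : ℝ → State) : Prop :=
  ∀ t : ℝ, 0 ≤ t → z t = T t x₀ + ∫ s in (0 : ℝ)..t, T (t - s) (K (z s))

/-- The variation of constants formulas for the three components `z = (u, v, w)`, where `S` is the
semigroup generated by `A + B`, so that `exp (-α t) S(t)` is generated by `A + B - α`. -/
def ComponentFormulas (σ α γ χ : ℝ) (y : Plane) (S : ℝ → L1 →L[ℝ] L1) (x₀ : State)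
    (z : ℝ → State) : Prop :=
  ∀ t : ℝ, 0 ≤ t →
    (z t).1 = Real.exp (-γ * t) * x₀.1
      + (∫ s in (0 : ℝ)..t, Real.exp (-γ * (t - s)) * (χ * ∫ x, (z s).2.2 x)) ∧
    (z t).2.1 = Real.exp (-α * t) • S t x₀.2.1
      + (∫ s in (0 : ℝ)..t, Real.exp (-α * (t - s)) •
          S (t - s) ((γ * (z s).1) • toL1 (fun x => gaussian σ (x - y)))) ∧
    (z t).2.2 = Real.exp (-χ * t) • x₀.2.2
      + (∫ s in (0 : ℝ)..t, (Real.exp (-χ * (t - s)) * α) • (z s).2.1)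

end

end ReturnHome

/-! The only real difficulty is that `A + B` generates a semigroup although `B` is unbounded. Let
`T` be the heat semigroup. Differentiating a Gaussian costs only a factor of order s^(-1/2), so `T
s` maps L¹ into the domain of `B` for s > 0, with ‖B T(s)‖ ≤ D + D/√(4ε²s)
(`exists_convection_gaussConvolution`). This singularity is integrable. Hence the Volterra equation
S(t) = T(t) + ∫₀ᵗ S(t-s) B T(s) ds is a contraction in a norm with exponential weight, and it has
exactly one strongly continuous solution (`exists_volterra`, `eq_zero_of_volterra`).

Uniqueness for this equation gives the semigroup law for `S`. Differentiating it at 0 shows that the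
generator of `S` extends `A + B`. The extension is not proper: for large μ, μ - A - B is onto, by a
truncated Laplace transform and a Neumann series, while μ minus the generator of `S` is injective.
This is `exists_perturbed_semigroup`; it covers bounded perturbations as well.

To apply it, `B` must be replaced by a closed operator. `transportGraph` consists of the pairs
satisfying the integrated transport equation; it is closed by construction, and the semigroup law of
the transport family is never needed. Its restriction to D(A) is that of `B`, since D(A) lies in its
domain and generators are single-valued. The transport operators are bounded on L¹ by a comparison
with Hausdorff measure, so the flow is never differentiated in space.

The model is a bounded perturbation of the diagonal operator (-γ, A + B - α, -χ): adding the
transition v ↦ αv gives 𝒜, and adding the coupling gives 𝒜 + 𝒞. Mild solutions are unique because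
T(t-s)Y(s) is constant in s for the primitive Y of a difference of two of them. The two variation of
constants formulas are equivalent because they view the same generator as a perturbation of 𝒜 and of
the diagonal operator, and each characterizes the same orbit. -/

namespace ReturnHome

noncomputable section

/-! ### Volterra equations for strongly continuous operator families -/

section VolterraEquation

variable {X : Type*} [NormedAddCommGroup X] [NormedSpace ℝ X]

/-- Strong continuity on `[0, ∞)` of a family of bounded operators. -/
def StronglyContinuous (U : ℝ → X →L[ℝ] X) : Prop :=
  ∀ x : X, ContinuousOn (fun t => U t x) (Ici 0)

lemma StronglyContinuous.exists_bound [CompleteSpace X] {U : ℝ → X →L[ℝ] X}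
    (hU : StronglyContinuous U) (τ : ℝ) : ∃ M, 0 ≤ M ∧ ∀ t ∈ Icc 0 τ, ‖U t‖ ≤ M := by
  obtain ⟨M, hM⟩ := banach_steinhaus (g := fun t : Icc (0 : ℝ) τ => U t) (fun x => by
    obtain ⟨C, hC⟩ := isCompact_Icc.exists_bound_of_continuousOn
      ((hU x).mono (Icc_subset_Ici_self : Icc 0 τ ⊆ Ici 0))
    exact ⟨C, fun t => hC t t.2⟩)
  exact ⟨max M 0, le_max_right _ _, fun t ht => (hM ⟨t, ht⟩).trans (le_max_left _ _)⟩

/-- Joint continuity: the local norm bound controls the change of the vector, strong continuity the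
change of time. -/
lemma StronglyContinuous.tendsto_apply [CompleteSpace X] {U : ℝ → X →L[ℝ] X}
    (hU : StronglyContinuous U) {α : Type*} {l : Filter α} {g : α → ℝ} {f : α → X} {t₀ : ℝ} {x₀ : X}
    (h₀ : 0 ≤ t₀) (hg : Tendsto g l (𝓝 t₀)) (hg₀ : ∀ᶠ a in l, 0 ≤ g a)
    (hf : Tendsto f l (𝓝 x₀)) : Tendsto (fun a => U (g a) (f a)) l (𝓝 (U t₀ x₀)) := by
  obtain ⟨M, hM0, hM⟩ := hU.exists_bound (t₀ + 1)
  have h1 : Tendsto (fun a => U (g a) x₀) l (𝓝 (U t₀ x₀)) :=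
    (hU x₀ t₀ h₀).tendsto.comp (tendsto_nhdsWithin_iff.2 ⟨hg, hg₀⟩)
  have h2 : Tendsto (fun a => U (g a) (f a - x₀)) l (𝓝 0) := by
    have h3 : Tendsto (fun a => M * ‖f a - x₀‖) l (𝓝 0) := by
      have := (hf.sub_const x₀).norm.const_mul M
      simpa using this
    refine squeeze_zero_norm' ?_ h3
    filter_upwards [hg₀, hg.eventually (gt_mem_nhds (lt_add_one t₀))] with a ha ha'
    exact (U (g a)).le_of_opNorm_le (hM _ ⟨ha, ha'.le⟩) _
  simpa using h2.add h1

lemma StronglyContinuous.continuousOn_apply [CompleteSpace X] {U : ℝ → X →L[ℝ] X}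
    (hU : StronglyContinuous U) {α : Type*} [TopologicalSpace α] {s : Set α} {g : α → ℝ} {f : α → X}
    (hg : ContinuousOn g s) (hg₀ : ∀ a ∈ s, 0 ≤ g a) (hf : ContinuousOn f s) :
    ContinuousOn (fun a => U (g a) (f a)) s := fun a ha =>
  hU.tendsto_apply (hg₀ a ha) (hg a ha) (eventually_mem_nhdsWithin.mono hg₀) (hf a ha)

/-- A family `P s`, `s > 0`, of bounded operators that is strongly continuous and bounded in norm by
a locally integrable function. -/
structure IsIntegrableFamily (P : ℝ → X →L[ℝ] X) (k : ℝ → ℝ) : Prop where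
  continuousOn : ∀ x, ContinuousOn (fun s => P s x) (Ioi 0)
  norm_le : ∀ s, 0 < s → ‖P s‖ ≤ k s
  integrableOn : ∀ τ, IntegrableOn k (Ioc 0 τ)

variable {P : ℝ → X →L[ℝ] X} {k : ℝ → ℝ}

lemma IsIntegrableFamily.nonneg (hP : IsIntegrableFamily P k) {s : ℝ} (hs : 0 < s) : 0 ≤ k s :=
  (norm_nonneg _).trans (hP.norm_le s hs)

lemma IsIntegrableFamily.integrableOn_apply (hP : IsIntegrableFamily P k) (x : X) (τ : ℝ) :
    IntegrableOn (fun s => P s x) (Ioc 0 τ) := by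
  refine Integrable.mono' ((hP.integrableOn τ).mul_const ‖x‖)
    (((hP.continuousOn x).mono Ioc_subset_Ioi_self).aestronglyMeasurable measurableSet_Ioc) ?_
  filter_upwards [ae_restrict_mem measurableSet_Ioc] with s hs
  exact (P s).le_of_opNorm_le (hP.norm_le s hs.1) x

/-- By dominated convergence, an exponential weight makes the mass of the kernel on a bounded
interval arbitrarily small. This is what turns the Volterra operator into a contraction. -/
lemma IsIntegrableFamily.exists_weight (hP : IsIntegrableFamily P k) (τ : ℝ) {q : ℝ} (hq : 0 < q) :
    ∃ l₀ : ℝ, ∀ l ≥ l₀, ∫ s in Ioc 0 τ, Real.exp (-l * s) * k s ≤ q := by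
  have h : Tendsto (fun l : ℝ => ∫ s in Ioc 0 τ, Real.exp (-l * s) * k s) atTop
      (𝓝 (∫ s in Ioc 0 τ, (0 : ℝ))) := by
    refine tendsto_integral_filter_of_dominated_convergence k ?_ ?_ (hP.integrableOn τ) ?_
    · refine Eventually.of_forall fun l => AEStronglyMeasurable.mul ?_ (hP.integrableOn τ).1
      exact (by fun_prop : Continuous fun s : ℝ => Real.exp (-l * s)).aestronglyMeasurable
    · filter_upwards [eventually_ge_atTop 0] with l hl
      filter_upwards [ae_restrict_mem measurableSet_Ioc] with s hs
      rw [norm_mul, Real.norm_of_nonneg (Real.exp_pos _).le, Real.norm_of_nonneg (hP.nonneg hs.1)]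
      refine mul_le_of_le_one_left (hP.nonneg hs.1) (Real.exp_le_one_iff.2 ?_)
      have := mul_nonneg hl hs.1.le
      linarith
    · filter_upwards [ae_restrict_mem measurableSet_Ioc] with s hs
      have h1 : Tendsto (fun l : ℝ => Real.exp (-(l * s))) atTop (𝓝 0) :=
        Real.tendsto_exp_neg_atTop_nhds_zero.comp (tendsto_id.atTop_mul_const hs.1)
      simpa using h1.mul_const (k s)
  rw [integral_zero] at h
  exact eventually_atTop.1 (h.eventually (ge_mem_nhds hq))

/-- Since exp(l(t-s)) = exp(lt) exp(-ls), convolution with `P` multiplies a bound in the weighted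
norm by the weighted mass of `k`. -/
lemma IsIntegrableFamily.norm_convolution_le (hP : IsIntegrableFamily P k)
    {U : ℝ → X →L[ℝ] X} {a l q τ : ℝ} (ha : 0 ≤ a)
    (hU : ∀ t ∈ Icc 0 τ, ‖U t‖ ≤ a * Real.exp (l * t))
    (hq : ∫ s in Ioc 0 τ, Real.exp (-l * s) * k s ≤ q) {t : ℝ} (ht : t ∈ Icc 0 τ) (x : X) :
    ‖∫ s in Ioc 0 t, U (t - s) (P s x)‖ ≤ a * q * Real.exp (l * t) * ‖x‖ := by
  have hint : ∀ r, IntegrableOn (fun s => Real.exp (-l * s) * k s) (Ioc 0 r) := by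
    intro r
    have h := IntegrableOn.continuousOn_mul (K := Icc 0 r)
      (g := fun s => Real.exp (-l * s)) (g' := k) (μ := volume) (by fun_prop)
      (by rw [integrableOn_Icc_iff_integrableOn_Ioc]; exact hP.integrableOn r) isCompact_Icc
    exact h.mono_set Ioc_subset_Icc_self
  have h1 : ‖∫ s in Ioc 0 t, U (t - s) (P s x)‖ ≤
      ∫ s in Ioc 0 t, (a * Real.exp (l * t) * ‖x‖) * (Real.exp (-l * s) * k s) := by
    refine norm_integral_le_of_norm_le ((hint t).const_mul _) ?_
    filter_upwards [ae_restrict_mem measurableSet_Ioc] with s hs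
    have h2 := (U (t - s)).le_of_opNorm_le
      (hU _ ⟨sub_nonneg.2 hs.2, by linarith [hs.1, ht.2]⟩) (P s x)
    have h3 := (P s).le_of_opNorm_le (hP.norm_le s hs.1) x
    refine h2.trans ((mul_le_mul_of_nonneg_left h3 (by positivity)).trans (le_of_eq ?_))
    rw [mul_sub, Real.exp_sub, neg_mul, Real.exp_neg]
    field_simp
  have h4 : ∫ s in Ioc 0 t, Real.exp (-l * s) * k s ≤ q := by
    refine (setIntegral_mono_set (hint τ) ?_ (Ioc_subset_Ioc_right ht.2).eventuallyLE).trans hq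
    filter_upwards [ae_restrict_mem measurableSet_Ioc] with s hs
    exact mul_nonneg (Real.exp_pos _).le (hP.nonneg hs.1)
  rw [integral_const_mul] at h1
  refine h1.trans ((mul_le_mul_of_nonneg_left h4 (by positivity)).trans (le_of_eq (by ring)))

variable [CompleteSpace X]

lemma IsIntegrableFamily.continuousOn_convolution (hP : IsIntegrableFamily P k)
    {U : ℝ → X →L[ℝ] X} (hU : StronglyContinuous U) (t : ℝ) (x : X) :
    ContinuousOn (fun s => U (t - s) (P s x)) (Ioc 0 t) :=
  hU.continuousOn_apply (by fun_prop) (fun s hs => sub_nonneg.2 hs.2)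
    ((hP.continuousOn x).mono Ioc_subset_Ioi_self)

lemma IsIntegrableFamily.integrableOn_convolution (hP : IsIntegrableFamily P k)
    {U : ℝ → X →L[ℝ] X} (hU : StronglyContinuous U) (t : ℝ) (x : X) :
    IntegrableOn (fun s => U (t - s) (P s x)) (Ioc 0 t) := by
  obtain ⟨M, hM0, hM⟩ := hU.exists_bound t
  refine Integrable.mono' (((hP.integrableOn t).mul_const ‖x‖).const_mul M)
    ((hP.continuousOn_convolution hU t x).aestronglyMeasurable measurableSet_Ioc) ?_
  filter_upwards [ae_restrict_mem measurableSet_Ioc] with s hs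
  have h1 := (P s).le_of_opNorm_le (hP.norm_le s hs.1) x
  exact ((U (t - s)).le_of_opNorm_le (hM _ ⟨sub_nonneg.2 hs.2, by linarith [hs.1]⟩) _).trans
    (mul_le_mul_of_nonneg_left h1 hM0)

/-- The Volterra convolution of `U` with `P`. -/
def convolution (U P : ℝ → X →L[ℝ] X) (hU : StronglyContinuous U) (hP : IsIntegrableFamily P k)
    (t : ℝ) : X →L[ℝ] X :=
  LinearMap.mkContinuousOfExistsBound
    { toFun := fun x => ∫ s in Ioc 0 t, U (t - s) (P s x)
      map_add' := fun x y => by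
        simp only [map_add]
        exact integral_add (hP.integrableOn_convolution hU t x) (hP.integrableOn_convolution hU t y)
      map_smul' := fun c x => by
        simp only [map_smul, RingHom.id_apply]
        exact integral_smul c _ }
    (by
      rcases lt_or_ge t 0 with ht | ht
      · exact ⟨0, fun x => by simp [Ioc_eq_empty (not_lt.2 ht.le)]⟩
      · obtain ⟨M, hM0, hM⟩ := hU.exists_bound t
        refine ⟨_, hP.norm_convolution_le (l := 0) (τ := t) hM0 (by simpa using hM) le_rfl
          ⟨ht, le_rfl⟩⟩)

lemma convolution_apply {U P : ℝ → X →L[ℝ] X} (hU : StronglyContinuous U)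
    (hP : IsIntegrableFamily P k) (t : ℝ) (x : X) :
    convolution U P hU hP t x = ∫ s in Ioc 0 t, U (t - s) (P s x) := rfl

lemma stronglyContinuous_convolution {U P : ℝ → X →L[ℝ] X} (hU : StronglyContinuous U)
    (hP : IsIntegrableFamily P k) : StronglyContinuous (convolution U P hU hP) := by
  intro x t₀ ht₀
  obtain ⟨M, hM0, hM⟩ := hU.exists_bound (t₀ + 1)
  -- The moving endpoint is absorbed into an indicator, so that dominated convergence applies on a
  -- fixed interval.
  let F : ℝ → ℝ → X := fun t => (Iic t).indicator (fun s => U (t - s) (P s x))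
  have hF : ∀ t ≤ t₀ + 1, convolution U P hU hP t x = ∫ s in Ioc 0 (t₀ + 1), F t s := by
    intro t ht
    rw [convolution_apply, setIntegral_indicator measurableSet_Iic]
    congr 2
    ext s
    simp only [mem_Ioc, mem_inter_iff, mem_Iic]
    constructor
    · rintro ⟨h1, h2⟩; exact ⟨⟨h1, by linarith⟩, h2⟩
    · rintro ⟨⟨h1, -⟩, h2⟩; exact ⟨h1, h2⟩
  have hnear : ∀ᶠ t in 𝓝[Ici 0] t₀, t ∈ Icc 0 (t₀ + 1) := by
    filter_upwards [self_mem_nhdsWithin,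
      mem_nhdsWithin_of_mem_nhds (gt_mem_nhds (lt_add_one t₀))] with t h1 h2 using ⟨h1, le_of_lt h2⟩
  have key : ContinuousWithinAt (fun t => ∫ s in Ioc 0 (t₀ + 1), F t s) (Ici 0) t₀ := by
    refine continuousWithinAt_of_dominated (bound := fun s => M * (k s * ‖x‖)) ?_ ?_
      (((hP.integrableOn (t₀ + 1)).mul_const ‖x‖).const_mul M) ?_
    · filter_upwards [hnear] with t ht
      rw [aestronglyMeasurable_indicator_iff measurableSet_Iic,
        Measure.restrict_restrict measurableSet_Iic]
      refine (hP.continuousOn_convolution hU t x).mono ?_ |>.aestronglyMeasurable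
        (measurableSet_Iic.inter measurableSet_Ioc)
      rintro s ⟨h1, h2⟩
      exact ⟨h2.1, h1⟩
    · filter_upwards [hnear] with t ht
      filter_upwards [ae_restrict_mem measurableSet_Ioc] with s hs
      have hk := hP.nonneg hs.1
      by_cases hst : s ≤ t
      · rw [show F t s = U (t - s) (P s x) from indicator_of_mem (by exact hst) _]
        have h1 := (P s).le_of_opNorm_le (hP.norm_le s hs.1) x
        exact ((U (t - s)).le_of_opNorm_le
          (hM _ ⟨sub_nonneg.2 hst, by linarith [hs.1, ht.2]⟩) _).trans
          (mul_le_mul_of_nonneg_left h1 hM0)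
      · rw [show F t s = 0 from indicator_of_notMem (by exact hst) _, norm_zero]
        positivity
    -- For fixed s the integrand may jump as t crosses s; at t₀ this affects only the null set s =
    -- t₀.
    · have hne : ∀ᵐ s ∂(volume.restrict (Ioc 0 (t₀ + 1))), s ≠ t₀ :=
        ae_restrict_of_ae (compl_mem_ae_iff.2 (measure_singleton t₀))
      filter_upwards [ae_restrict_mem measurableSet_Ioc, hne] with s hs hne
      rcases lt_or_gt_of_ne hne with h | h
      · have h1 : ContinuousWithinAt (fun t => U (t - s) (P s x)) (Ici 0) t₀ := by
          refine hU.tendsto_apply (sub_nonneg.2 h.le) ?_ ?_ tendsto_const_nhds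
          · exact (continuous_id.sub continuous_const).continuousWithinAt
          · filter_upwards [mem_nhdsWithin_of_mem_nhds (lt_mem_nhds h)] with t ht
            exact sub_nonneg.2 (le_of_lt ht)
        refine h1.congr_of_eventuallyEq ?_ (indicator_of_mem (by exact h.le) _)
        filter_upwards [mem_nhdsWithin_of_mem_nhds (lt_mem_nhds h)] with t ht
        exact indicator_of_mem (by exact le_of_lt ht) _
      · refine (continuousWithinAt_const (b := (0 : X))).congr_of_eventuallyEq ?_
          (indicator_of_notMem (by exact not_le.2 h) _)
        filter_upwards [mem_nhdsWithin_of_mem_nhds (gt_mem_nhds h)] with t ht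
        exact indicator_of_notMem (by exact not_le.2 ht) _
  refine key.congr_of_eventuallyEq ?_ (hF t₀ (by linarith))
  filter_upwards [hnear] with t ht using hF t ht.2

/-- The powers of the Volterra operator, applied to `T`. -/
def dysonTerm (T P : ℝ → X →L[ℝ] X) (hT : StronglyContinuous T) (hP : IsIntegrableFamily P k) :
    ℕ → {U : ℝ → X →L[ℝ] X // StronglyContinuous U}
  | 0 => ⟨T, hT⟩
  | n + 1 => ⟨convolution (dysonTerm T P hT hP n).1 P (dysonTerm T P hT hP n).2 hP,
      stronglyContinuous_convolution (dysonTerm T P hT hP n).2 hP⟩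

/-- With the weight chosen so that the kernel has mass at most 1/2, every convolution halves the
weighted norm. -/
lemma exists_dysonTerm_bound {T P : ℝ → X →L[ℝ] X} (hT : StronglyContinuous T)
    (hP : IsIntegrableFamily P k) (τ : ℝ) :
    ∃ C, 0 ≤ C ∧ ∀ n, ∀ t ∈ Icc 0 τ, ‖(dysonTerm T P hT hP n).1 t‖ ≤ C * (1 / 2) ^ n := by
  obtain ⟨M, hM0, hM⟩ := hT.exists_bound τ
  obtain ⟨l₀, hl₀⟩ := hP.exists_weight τ (q := 1 / 2) (by norm_num)
  set l := max l₀ 0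
  have hl : 0 ≤ l := le_max_right _ _
  have key : ∀ n, ∀ t ∈ Icc 0 τ,
      ‖(dysonTerm T P hT hP n).1 t‖ ≤ M * (1 / 2) ^ n * Real.exp (l * t) := by
    intro n
    induction n with
    | zero =>
      intro t ht
      refine (hM t ht).trans ?_
      simpa using le_mul_of_one_le_right hM0 (Real.one_le_exp (mul_nonneg hl ht.1))
    | succ n ih =>
      intro t ht
      refine ContinuousLinearMap.opNorm_le_bound _ (by positivity) fun x => ?_
      refine (hP.norm_convolution_le (by positivity) ih (hl₀ l (le_max_left _ _)) ht x).trans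
        (le_of_eq ?_)
      rw [pow_succ, mul_assoc M]
  refine ⟨M * Real.exp (l * τ), by positivity, fun n t ht => (key n t ht).trans ?_⟩
  rw [mul_assoc, mul_assoc, mul_comm (Real.exp (l * τ))]
  gcongr
  exact ht.2

/-- A strongly continuous solution of the homogeneous Volterra equation vanishes. -/
lemma eq_zero_of_volterra {D P : ℝ → X →L[ℝ] X} (hD : StronglyContinuous D)
    (hP : IsIntegrableFamily P k)
    (h : ∀ t, 0 ≤ t → ∀ x, D t x = ∫ s in Ioc 0 t, D (t - s) (P s x)) {t : ℝ} (ht : 0 ≤ t) :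
    D t = 0 := by
  obtain ⟨C, hC0, hC⟩ := exists_dysonTerm_bound hD hP t
  -- `D` is a fixed point of the Volterra operator, so all its iterates equal `D`, while their norms
  -- decay geometrically.
  have key : ∀ n, ∀ r, 0 ≤ r → (dysonTerm D P hD hP n).1 r = D r := by
    intro n
    induction n with
    | zero => intro r _; rfl
    | succ n ih =>
      intro r hr
      ext x
      rw [h r hr]
      refine (convolution_apply (dysonTerm D P hD hP n).2 hP r x).trans ?_
      refine setIntegral_congr_fun measurableSet_Ioc fun s hs => ?_
      simp only [ih (r - s) (sub_nonneg.2 hs.2)]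
  have h1 : Tendsto (fun n : ℕ => C * (1 / 2 : ℝ) ^ n) atTop (𝓝 0) := by
    simpa using (tendsto_pow_atTop_nhds_zero_of_lt_one (r := (1 / 2 : ℝ))
      (by norm_num) (by norm_num)).const_mul C
  have h2 : ‖D t‖ ≤ 0 := ge_of_tendsto' h1 fun n => by
    rw [← key n t ht]; exact hC n t ⟨ht, le_rfl⟩
  exact norm_le_zero_iff.1 h2

/-- The Volterra equation `S = T + S * P` has a strongly continuous solution. -/
lemma exists_volterra {T P : ℝ → X →L[ℝ] X} (hT : StronglyContinuous T)
    (hP : IsIntegrableFamily P k) :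
    ∃ S : ℝ → X →L[ℝ] X, StronglyContinuous S ∧
      ∀ t, 0 ≤ t → ∀ x, S t x = T t x + ∫ s in Ioc 0 t, S (t - s) (P s x) := by
  set D : ℕ → ℝ → X →L[ℝ] X := fun n => (dysonTerm T P hT hP n).1 with hDdef
  have hDc : ∀ n, StronglyContinuous (D n) := fun n => (dysonTerm T P hT hP n).2
  have hgeo : Summable fun n : ℕ => (1 / 2 : ℝ) ^ n :=
    summable_geometric_of_lt_one (by norm_num) (by norm_num)
  have hsum : ∀ t, 0 ≤ t → Summable fun n => D n t := by
    intro t ht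
    obtain ⟨C, hC0, hC⟩ := exists_dysonTerm_bound hT hP t
    exact Summable.of_norm_bounded (hgeo.mul_left C) fun n => hC n t ⟨ht, le_rfl⟩
  have happ : ∀ t, 0 ≤ t → ∀ x, HasSum (fun n => D n t x) ((∑' n, D n t) x) := fun t ht x =>
    (ContinuousLinearMap.apply ℝ X x).hasSum (hsum t ht).hasSum
  refine ⟨fun t => ∑' n, D n t, ?_, ?_⟩
  · intro x t₀ ht₀
    obtain ⟨C, hC0, hC⟩ := exists_dysonTerm_bound hT hP (t₀ + 1)
    have h1 : ContinuousOn (fun t => ∑' n, D n t x) (Icc 0 (t₀ + 1)) := by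
      refine continuousOn_tsum (u := fun n => C * (1 / 2) ^ n * ‖x‖)
        (fun n => (hDc n x).mono Icc_subset_Ici_self) ((hgeo.mul_left C).mul_right _) ?_
      intro n t ht
      exact (D n t).le_of_opNorm_le (hC n t ht) x
    have h2 : ContinuousWithinAt (fun t => ∑' n, D n t x) (Ici 0) t₀ := by
      refine (h1 t₀ ⟨ht₀, by linarith⟩).mono_of_mem_nhdsWithin ?_
      filter_upwards [self_mem_nhdsWithin,
        mem_nhdsWithin_of_mem_nhds (gt_mem_nhds (lt_add_one t₀))] with t h1 h2
      exact ⟨h1, le_of_lt h2⟩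
    exact h2.congr (fun t ht => (happ t ht x).tsum_eq.symm) (happ t₀ ht₀ x).tsum_eq.symm
  · intro t ht x
    obtain ⟨C, hC0, hC⟩ := exists_dysonTerm_bound hT hP t
    have h1 : HasSum (fun n => ∫ s in Ioc 0 t, D n (t - s) (P s x))
        (∫ s in Ioc 0 t, (∑' n, D n (t - s)) (P s x)) := by
      refine hasSum_integral_of_dominated_convergence
        (fun n s => C * (1 / 2) ^ n * (k s * ‖x‖)) ?_ ?_ ?_ ?_ ?_
      · exact fun n => (hP.integrableOn_convolution (hDc n) t x).1
      · intro n
        filter_upwards [ae_restrict_mem measurableSet_Ioc] with s hs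
        have h1 := (P s).le_of_opNorm_le (hP.norm_le s hs.1) x
        exact ((D n (t - s)).le_of_opNorm_le
          (hC n _ ⟨sub_nonneg.2 hs.2, by linarith [hs.1]⟩) _).trans
          (mul_le_mul_of_nonneg_left h1 (by positivity))
      · exact Eventually.of_forall fun s => (hgeo.mul_left C).mul_right _
      · simp only [tsum_mul_right]
        exact ((hP.integrableOn t).mul_const ‖x‖).const_mul _
      · filter_upwards [ae_restrict_mem measurableSet_Ioc] with s hs
        exact happ _ (sub_nonneg.2 hs.2) _
    -- By definition the convolution of the n-th term is the (n+1)-st, so convolving the series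
    -- shifts it by one; the missing zeroth term is `T`.
    have h2 : HasSum (fun n => D (n + 1) t x) (∫ s in Ioc 0 t, (∑' n, D n (t - s)) (P s x)) := h1
    have h3 := (hasSum_nat_add_iff (f := fun n => D n t x) 1).1 h2
    rw [← (happ t ht x).unique h3 |>.symm]
    simp only [Finset.range_one, Finset.sum_singleton]
    rw [add_comm]
    rfl

end VolterraEquation

end

end ReturnHome

namespace ReturnHome

noncomputable section

/-! ### Generators and uniqueness of mild solutions -/

section Semigroups

variable {X : Type*} [NormedAddCommGroup X] [NormedSpace ℝ X]

lemma tendsto_slope_iff_hasDerivWithinAt_Ici {f : ℝ → X} {f' : X} {t : ℝ} :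
    Tendsto (fun h : ℝ => h⁻¹ • (f (t + h) - f t)) (𝓝[>] 0) (𝓝 f') ↔
      HasDerivWithinAt f f' (Ici t) t := by
  rw [← hasDerivWithinAt_Ioi_iff_Ici, hasDerivWithinAt_iff_tendsto_slope' self_notMem_Ioi]
  have h : 𝓝[>] t = map (fun h => t + h) (𝓝[>] 0) := by
    simp
  rw [h, tendsto_map'_iff]
  refine tendsto_congr fun h => ?_
  simp [slope_def_module]

lemma hasDerivWithinAt_integral_Ici [CompleteSpace X] {f : ℝ → X} (hf : ContinuousOn f (Ici 0))
    {t : ℝ} (ht : 0 ≤ t) :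
    HasDerivWithinAt (fun u => ∫ s in (0 : ℝ)..u, f s) (f t) (Ici t) t := by
  have hsub : Ioi t ⊆ Ici 0 := fun s hs => ht.trans (le_of_lt hs)
  refine intervalIntegral.integral_hasDerivWithinAt_right (t := Ioi t) ?_ ?_ ?_
  · exact (hf.mono (by rw [uIcc_of_le ht]; exact Icc_subset_Ici_self)).intervalIntegrable
  · exact ⟨Ioi t, self_mem_nhdsWithin, (hf.mono hsub).aestronglyMeasurable measurableSet_Ioi⟩
  · exact (hf t ht).mono hsub

lemma intervalIntegrable_of_continuousOn_Ici {E : Type*} [NormedAddCommGroup E] {f : ℝ → E} (hf : ContinuousOn f (Ici 0))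
    {s t : ℝ} (hs : 0 ≤ s) (ht : 0 ≤ t) : IntervalIntegrable f volume s t :=
  (hf.mono fun _ hu => le_trans (le_min hs ht) hu.1).intervalIntegrable

lemma continuousOn_integral_Ici {f : ℝ → X} (hf : ContinuousOn f (Ici 0)) (τ : ℝ) :
    ContinuousOn (fun u => ∫ s in (0 : ℝ)..u, f s) (Icc 0 τ) := by
  rcases lt_or_ge τ 0 with hτ | hτ
  · simp [Icc_eq_empty (not_le.2 hτ)]
  · have h := intervalIntegral.continuousOn_primitive_interval (μ := volume) (a := 0) (b := τ)
      (f := f) (by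
        rw [uIcc_of_le hτ]
        exact (hf.mono Icc_subset_Ici_self).integrableOn_Icc)
    rwa [uIcc_of_le hτ] at h

lemma generator_unique {T : ℝ → X → X} {x a b : X} (ha : (x, a) ∈ generator T)
    (hb : (x, b) ∈ generator T) : a = b :=
  tendsto_nhds_unique ha hb

/-- The right derivative at 0 of the integral is `T 0 a = a`. No semigroup law is needed, so the
criterion also serves for the transport family. -/
lemma mem_generator_of_sub_eq_integral [CompleteSpace X] {T : ℝ → X → X} {x a : X}
    (hc : ContinuousOn (fun t => T t a) (Ici 0)) (h₀ : T 0 a = a) {τ : ℝ} (hτ : 0 < τ)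
    (h : ∀ t ∈ Ioc 0 τ, T t x - x = ∫ s in (0 : ℝ)..t, T s a) : (x, a) ∈ generator T := by
  have h0 := tendsto_slope_iff_hasDerivWithinAt_Ici.2 (hasDerivWithinAt_integral_Ici hc le_rfl)
  rw [h₀] at h0
  refine h0.congr' ?_
  filter_upwards [Ioc_mem_nhdsGT hτ] with t ht
  simp [h t ht]

section Linear

variable {T : ℝ → X →L[ℝ] X} {x y a b : X}

lemma generator_add (h : (x, a) ∈ generator fun t x => T t x)
    (h' : (y, b) ∈ generator fun t x => T t x) :
    (x + y, a + b) ∈ generator fun t x => T t x := by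
  refine (Tendsto.add h h').congr fun t => ?_
  simp only [map_add, ← smul_add]
  congr 1; abel

lemma generator_smul (c : ℝ) (h : (x, a) ∈ generator fun t x => T t x) :
    (c • x, c • a) ∈ generator fun t x => T t x := by
  refine (Tendsto.const_smul h c).congr fun t => ?_
  simp only [map_smul, ← smul_sub]
  rw [smul_comm]

lemma generator_sub (h : (x, a) ∈ generator fun t x => T t x)
    (h' : (y, b) ∈ generator fun t x => T t x) :
    (x - y, a - b) ∈ generator fun t x => T t x := by
  simpa [sub_eq_add_neg] using generator_add h (generator_smul (-1) h')

end Linear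

namespace IsC0Semigroup

variable {T : ℝ → X →L[ℝ] X}

lemma stronglyContinuous (hT : IsC0Semigroup T) : StronglyContinuous T := hT.continuousOn

lemma zero_apply (hT : IsC0Semigroup T) (x : X) : T 0 x = x := by
  rw [hT.map_zero]; rfl

lemma add_apply (hT : IsC0Semigroup T) {s t : ℝ} (hs : 0 ≤ s) (ht : 0 ≤ t) (x : X) :
    T (s + t) x = T s (T t x) := by
  rw [hT.map_add s t hs ht]; rfl

lemma hasDerivWithinAt (hT : IsC0Semigroup T) {x a : X} (h : (x, a) ∈ generator fun t x => T t x)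
    {t : ℝ} (ht : 0 ≤ t) : HasDerivWithinAt (fun s => T s x) (T t a) (Ici t) t := by
  rw [← tendsto_slope_iff_hasDerivWithinAt_Ici]
  have h1 := ((T t).continuous.tendsto a).comp h
  refine h1.congr' ?_
  filter_upwards [self_mem_nhdsWithin] with s hs
  simp [hT.add_apply ht (le_of_lt hs)]

/-- The rescaled semigroup `exp (c t) T(t)`. -/
lemma exp_smul (hT : IsC0Semigroup T) (c : ℝ) :
    IsC0Semigroup fun t => Real.exp (c * t) • T t where
  map_zero := by simp [hT.map_zero]
  map_add s t hs ht := by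
    ext x
    simp [mul_add, Real.exp_add, hT.add_apply hs ht, smul_smul, mul_comm]
  continuousOn x := by
    simp only [smul_apply]
    exact (by fun_prop : Continuous fun t : ℝ => Real.exp (c * t)).continuousOn.smul
      (hT.continuousOn x)

lemma generator_exp_smul_of_mem (hT : IsC0Semigroup T) (c : ℝ) {x a : X}
    (h : (x, a) ∈ generator fun t x => T t x) :
    (x, a + c • x) ∈ generator fun t x => (Real.exp (c * t) • T t) x := by
  have h1 : HasDerivWithinAt (fun s => T s x) a (Ici 0) 0 := by
    simpa [hT.map_zero] using hT.hasDerivWithinAt h le_rfl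
  have h2 : HasDerivWithinAt (fun s => Real.exp (c * s)) c (Ici 0) 0 := by
    have := ((hasDerivAt_id (0 : ℝ)).const_mul c).exp.hasDerivWithinAt (s := Ici 0)
    simpa using this
  have h3 := h2.smul h1
  have h4 := tendsto_slope_iff_hasDerivWithinAt_Ici.2 h3
  refine (Tendsto.congr (fun t => ?_) h4 :)|>.trans (le_of_eq ?_)
  · simp [hT.zero_apply]
  · simp [hT.zero_apply]

variable [CompleteSpace X]

lemma sub_eq_integral (hT : IsC0Semigroup T) {x a : X} (h : (x, a) ∈ generator fun t x => T t x)
    {t : ℝ} (ht : 0 ≤ t) : T t x - x = ∫ s in (0 : ℝ)..t, T s a := by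
  refine eq_of_has_deriv_right_eq (a := 0) (b := t) (f := fun t => T t x - x)
    (g := fun t => ∫ s in (0 : ℝ)..t, T s a) (f' := fun t => T t a) ?_ ?_ ?_ ?_ ?_ t ⟨ht, le_rfl⟩
  · exact fun s hs => (hT.hasDerivWithinAt h hs.1).sub_const x
  · exact fun s hs => hasDerivWithinAt_integral_Ici (hT.continuousOn a) hs.1
  · exact ((hT.continuousOn x).mono Icc_subset_Ici_self).sub continuousOn_const
  · exact continuousOn_integral_Ici (hT.continuousOn a) t
  · simp [hT.zero_apply]

/-- `T h` shifts the integral over [0, t] to [h, t + h]; the difference is the integral over [t, t +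
h] minus that over [0, h], and division by h gives the two endpoint values. -/
lemma integral_mem_generator (hT : IsC0Semigroup T) (x : X) {t : ℝ} (ht : 0 ≤ t) :
    (∫ s in (0 : ℝ)..t, T s x, T t x - x) ∈ generator fun t x => T t x := by
  have hc := hT.continuousOn x
  have h1 := tendsto_slope_iff_hasDerivWithinAt_Ici.2 (hasDerivWithinAt_integral_Ici hc ht)
  have h0 := tendsto_slope_iff_hasDerivWithinAt_Ici.2 (hasDerivWithinAt_integral_Ici hc le_rfl)
  have h2 := h1.sub h0
  rw [hT.zero_apply] at h2
  refine h2.congr' ?_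
  filter_upwards [self_mem_nhdsWithin] with h hh
  have hh0 : (0 : ℝ) ≤ h := le_of_lt hh
  have h3 : T h (∫ s in (0 : ℝ)..t, T s x) = ∫ s in h..(t + h), T s x := by
    rw [← (T h).intervalIntegral_comp_comm (intervalIntegrable_of_continuousOn_Ici hc le_rfl ht)]
    have h4 := intervalIntegral.integral_comp_add_right (a := 0) (b := t) (fun s => T s x) h
    rw [zero_add] at h4
    rw [← h4]
    refine intervalIntegral.integral_congr fun s hs => ?_
    rw [uIcc_of_le ht] at hs
    simp only [add_comm s h, hT.add_apply hh0 hs.1]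
  have h5 := intervalIntegral.integral_add_adjacent_intervals
    (intervalIntegrable_of_continuousOn_Ici hc le_rfl hh0)
    (intervalIntegrable_of_continuousOn_Ici hc hh0 (by positivity : 0 ≤ t + h))
  rw [h3, ← smul_sub, ← h5, zero_add, intervalIntegral.integral_same]
  congr 1
  abel

lemma isMildSolution (hT : IsC0Semigroup T) (x : X) :
    IsMildSolution (generator fun t x => T t x) x fun t => T t x :=
  ⟨hT.continuousOn x, fun _ ht => hT.integral_mem_generator x ht⟩

/-- Mild solutions are unique. -/
lemma eqOn_of_isMildSolution (hT : IsC0Semigroup T) {x : X} {z z' : ℝ → X}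
    (hz : IsMildSolution (generator fun t x => T t x) x z)
    (hz' : IsMildSolution (generator fun t x => T t x) x z') : EqOn z z' (Ici 0) := by
  set w : ℝ → X := fun t => z t - z' t
  have hw : ContinuousOn w (Ici 0) := hz.1.sub hz'.1
  set Y : ℝ → X := fun t => ∫ s in (0 : ℝ)..t, w s with hY
  have hmem : ∀ t, 0 ≤ t → (Y t, w t) ∈ generator fun t x => T t x := by
    intro t ht
    have h := generator_sub (hz.2 t ht) (hz'.2 t ht)
    rw [← intervalIntegral.integral_sub (intervalIntegrable_of_continuousOn_Ici hz.1 le_rfl ht)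
      (intervalIntegrable_of_continuousOn_Ici hz'.1 le_rfl ht)] at h
    simpa [w] using h
  have hYd : ∀ t, 0 ≤ t → HasDerivWithinAt Y (w t) (Ici t) t := fun t ht =>
    hasDerivWithinAt_integral_Ici hw ht
  have hYc : ∀ t, ContinuousOn Y (Icc 0 t) := fun t => continuousOn_integral_Ici hw t
  have hY0 : ∀ t, 0 ≤ t → Y t = 0 := by
    intro t ht
    have hcont : ContinuousOn (fun s => T (t - s) (Y s)) (Icc 0 t) :=
      hT.stronglyContinuous.continuousOn_apply (by fun_prop) (fun s hs => sub_nonneg.2 hs.2) (hYc t)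
    -- Y'(s) = w(s) is the generator applied to Y(s), so the two contributions to the derivative of
    -- T(t-s)Y(s) cancel. Only right derivatives are available, and they suffice.
    have hder : ∀ s ∈ Ico 0 t, HasDerivWithinAt (fun s => T (t - s) (Y s)) 0 (Ici s) s := by
      intro s hs
      rw [← tendsto_slope_iff_hasDerivWithinAt_Ici]
      have h1 := tendsto_slope_iff_hasDerivWithinAt_Ici.2 (hYd s hs.1)
      have h2 := h1.sub (hmem s hs.1)
      have hsub : Tendsto (fun h : ℝ => t - s - h) (𝓝[>] 0) (𝓝 (t - s)) := by
        have : Tendsto (fun h : ℝ => t - s - h) (𝓝 0) (𝓝 (t - s - 0)) :=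
          (continuous_const.sub continuous_id).tendsto 0
        rw [sub_zero] at this
        exact this.mono_left nhdsWithin_le_nhds
      have hpos : ∀ᶠ h : ℝ in 𝓝[>] 0, 0 ≤ t - s - h :=
        (hsub.eventually (lt_mem_nhds (sub_pos.2 hs.2))).mono fun _ h => le_of_lt h
      have h3 := hT.stronglyContinuous.tendsto_apply (sub_nonneg.2 hs.2.le) hsub hpos h2
      rw [sub_self, _root_.map_zero] at h3
      refine h3.congr' ?_
      filter_upwards [hpos, self_mem_nhdsWithin] with h hh hh0
      have h4 : T (t - s) (Y s) = T (t - s - h) (T h (Y s)) := by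
        rw [← hT.add_apply hh (le_of_lt hh0)]; congr 2; ring
      rw [h4, ← smul_sub, map_smul, show t - (s + h) = t - s - h by ring, ← map_sub]
      congr 2
      abel
    have h := constant_of_has_deriv_right_zero hcont hder t ⟨ht, le_rfl⟩
    simpa [hT.zero_apply, hY] using h
  intro t ht
  -- Once Y vanishes, w t is a value of the generator at 0, hence 0.
  have h1 := hmem t ht
  rw [hY0 t ht] at h1
  have h2 : ((0 : X), (0 : X)) ∈ generator fun t x => T t x := by
    simp [generator]
  exact sub_eq_zero.1 (generator_unique h1 h2)

end IsC0Semigroup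

/-- A strongly continuous semigroup is determined by its generator. -/
lemma Generates.eq [CompleteSpace X] {G : Set (X × X)} {T T' : ℝ → X →L[ℝ] X}
    (hT : Generates G T) (hT' : Generates G T') {t : ℝ} (ht : 0 ≤ t) : T' t = T t := by
  ext x
  have h := hT.1.isMildSolution x
  have h' := hT'.1.isMildSolution x
  rw [hT'.2, ← hT.2] at h'
  exact hT.1.eqOn_of_isMildSolution h' h ht

end Semigroups

end

end ReturnHome

namespace ReturnHome

noncomputable section

/-! ### The perturbation theorem -/

section Perturbation

variable {X : Type*} [NormedAddCommGroup X] [NormedSpace ℝ X] [CompleteSpace X]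

/-- The integral of a function with values in a closed subspace lies in that subspace. -/
lemma integral_mem_of_isClosed {Ω E : Type*} [MeasurableSpace Ω] {μ : Measure Ω}
    [NormedAddCommGroup E] [NormedSpace ℝ E] [CompleteSpace E] {M : Submodule ℝ E}
    (hM : IsClosed (M : Set E)) {f : Ω → E} (hf : Integrable f μ) (h : ∀ᵐ a ∂μ, f a ∈ M) :
    ∫ a, f a ∂μ ∈ M := by
  have : IsClosed (M : Set E) := hM
  -- In the quotient, normed because `M` is closed, the integrand vanishes almost everywhere.
  have h1 := M.mkQL.integral_comp_comm hf
  rw [integral_eq_zero_of_ae] at h1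
  · exact (Submodule.Quotient.mk_eq_zero M).1 h1.symm
  · filter_upwards [h] with a ha
    exact (Submodule.Quotient.mk_eq_zero M).2 ha

/-- Used with `M` the graph of a closed operator: such an operator may be taken inside an integral.
-/
lemma integral_prodMk_mem_of_isClosed {Ω E F : Type*} [MeasurableSpace Ω] {μ : Measure Ω}
    [NormedAddCommGroup E] [NormedSpace ℝ E] [CompleteSpace E]
    [NormedAddCommGroup F] [NormedSpace ℝ F] [CompleteSpace F] {M : Submodule ℝ (E × F)}
    (hM : IsClosed (M : Set (E × F))) {f : Ω → E} {g : Ω → F} (hf : Integrable f μ)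
    (hg : Integrable g μ) (h : ∀ᵐ a ∂μ, (f a, g a) ∈ M) :
    (∫ a, f a ∂μ, ∫ a, g a ∂μ) ∈ M := by
  rw [← integral_pair hf hg]
  exact integral_mem_of_isClosed hM (hf.prodMk hg) h

variable {T : ℝ → X →L[ℝ] X} {R : Submodule ℝ (X × X)} {P : ℝ → X →L[ℝ] X} {k : ℝ → ℝ}

omit [CompleteSpace X] in
lemma eq_of_mem_of_mem (hR₀ : ∀ b, (0, b) ∈ R → b = 0) {x a b : X} (ha : (x, a) ∈ R)
    (hb : (x, b) ∈ R) : a = b := by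
  have h := R.sub_mem ha hb
  rw [Prod.mk_sub_mk, sub_self] at h
  exact sub_eq_zero.1 (hR₀ _ h)

omit [CompleteSpace X] in
-- Both sides are values at T(s+t)x of the single-valued relation `R`.
lemma smoothing_add_apply (hT : IsC0Semigroup T) (hR₀ : ∀ b, (0, b) ∈ R → b = 0)
    (hPR : ∀ s, 0 < s → ∀ x, (T s x, P s x) ∈ R) {s t : ℝ} (hs : 0 < s) (ht : 0 ≤ t) (x : X) :
    P (s + t) x = P s (T t x) := by
  refine eq_of_mem_of_mem hR₀ (hPR (s + t) (by positivity) x) ?_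
  rw [hT.add_apply hs.le ht]
  exact hPR s hs _

omit [CompleteSpace X] in
-- Strong continuity away from 0 comes for free: near s one has P(r) = P(s/2) T(r - s/2), a bounded
-- operator applied to an orbit of `T`.
lemma isIntegrableFamily_of_mem (hT : IsC0Semigroup T) (hR₀ : ∀ b, (0, b) ∈ R → b = 0)
    (hPR : ∀ s, 0 < s → ∀ x, (T s x, P s x) ∈ R) (hPk : ∀ s, 0 < s → ‖P s‖ ≤ k s)
    (hk : ∀ τ, IntegrableOn k (Ioc 0 τ)) : IsIntegrableFamily P k where
  continuousOn x s hs := by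
    have hs' : (0 : ℝ) < s := hs
    have h1 : ContinuousAt (fun r => T (r - s / 2) x) s := by
      have h2 : ContinuousAt (fun r => T r x) (s - s / 2) :=
        (hT.continuousOn x).continuousAt (Ici_mem_nhds (by linarith))
      exact ContinuousAt.comp (f := fun r => r - s / 2) h2 (by fun_prop)
    have h3 : ContinuousAt (fun r => P (s / 2) (T (r - s / 2) x)) s :=
      (P (s / 2)).continuous.continuousAt.comp h1
    refine (h3.congr ?_).continuousWithinAt
    filter_upwards [lt_mem_nhds (half_lt_self hs')] with r hr
    rw [← smoothing_add_apply hT hR₀ hPR (half_pos hs') (sub_nonneg.2 hr.le)]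
    congr 2; ring
  norm_le := hPk
  integrableOn := hk

/-- This is the inclusion D(A) ⊆ D(B). For (x, a) in the generator, T(s)x = T(1)x - ∫ₛ¹ T(r)a dr.
Applying the closed operator gives P(s)x = P(1)x - ∫ₛ¹ P(r)a dr, which converges as s ↘ 0 because
the bound on `P` is integrable. Closedness identifies the limit as the value at x. -/
lemma exists_mem_and_tendsto (hT : IsC0Semigroup T) (hRc : IsClosed (R : Set (X × X)))
    (hR₀ : ∀ b, (0, b) ∈ R → b = 0) (hPR : ∀ s, 0 < s → ∀ x, (T s x, P s x) ∈ R)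
    (hP : IsIntegrableFamily P k) {x a : X} (h : (x, a) ∈ generator fun t x => T t x) :
    ∃ b, (x, b) ∈ R ∧ Tendsto (fun s => P s x) (𝓝[>] 0) (𝓝 b) := by
  have hPi : IntervalIntegrable (fun s => P s a) volume 0 1 :=
    (intervalIntegrable_iff_integrableOn_Ioc_of_le zero_le_one).2 (hP.integrableOn_apply a 1)
  have hTc := hT.continuousOn a
  have hPs : ∀ s ∈ Ioc (0 : ℝ) 1, P s x = P 1 x - ((∫ r in (0 : ℝ)..1, P r a) -
      ∫ r in (0 : ℝ)..s, P r a) := by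
    intro s hs
    have hi : IntervalIntegrable (fun s => P s a) volume 0 s :=
      hPi.mono_set (by rw [uIcc_of_le hs.1.le, uIcc_of_le zero_le_one]; exact Icc_subset_Icc_right hs.2)
    rw [intervalIntegral.integral_interval_sub_left hPi hi]
    refine eq_of_mem_of_mem hR₀ (hPR s hs.1 x) ?_
    have h1 : T s x = T 1 x - ∫ r in s..1, T r a := by
      rw [← intervalIntegral.integral_interval_sub_left
        (intervalIntegrable_of_continuousOn_Ici hTc le_rfl zero_le_one)
        (intervalIntegrable_of_continuousOn_Ici hTc le_rfl hs.1.le),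
        ← hT.sub_eq_integral h zero_le_one, ← hT.sub_eq_integral h hs.1.le]
      abel
    rw [h1, ← Prod.mk_sub_mk]
    refine R.sub_mem (hPR 1 one_pos x) ?_
    rw [intervalIntegral.integral_of_le hs.2, intervalIntegral.integral_of_le hs.2]
    refine integral_prodMk_mem_of_isClosed hRc ?_ ?_ ?_
    · exact (intervalIntegrable_of_continuousOn_Ici hTc hs.1.le zero_le_one).1
    · exact (hP.integrableOn_apply a 1).mono_set (Ioc_subset_Ioc_left hs.1.le)
    · filter_upwards [ae_restrict_mem measurableSet_Ioc] with r hr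
      exact hPR r (hs.1.trans hr.1) a
  have hlim : Tendsto (fun s => P s x) (𝓝[>] 0) (𝓝 (P 1 x - ∫ r in (0 : ℝ)..1, P r a)) := by
    have h1 : Tendsto (fun s => ∫ r in (0 : ℝ)..s, P r a) (𝓝[>] 0) (𝓝 0) := by
      have h2 := intervalIntegral.continuousOn_primitive_interval (μ := volume) (a := 0) (b := 1)
        (f := fun s => P s a) (by
          rw [uIcc_of_le zero_le_one, integrableOn_Icc_iff_integrableOn_Ioc]
          exact hP.integrableOn_apply a 1)
      have h3 := h2 0 left_mem_uIcc
      rw [ContinuousWithinAt, intervalIntegral.integral_same, uIcc_of_le zero_le_one] at h3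
      exact h3.mono_left (nhdsWithin_le_of_mem (Icc_mem_nhdsGT one_pos))
    have h2 := ((h1.const_sub (∫ r in (0 : ℝ)..1, P r a)).const_sub (P 1 x))
    rw [sub_zero] at h2
    refine h2.congr' ?_
    filter_upwards [Ioc_mem_nhdsGT one_pos] with s hs using (hPs s hs).symm
  refine ⟨_, ?_, hlim⟩
  have h1 : Tendsto (fun s => T s x) (𝓝[>] 0) (𝓝 x) := by
    have := (hT.continuousOn x) 0 self_mem_Ici
    rw [ContinuousWithinAt, hT.zero_apply] at this
    exact this.mono_left (nhdsWithin_mono _ Ioi_subset_Ici_self)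
  refine hRc.mem_of_tendsto (h1.prodMk_nhds hlim) ?_
  filter_upwards [self_mem_nhdsWithin] with s hs using hPR s hs x

/-- For fixed t, r ↦ S(t+r) - S(t)S(r) solves the homogeneous Volterra equation and so vanishes. -/
lemma isC0Semigroup_of_volterra (hT : IsC0Semigroup T) (hP : IsIntegrableFamily P k)
    (hadd : ∀ s t, 0 < s → 0 ≤ t → ∀ x, P (s + t) x = P s (T t x))
    {S : ℝ → X →L[ℝ] X} (hS : StronglyContinuous S)
    (h : ∀ t, 0 ≤ t → ∀ x, S t x = T t x + ∫ s in Ioc 0 t, S (t - s) (P s x)) :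
    IsC0Semigroup S where
  map_zero := by
    ext x
    simp [h 0 le_rfl, hT.zero_apply]
  map_add t r ht hr := by
    have hD : StronglyContinuous fun r => S (t + r) - (S t).comp (S r) := by
      intro x
      simp only [sub_apply, ContinuousLinearMap.comp_apply]
      refine ContinuousOn.sub ?_ ((S t).continuous.comp_continuousOn (hS x))
      exact (hS x).comp (by fun_prop) fun r hr => add_nonneg ht hr
    refine sub_eq_zero.1 (eq_zero_of_volterra hD hP ?_ hr)
    intro r hr x
    have hi := hP.integrableOn_convolution hS (t + r) x
    have hir := hP.integrableOn_convolution hS r x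
    have hrt : r ≤ t + r := by linarith
    -- Split at s = r. Beyond r, the shift s ↦ s + r and P(s+r) = P(s)T(r) recover the integral term
    -- of S(t) at T(r)x.
    have e1 : ∫ s in Ioc 0 (t + r), S (t + r - s) (P s x) =
        (∫ s in Ioc 0 r, S (t + r - s) (P s x)) + ∫ s in Ioc 0 t, S (t - s) (P s (T r x)) := by
      have e2 : ∫ s in Ioc 0 t, S (t - s) (P s (T r x)) =
          ∫ s in Ioc r (t + r), S (t + r - s) (P s x) := by
        rw [← intervalIntegral.integral_of_le ht, ← intervalIntegral.integral_of_le hrt]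
        have e3 := intervalIntegral.integral_comp_add_right (a := 0) (b := t)
          (fun s => S (t + r - s) (P s x)) r
        rw [zero_add] at e3
        rw [← e3]
        refine intervalIntegral.integral_congr_ae (Eventually.of_forall fun s hs => ?_)
        rw [uIoc_of_le ht] at hs
        rw [hadd s r hs.1 hr, show t + r - (s + r) = t - s by ring]
      rw [e2, ← setIntegral_union (Ioc_disjoint_Ioc_of_le le_rfl) measurableSet_Ioc
        (hi.mono_set (Ioc_subset_Ioc_right hrt)) (hi.mono_set (Ioc_subset_Ioc_left hr)),
        Ioc_union_Ioc_eq_Ioc hr hrt]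
    have e4 : ∫ s in Ioc 0 r, (S (t + (r - s)) - (S t).comp (S (r - s))) (P s x) =
        (∫ s in Ioc 0 r, S (t + r - s) (P s x)) - S t (∫ s in Ioc 0 r, S (r - s) (P s x)) := by
      rw [← (S t).integral_comp_comm hir, ← integral_sub (hi.mono_set (Ioc_subset_Ioc_right hrt))
        ((S t).integrable_comp hir)]
      simp only [add_sub_assoc]
      rfl
    rw [e4]
    simp only [sub_apply, ContinuousLinearMap.comp_apply]
    rw [h (t + r) (by positivity), e1, h r hr, map_add, h t ht (T r x), hT.add_apply ht hr]
    abel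
  continuousOn := hS

/-- The slope of `T` at 0 contributes a. The integral term contributes the mean of S(t-s)P(s)x over
(0, t], which tends to b since P(s)x → b and `S` is strongly continuous at 0. -/
lemma opAdd_subset_generator_of_volterra (hT : IsC0Semigroup T) (hRc : IsClosed (R : Set (X × X)))
    (hR₀ : ∀ b, (0, b) ∈ R → b = 0) (hPR : ∀ s, 0 < s → ∀ x, (T s x, P s x) ∈ R)
    (hP : IsIntegrableFamily P k) {S : ℝ → X →L[ℝ] X} (hS : IsC0Semigroup S)
    (h : ∀ t, 0 ≤ t → ∀ x, S t x = T t x + ∫ s in Ioc 0 t, S (t - s) (P s x)) :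
    opAdd (generator fun t x => T t x) R ⊆ generator fun t x => S t x := by
  rintro ⟨x, f⟩ ⟨a, b, ha, hb, hf⟩
  obtain ⟨b', hb', hlim⟩ := exists_mem_and_tendsto hT hRc hR₀ hPR hP ha
  obtain rfl : b = b' := eq_of_mem_of_mem hR₀ hb hb'
  simp only at ha hb hf
  subst hf
  have key : Tendsto (fun t : ℝ => t⁻¹ • ∫ s in Ioc 0 t, S (t - s) (P s x)) (𝓝[>] 0) (𝓝 b) := by
    obtain ⟨M, hM0, hM⟩ := hS.stronglyContinuous.exists_bound 1
    rw [Metric.tendsto_nhds]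
    intro ε hε
    have hSb : Tendsto (fun t => S t b) (𝓝[Ici 0] 0) (𝓝 b) := by
      have := hS.continuousOn b 0 self_mem_Ici
      rwa [ContinuousWithinAt, hS.zero_apply] at this
    -- With `M` bounding ‖S‖ on [0, 1], the two errors add up to (M+1)/(M+2) · ε/2.
    have hε' : 0 < ε / (2 * (M + 2)) := by positivity
    obtain ⟨δ₁, hδ₁, h1⟩ := mem_nhdsGT_iff_exists_Ioo_subset.1
      ((Metric.tendsto_nhds.1 hlim _ hε'))
    obtain ⟨δ₂, hδ₂, h2⟩ := mem_nhdsGE_iff_exists_Ico_subset.1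
      ((Metric.tendsto_nhds.1 hSb _ hε'))
    have hev : Ioo (0 : ℝ) (min 1 (min δ₁ δ₂)) ∈ 𝓝[>] (0 : ℝ) :=
      Ioo_mem_nhdsGT (lt_min one_pos (lt_min hδ₁ hδ₂))
    filter_upwards [hev] with t ht
    have ht0 : 0 < t := ht.1
    have ht1 : t < 1 := ht.2.trans_le (min_le_left _ _)
    have htδ₁ : t < δ₁ := ht.2.trans_le ((min_le_right _ _).trans (min_le_left _ _))
    have htδ₂ : t < δ₂ := ht.2.trans_le ((min_le_right _ _).trans (min_le_right _ _))
    have e1 : t⁻¹ • (∫ s in Ioc 0 t, S (t - s) (P s x)) - b =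
        t⁻¹ • ∫ s in Ioc 0 t, (S (t - s) (P s x) - b) := by
      rw [integral_sub (hP.integrableOn_convolution hS.stronglyContinuous t x)
        (integrableOn_const (by simp)), setIntegral_const, smul_sub, smul_smul]
      simp [ht0.le, inv_mul_cancel₀ ht0.ne']
    have e2 : ‖∫ s in Ioc 0 t, (S (t - s) (P s x) - b)‖ ≤ (ε / 2) * t := by
      have := norm_setIntegral_le_of_norm_le_const (μ := volume) (s := Ioc 0 t) (C := ε / 2)
        (f := fun s => S (t - s) (P s x) - b) (by simp) ?_
      · simpa [ht0.le] using this
      intro s hs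
      have h3 : dist (P s x) b < ε / (2 * (M + 2)) := h1 ⟨hs.1, hs.2.trans_lt htδ₁⟩
      have h4 : dist (S (t - s) b) b < ε / (2 * (M + 2)) :=
        h2 ⟨sub_nonneg.2 hs.2, by linarith [hs.1]⟩
      rw [dist_eq_norm] at h3 h4
      have h5 := (S (t - s)).le_of_opNorm_le (hM _ ⟨sub_nonneg.2 hs.2, by linarith [hs.1]⟩)
        (P s x - b)
      calc ‖S (t - s) (P s x) - b‖ = ‖S (t - s) (P s x - b) + (S (t - s) b - b)‖ := by
            rw [map_sub]; congr 1; abel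
        _ ≤ M * (ε / (2 * (M + 2))) + ε / (2 * (M + 2)) :=
            (norm_add_le _ _).trans (add_le_add (h5.trans (by gcongr)) h4.le)
        _ = (M + 1) / (M + 2) * (ε / 2) := by field_simp
        _ ≤ ε / 2 := mul_le_of_le_one_left (by positivity)
            ((div_le_one (by positivity)).2 (by linarith))
    rw [dist_eq_norm, e1, norm_smul, norm_inv, Real.norm_of_nonneg ht0.le]
    calc t⁻¹ * _ ≤ t⁻¹ * ((ε / 2) * t) := by gcongr
      _ = ε / 2 := by field_simp
      _ < ε := half_lt_self hε
  refine (Tendsto.add ha key).congr' ?_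
  filter_upwards [self_mem_nhdsWithin] with t ht
  rw [h t (le_of_lt ht), ← smul_add]
  congr 1
  abel

/-- **Perturbation theorem.** Let `T` be a strongly continuous semigroup with generator `A`, and let
`B` be a closed operator with graph `R`. If `T s` maps into the domain of `B` for `s > 0`, and
`P s = B (T s)` is bounded with a locally integrable bound, then `A + B`, with domain `D(A)`,
generates a strongly continuous semigroup. -/
theorem exists_perturbed_semigroup (hT : IsC0Semigroup T) (hRc : IsClosed (R : Set (X × X)))
    (hR₀ : ∀ b, (0, b) ∈ R → b = 0) (hPR : ∀ s, 0 < s → ∀ x, (T s x, P s x) ∈ R)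
    (hPk : ∀ s, 0 < s → ‖P s‖ ≤ k s) (hk : ∀ τ, IntegrableOn k (Ioc 0 τ)) :
    ∃ S : ℝ → X →L[ℝ] X, Generates (opAdd (generator fun t x => T t x) R) S ∧
      ∀ t, 0 ≤ t → ∀ x, S t x = T t x + ∫ s in Ioc 0 t, S (t - s) (P s x) := by
  have hP := isIntegrableFamily_of_mem hT hR₀ hPR hPk hk
  obtain ⟨S, hSc, hS⟩ := exists_volterra hT.stronglyContinuous hP
  have hS0 : IsC0Semigroup S := isC0Semigroup_of_volterra hT hP
    (fun s t hs ht x => smoothing_add_apply hT hR₀ hPR hs ht x) hSc hS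
  have hsub := opAdd_subset_generator_of_volterra hT hRc hR₀ hPR hP hS0 hS
  refine ⟨S, ⟨hS0, subset_antisymm ?_ hsub⟩, hS⟩
  -- For the reverse inclusion, y in D(A + B) is found with (μ - A - B)y = μx - f; injectivity of μ
  -- minus the generator of `S` then forces x = y.
  rintro ⟨x, f⟩ hxf
  -- the operator `1 - Q` is invertible for large `μ`
  obtain ⟨l₀, hl₀⟩ := hP.exists_weight 1 (q := 1 / 4) (by norm_num)
  obtain ⟨μ, hμl, hμT, hμS⟩ : ∃ μ : ℝ, l₀ ≤ μ ∧ Real.exp (-μ) * ‖T 1‖ < 1 / 4 ∧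
      Real.exp (-μ) * ‖S 1‖ < 1 := by
    have h1 : ∀ c : ℝ, Tendsto (fun μ => Real.exp (-μ) * c) atTop (𝓝 0) := fun c => by
      simpa using Real.tendsto_exp_neg_atTop_nhds_zero.mul_const c
    exact ((eventually_ge_atTop l₀).and (((h1 ‖T 1‖).eventually (gt_mem_nhds (by norm_num))).and
      ((h1 ‖S 1‖).eventually (gt_mem_nhds (by norm_num))))).exists
  -- Convolving with exp(μt) and then scaling by exp(-μ) gives Q = exp(-μ) T(1) + ∫₀¹ exp(-μs) P(s)
  -- ds. Both summands have norm at most 1/4. Truncating the Laplace transform at 1 makes a growth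
  -- bound for `T` unnecessary.
  set E : ℝ → X →L[ℝ] X := fun t => Real.exp (μ * t) • ContinuousLinearMap.id ℝ X with hE
  have hEc : StronglyContinuous E := fun x =>
    ((by fun_prop : Continuous fun t : ℝ => Real.exp (μ * t) • x)).continuousOn
  set Q : X →L[ℝ] X := Real.exp (-μ) • (T 1 + convolution E P hEc hP 1) with hQ
  have hEn : ∀ t ∈ Icc (0 : ℝ) 1, ‖E t‖ ≤ 1 * Real.exp (μ * t) := by
    intro t _
    rw [hE, norm_smul, Real.norm_of_nonneg (Real.exp_pos _).le, one_mul]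
    exact mul_le_of_le_one_right (Real.exp_pos _).le ContinuousLinearMap.norm_id_le
  have hconv : ‖convolution E P hEc hP 1‖ ≤ 1 / 4 * Real.exp μ := by
    refine ContinuousLinearMap.opNorm_le_bound _ (by positivity) fun x => ?_
    have := hP.norm_convolution_le zero_le_one hEn (hl₀ μ hμl) ⟨zero_le_one, le_rfl⟩ x
    rwa [one_mul, mul_one] at this
  have hQn : ‖Q‖ < 1 := by
    have h2 : Real.exp (-μ) * ‖convolution E P hEc hP 1‖ ≤ 1 / 4 := by
      refine (mul_le_mul_of_nonneg_left hconv (Real.exp_pos _).le).trans (le_of_eq ?_)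
      rw [mul_left_comm, ← Real.exp_add]
      simp
    rw [hQ, norm_smul, Real.norm_of_nonneg (Real.exp_pos _).le]
    have h3 := mul_le_mul_of_nonneg_left (norm_add_le (T 1) (convolution E P hEc hP 1))
      (Real.exp_pos (-μ)).le
    linarith
  obtain ⟨V, hV⟩ := (isUnit_one_sub_of_norm_lt_one hQn).exists_right_inv
  -- solve `(μ - A - B) y = μ x - f`
  set g := μ • x - f with hg
  set h := V g with hh
  have hh1 : h - Q h = g := by
    have := congrArg (fun L : X →L[ℝ] X => L g) hV
    simpa using this
  have hT' := hT.exp_smul (-μ)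
  -- For this truncated resolvent, (μ - A)y = h - exp(-μ) T(1)h and By = ∫₀¹ exp(-μr) P(r)h dr, so
  -- (μ - A - B)y = h - Qh = g.
  set y := ∫ r in (0 : ℝ)..1, (Real.exp (-μ * r) • T r) h with hy
  have hyT : (y, μ • y - h + Real.exp (-μ) • T 1 h) ∈ generator fun t x => T t x := by
    have h1 := hT'.integral_mem_generator h zero_le_one
    have h2 := hT'.generator_exp_smul_of_mem μ h1
    have h3 : (fun (t : ℝ) (x : X) => (Real.exp (μ * t) • Real.exp (-μ * t) • T t) x) =
        fun t x => T t x := by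
      funext t x
      rw [smul_smul, ← Real.exp_add]
      simp
    rw [h3] at h2
    convert h2 using 2
    simp [hy]
    abel
  have hyR : (y, ∫ r in (0 : ℝ)..1, Real.exp (-μ * r) • P r h) ∈ R := by
    rw [hy, intervalIntegral.integral_of_le zero_le_one, intervalIntegral.integral_of_le zero_le_one]
    refine integral_prodMk_mem_of_isClosed hRc ?_ ?_ ?_
    · exact (intervalIntegrable_of_continuousOn_Ici (hT'.continuousOn h) le_rfl zero_le_one).1
    · have h1 := IntegrableOn.continuousOn_smul (K := Icc 0 1)
        (f := fun s => Real.exp (-μ * s)) (g := fun r => P r h) (μ := volume)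
        (by rw [integrableOn_Icc_iff_integrableOn_Ioc]; exact hP.integrableOn_apply h 1)
        (by fun_prop) isCompact_Icc
      exact h1.mono_set Ioc_subset_Icc_self
    · filter_upwards [ae_restrict_mem measurableSet_Ioc] with r hr
      exact R.smul_mem _ (hPR r hr.1 h)
  have hQh : Q h = Real.exp (-μ) • T 1 h + ∫ r in (0 : ℝ)..1, Real.exp (-μ * r) • P r h := by
    rw [hQ, smul_apply, add_apply, smul_add, convolution_apply, ← integral_smul,
      intervalIntegral.integral_of_le zero_le_one]
    congr 2
    funext r
    rw [hE]
    simp only [smul_apply, ContinuousLinearMap.id_apply, smul_smul, ← Real.exp_add]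
    congr 2
    ring
  have hymem : (y, μ • y - g) ∈ opAdd (generator fun t x => T t x) R := by
    refine ⟨_, _, hyT, hyR, ?_⟩
    rw [← hh1, hQh]
    simp only
    abel
  -- injectivity of `μ - C`
  have hw : (x - y, μ • (x - y)) ∈ generator fun t x => S t x := by
    have h1 := generator_sub hxf (hsub hymem)
    convert h1 using 2
    rw [hg, smul_sub]
    abel
  -- An eigenvector for the eigenvalue μ is fixed by exp(-μ) S(1), whose norm is less than 1.
  have hw0 : x - y = 0 := by
    have h1 := hS0.generator_exp_smul_of_mem (-μ) hw
    have h2 := (hS0.exp_smul (-μ)).sub_eq_integral h1 zero_le_one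
    simp only [neg_smul, add_neg_cancel, map_zero, intervalIntegral.integral_zero, mul_one] at h2
    have h3 : x - y = Real.exp (-μ) • S 1 (x - y) := (sub_eq_zero.1 h2).symm
    have h4 : ‖x - y‖ ≤ Real.exp (-μ) * ‖S 1‖ * ‖x - y‖ := by
      conv_lhs => rw [h3]
      rw [norm_smul, Real.norm_of_nonneg (Real.exp_pos _).le, mul_assoc]
      exact mul_le_mul_of_nonneg_left ((S 1).le_opNorm _) (Real.exp_pos _).le
    by_contra hne
    have h5 : 0 < ‖x - y‖ := norm_pos_iff.2 hne
    nlinarith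
  have hxy : x = y := sub_eq_zero.1 hw0
  have hfg : f = μ • y - g := by rw [hg, ← hxy]; abel
  rw [hfg, hxy]
  exact hymem

/-- The graph of a bounded operator, as a subspace. -/
def graphSubmodule (K : X →L[ℝ] X) : Submodule ℝ (X × X) := (K : X →ₗ[ℝ] X).graph

omit [CompleteSpace X] in
lemma coe_graphSubmodule (K : X →L[ℝ] X) : (graphSubmodule K : Set (X × X)) = graphOf K := by
  ext p
  simp [graphSubmodule, graphOf, LinearMap.mem_graph_iff]

/-- Bounded perturbations of a strongly continuous semigroup. -/
theorem exists_bounded_perturbation {G : Set (X × X)} (hT : Generates G T) (K : X →L[ℝ] X) :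
    ∃ S : ℝ → X →L[ℝ] X, Generates (opAdd G (graphOf K)) S ∧
      ∀ t, 0 ≤ t → ∀ x, S t x = T t x + ∫ s in (0 : ℝ)..t, S (t - s) (K (T s x)) := by
  have hbd : ∀ n : ℕ, ∃ M, 0 ≤ M ∧ ∀ t ∈ Icc 0 (n : ℝ), ‖T t‖ ≤ M :=
    fun n => hT.1.stronglyContinuous.exists_bound n
  choose M hM0 hM using hbd
  have hRc : IsClosed (graphSubmodule K : Set (X × X)) := by
    rw [coe_graphSubmodule]
    exact isClosed_eq continuous_snd (K.continuous.comp continuous_fst)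
  have hmem : ∀ x b, (x, b) ∈ graphSubmodule K ↔ b = K x := fun x b => by
    rw [← SetLike.mem_coe, coe_graphSubmodule]
    rfl
  -- A step function built from bounds on the intervals [0, n] serves as majorant: it is visibly
  -- measurable and locally bounded, and no measurability of the operator norm is needed.
  have hk : ∀ τ, IntegrableOn (fun s : ℝ => ‖K‖ * M ⌈s⌉₊) (Ioc 0 τ) := by
    intro τ
    refine Measure.integrableOn_of_bounded (M := ‖K‖ * ∑ n ∈ Finset.range (⌈τ⌉₊ + 1), M n)
      (by simp) ?_ ?_
    · refine Measurable.aestronglyMeasurable ?_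
      exact ((measurable_from_nat (f := M)).comp Nat.measurable_ceil).const_mul _
    · filter_upwards [ae_restrict_mem measurableSet_Ioc] with s hs
      rw [Real.norm_of_nonneg (mul_nonneg (norm_nonneg _) (hM0 _))]
      refine mul_le_mul_of_nonneg_left ?_ (norm_nonneg _)
      exact Finset.single_le_sum (f := M) (fun i _ => hM0 i)
        (Finset.mem_range.2 (Nat.lt_succ_of_le (Nat.ceil_mono hs.2)))
  obtain ⟨S, h1, h2⟩ := exists_perturbed_semigroup (P := fun s => K.comp (T s)) hT.1 hRc
    (fun b hb => by simpa using (hmem 0 b).1 hb) (fun s _ x => (hmem _ _).2 rfl)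
    (fun s hs => (K.opNorm_comp_le _).trans
      (mul_le_mul_of_nonneg_left (hM _ _ ⟨hs.le, Nat.le_ceil s⟩) (norm_nonneg _))) hk
  refine ⟨S, ?_, fun t ht x => ?_⟩
  · rwa [hT.2, coe_graphSubmodule] at h1
  · rw [h2 t ht x, intervalIntegral.integral_of_le ht]
    rfl

end Perturbation

end

end ReturnHome

namespace ReturnHome

noncomputable section

/-! ### The variation of constants formula -/

section VariationOfConstants

variable {X : Type*} [NormedAddCommGroup X] [NormedSpace ℝ X] [CompleteSpace X]
  {G : Set (X × X)} {T₀ T : ℝ → X →L[ℝ] X} {K : X →L[ℝ] X}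

/-- The perturbation theorem puts the perturbed semigroup on the left inside the integral; here it
must be on the right. So `T₀` is regarded as the perturbation of `T` by -K: the semigroup obtained
has generator `G`, hence equals `T₀`, and its Volterra equation is the claim up to sign. -/
lemma Generates.variationOfConstants (hT₀ : Generates G T₀)
    (hT : Generates (opAdd G (graphOf K)) T) {t : ℝ} (ht : 0 ≤ t) (x : X) :
    T t x = T₀ t x + ∫ s in (0 : ℝ)..t, T₀ (t - s) (K (T s x)) := by
  obtain ⟨S, hS, h⟩ := exists_bounded_perturbation hT (-K)
  have hG : opAdd (opAdd G (graphOf K)) (graphOf (-K : X →L[ℝ] X)) = G := by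
    ext ⟨x, f⟩
    constructor
    · rintro ⟨a, b, ⟨c, d, hc, hd, h1⟩, hb, h2⟩
      simp only [graphOf, mem_ofPred_eq, neg_apply] at hc hd h1 hb h2
      rw [h2, h1, hd, hb, add_neg_cancel_right]
      exact hc
    · intro h
      exact ⟨f + K x, -K x, ⟨f, K x, h, rfl, rfl⟩, rfl, by simp⟩
  rw [hG] at hS
  have h1 := h t ht x
  rw [hT₀.eq hS ht] at h1
  have h2 : ∫ s in (0 : ℝ)..t, S (t - s) ((-K) (T s x)) =
      -∫ s in (0 : ℝ)..t, T₀ (t - s) (K (T s x)) := by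
    rw [← intervalIntegral.integral_neg]
    refine intervalIntegral.integral_congr fun s hs => ?_
    rw [uIcc_of_le ht] at hs
    simp only [hT₀.eq hS (sub_nonneg.2 hs.2), neg_apply, map_neg]
  rw [h1, h2]
  abel

lemma IsC0Semigroup.intervalIntegrable_convolution (hT₀ : IsC0Semigroup T₀) {f : ℝ → X}
    (hf : ContinuousOn f (Ici 0)) {t : ℝ} (ht : 0 ≤ t) :
    IntervalIntegrable (fun s => T₀ (t - s) (f s)) volume 0 t := by
  refine ContinuousOn.intervalIntegrable ?_
  rw [uIcc_of_le ht]
  exact hT₀.stronglyContinuous.continuousOn_apply (by fun_prop) (fun s hs => sub_nonneg.2 hs.2)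
    (hf.mono Icc_subset_Ici_self)

/-- The orbits of the perturbed semigroup are characterized by the variation of constants formula. -/
lemma Generates.variationOfConstants_iff (hT₀ : Generates G T₀)
    (hT : Generates (opAdd G (graphOf K)) T) (x : X) {z : ℝ → X} (hz : ContinuousOn z (Ici 0)) :
    (∀ t, 0 ≤ t → z t = T₀ t x + ∫ s in (0 : ℝ)..t, T₀ (t - s) (K (z s))) ↔
      EqOn z (fun t => T t x) (Ici 0) := by
  constructor
  · intro h
    set d : ℝ → X := fun t => z t - T t x with hd
    have hdc : ContinuousOn d (Ici 0) := hz.sub (hT.1.continuousOn x)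
    have hde : ∀ t, 0 ≤ t → d t = ∫ s in (0 : ℝ)..t, T₀ (t - s) (K (d s)) := by
      intro t ht
      have h1 := hT₀.1.intervalIntegrable_convolution (K.continuous.comp_continuousOn hz) ht
      have h2 := hT₀.1.intervalIntegrable_convolution
        (K.continuous.comp_continuousOn (hT.1.continuousOn x)) ht
      simp only [Function.comp_apply] at h1 h2
      simp only [hd, map_sub]
      rw [intervalIntegral.integral_sub h1 h2, h t ht, hT₀.variationOfConstants hT ht]
      abel
    have hd0 : ∀ t, 0 ≤ t → d t = 0 := by
      intro τ hτ
      obtain ⟨M, hM0, hM⟩ := hT₀.1.stronglyContinuous.exists_bound τ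
      have hdn : ContinuousOn (fun s => ‖d s‖) (Ici 0) := hdc.norm
      have hle : ∀ t ∈ Icc 0 τ, ‖d t‖ ≤ M * ‖K‖ * ∫ s in (0 : ℝ)..t, ‖d s‖ := by
        intro t ht
        rw [hde t ht.1, ← intervalIntegral.integral_const_mul]
        refine intervalIntegral.norm_integral_le_of_norm_le ht.1 ?_
          ((intervalIntegrable_of_continuousOn_Ici hdn le_rfl ht.1).const_mul _)
        refine Eventually.of_forall fun s hs => ?_
        rw [mul_assoc]
        exact ((T₀ (t - s)).le_of_opNorm_le
          (hM _ ⟨sub_nonneg.2 hs.2, by linarith [hs.1, ht.2]⟩) _).trans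
          (mul_le_mul_of_nonneg_left (K.le_opNorm _) hM0)
      -- Grönwall's inequality, applied to the primitive of ‖d‖.
      have hgron := eq_zero_of_abs_deriv_le_mul_abs_self_of_eq_zero_right
        (f := fun t => ∫ s in (0 : ℝ)..t, ‖d s‖) (f' := fun t => ‖d t‖) (K := M * ‖K‖)
        (continuousOn_integral_Ici hdn τ)
        (fun t ht => hasDerivWithinAt_integral_Ici hdn ht.1) (by simp)
        (fun t ht => by
          rw [norm_norm, Real.norm_of_nonneg
            (intervalIntegral.integral_nonneg ht.1 fun _ _ => norm_nonneg _)]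
          exact hle t ⟨ht.1, ht.2.le⟩)
      have h1 := hle τ ⟨hτ, le_rfl⟩
      rw [hgron τ ⟨hτ, le_rfl⟩, mul_zero] at h1
      exact norm_le_zero_iff.1 h1
    exact fun t ht => sub_eq_zero.1 (hd0 t ht)
  · intro h t ht
    rw [h ht]
    simp only
    rw [hT₀.variationOfConstants hT ht]
    congr 1
    refine intervalIntegral.integral_congr fun s hs => ?_
    rw [uIcc_of_le ht] at hs
    simp only [h hs.1]

end VariationOfConstants

end

end ReturnHome

namespace ReturnHome

noncomputable section

/-! ### Functions and classes in L¹ -/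

section ToL1

variable {f g : Plane → ℝ}

lemma toL1_eq (hf : Integrable f) : toL1 f = hf.toL1 f := dif_pos hf

lemma coeFn_toL1 (hf : Integrable f) : (toL1 f : Plane → ℝ) =ᵐ[volume] f := by
  rw [toL1_eq hf]; exact hf.coeFn_toL1

lemma integrable_coe (v : L1) : Integrable (v : Plane → ℝ) := L1.integrable_coeFn v

lemma toL1_coe (v : L1) : toL1 v = v := by
  rw [toL1_eq (integrable_coe v)]; exact Integrable.toL1_coeFn _ _

lemma toL1_congr (h : f =ᵐ[volume] g) : toL1 f = toL1 g := by
  by_cases hf : Integrable f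
  · rw [toL1_eq hf, toL1_eq (hf.congr h)]
    exact (Integrable.toL1_eq_toL1_iff _ _ _ _).2 h
  · have hg : ¬ Integrable g := fun hg => hf (hg.congr h.symm)
    rw [toL1, toL1, dif_neg hf, dif_neg hg]

lemma toL1_add (hf : Integrable f) (hg : Integrable g) :
    toL1 (fun x => f x + g x) = toL1 f + toL1 g := by
  rw [toL1_eq hf, toL1_eq hg, toL1_eq (f := fun x => f x + g x) (hf.add hg)]; rfl

lemma toL1_const_mul (c : ℝ) (hf : Integrable f) : toL1 (fun x => c * f x) = c • toL1 f := by
  rw [toL1_eq hf, toL1_eq (hf.const_mul c)]; rfl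

lemma toL1_neg (hf : Integrable f) : toL1 (fun x => -f x) = -toL1 f := by
  rw [toL1_eq hf, toL1_eq (f := fun x => -f x) hf.neg]; rfl

lemma toL1_sub (hf : Integrable f) (hg : Integrable g) :
    toL1 (fun x => f x - g x) = toL1 f - toL1 g := by
  rw [toL1_eq hf, toL1_eq hg, toL1_eq (f := fun x => f x - g x) (hf.sub hg)]; rfl

lemma norm_toL1 (hf : Integrable f) : ‖toL1 f‖ = ∫ x, ‖f x‖ := by
  rw [toL1_eq hf]; exact L1.norm_of_fun_eq_integral_norm hf

/-- Integration over a measurable set, as a functional on `L¹`. -/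
def setIntegralL (E : Set Plane) : L1 →L[ℝ] ℝ :=
  LinearMap.mkContinuous
    { toFun := fun v => ∫ x in E, v x
      map_add' := fun v w => by
        rw [← integral_add (integrable_coe v).integrableOn (integrable_coe w).integrableOn]
        exact integral_congr_ae (ae_restrict_of_ae (Lp.coeFn_add v w))
      map_smul' := fun c v => by
        rw [RingHom.id_apply, ← integral_smul]
        exact integral_congr_ae (ae_restrict_of_ae (Lp.coeFn_smul c v)) } 1
    (fun v => by
      rw [one_mul, L1.norm_eq_integral_norm]
      exact (norm_integral_le_integral_norm _).trans
        (setIntegral_le_integral (integrable_coe v).norm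
          (Eventually.of_forall fun _ => norm_nonneg _)))

lemma setIntegralL_apply (E : Set Plane) (v : L1) : setIntegralL E v = ∫ x in E, v x := rfl

/-- A Bochner integral in `L¹` can be computed pointwise. -/
lemma integral_eq_toL1 {Z : Type*} [MeasurableSpace Z] {ν : Measure Z} [SFinite ν]
    {κ : Z → Plane → ℝ} (hκ : Integrable (Function.uncurry κ) (ν.prod volume)) {Ψ : Z → L1}
    (hΨ : Integrable Ψ ν) (h : ∀ᵐ z ∂ν, Ψ z =ᵐ[volume] κ z) :
    ∫ z, Ψ z ∂ν = toL1 fun x => ∫ z, κ z x ∂ν := by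
  have hint : Integrable fun x => ∫ z, κ z x ∂ν := hκ.integral_prod_right
  rw [← toL1_coe (∫ z, Ψ z ∂ν)]
  -- It suffices to compare integrals over measurable sets. These are continuous functionals on L¹,
  -- so they commute with the Bochner integral, and Fubini does the rest.
  refine toL1_congr (Integrable.ae_eq_of_forall_setIntegral_eq _ _ (integrable_coe _) hint ?_)
  intro E hE _
  rw [← setIntegralL_apply, ← (setIntegralL E).integral_comp_comm hΨ]
  have hκE : Integrable (Function.uncurry κ) (ν.prod (volume.restrict E)) :=
    hκ.mono_measure (Measure.prod_mono le_rfl Measure.restrict_le_self)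
  rw [← integral_integral_swap hκE]
  refine integral_congr_ae ?_
  filter_upwards [h] with z hz
  exact integral_congr_ae (ae_restrict_of_ae hz)

end ToL1

/-! ### Weighted composition operators and translations -/

section WeightedComposition

/-- The data of a bounded weighted composition operator on `L¹`. -/
structure IsWeight (b : ℝ) (c : NNReal) (m : Plane → ℝ) (Θ : Plane → Plane) : Prop where
  measurable_weight : Measurable m
  measurable_map : Measurable Θ
  norm_le : ∀ x, ‖m x‖ ≤ b
  map_le : Measure.map Θ volume ≤ c • (volume : Measure Plane)

variable {b : ℝ} {c : NNReal} {m : Plane → ℝ} {Θ : Plane → Plane}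

namespace IsWeight

lemma nonneg (h : IsWeight b c m Θ) : 0 ≤ b := (norm_nonneg _).trans (h.norm_le 0)

/-- Composition with Θ is thereby well defined on classes modulo null sets. -/
lemma quasiMeasurePreserving (h : IsWeight b c m Θ) :
    Measure.QuasiMeasurePreserving Θ volume volume :=
  ⟨h.measurable_map, (Measure.absolutelyContinuous_of_le h.map_le).trans
    (Measure.smul_absolutelyContinuous)⟩

lemma integrable_map (h : IsWeight b c m Θ) {f : Plane → ℝ} (hf : Integrable f) :
    Integrable f (Measure.map Θ volume) :=
  (hf.smul_measure_nnreal (c := c)).mono_measure h.map_le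

lemma integrable (h : IsWeight b c m Θ) {f : Plane → ℝ} (hf : Integrable f) :
    Integrable fun x => m x * f (Θ x) :=
  ((h.integrable_map hf).comp_measurable h.measurable_map).bdd_mul
    h.measurable_weight.aestronglyMeasurable (Eventually.of_forall h.norm_le)

lemma integral_norm_le (h : IsWeight b c m Θ) {f : Plane → ℝ} (hf : Integrable f) :
    ∫ x, ‖m x * f (Θ x)‖ ≤ b * c * ∫ x, ‖f x‖ := by
  have h1 : ∫ x, ‖f (Θ x)‖ = ∫ x, ‖f x‖ ∂(Measure.map Θ volume) :=
    (integral_map h.measurable_map.aemeasurable (h.integrable_map hf).1.norm).symm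
  have h2 : ∫ x, ‖f x‖ ∂(Measure.map Θ volume) ≤ c * ∫ x, ‖f x‖ := by
    have h3 := integral_mono_measure h.map_le (Eventually.of_forall fun x => norm_nonneg (f x))
      ((hf.smul_measure_nnreal (c := c)).norm)
    rwa [integral_smul_nnreal_measure] at h3
  calc ∫ x, ‖m x * f (Θ x)‖ ≤ ∫ x, b * ‖f (Θ x)‖ := by
        refine integral_mono (h.integrable hf).norm
          (((h.integrable_map hf).comp_measurable h.measurable_map).norm.const_mul b) fun x => ?_
        simp only [norm_mul]
        exact mul_le_mul_of_nonneg_right (h.norm_le x) (norm_nonneg _)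
    _ = b * ∫ x, ‖f x‖ ∂(Measure.map Θ volume) := by rw [integral_const_mul, h1]
    _ ≤ b * (c * ∫ x, ‖f x‖) := mul_le_mul_of_nonneg_left h2 h.nonneg
    _ = _ := by ring

/-- The operator `v ↦ m · (v ∘ Θ)` on `L¹`. -/
def op (h : IsWeight b c m Θ) : L1 →L[ℝ] L1 :=
  LinearMap.mkContinuous
    { toFun := fun v => toL1 fun x => m x * v (Θ x)
      map_add' := fun v w => by
        rw [← toL1_add (h.integrable (integrable_coe v)) (h.integrable (integrable_coe w))]
        refine toL1_congr ?_
        filter_upwards [h.quasiMeasurePreserving.ae_eq_comp (Lp.coeFn_add v w)] with x hx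
        simp only [Function.comp_apply, Pi.add_apply] at hx
        rw [hx, mul_add]
      map_smul' := fun r v => by
        rw [RingHom.id_apply, ← toL1_const_mul r (h.integrable (integrable_coe v))]
        refine toL1_congr ?_
        filter_upwards [h.quasiMeasurePreserving.ae_eq_comp (Lp.coeFn_smul r v)] with x hx
        simp only [Function.comp_apply, Pi.smul_apply, smul_eq_mul] at hx
        rw [hx, mul_left_comm] } (b * c)
    (fun v => by
      rw [L1.norm_eq_integral_norm v]
      refine le_trans (le_of_eq ?_) (h.integral_norm_le (integrable_coe v))
      exact norm_toL1 (h.integrable (integrable_coe v)))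

lemma op_apply (h : IsWeight b c m Θ) (v : L1) : h.op v = toL1 fun x => m x * v (Θ x) := rfl

lemma norm_op_le (h : IsWeight b c m Θ) : ‖h.op‖ ≤ b * c :=
  LinearMap.mkContinuous_norm_le _ (mul_nonneg h.nonneg c.2) _

lemma op_toL1 (h : IsWeight b c m Θ) {f : Plane → ℝ} (hf : Integrable f) :
    h.op (toL1 f) = toL1 fun x => m x * f (Θ x) := by
  rw [op_apply]
  refine toL1_congr ?_
  filter_upwards [h.quasiMeasurePreserving.ae_eq_comp (coeFn_toL1 hf)] with x hx
  simp only [Function.comp_apply] at hx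
  rw [hx]

end IsWeight

/-- Strong convergence of weighted composition operators. -/
lemma tendsto_op {α : Type*} {l : Filter α} [l.IsCountablyGenerated] {b : α → ℝ} {c : α → NNReal}
    {m : α → Plane → ℝ} {Θ : α → Plane → Plane} (h : ∀ a, IsWeight (b a) (c a) (m a) (Θ a))
    {b₀ : ℝ} {c₀ : NNReal} {m₀ : Plane → ℝ} {Θ₀ : Plane → Plane} (h₀ : IsWeight b₀ c₀ m₀ Θ₀)
    {B C ρ : ℝ} (hb : ∀ᶠ a in l, b a ≤ B) (hc : ∀ᶠ a in l, c a ≤ C)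
    (hρ : ∀ᶠ a in l, ∀ x, ‖Θ a x - x‖ ≤ ρ) (hρ₀ : ∀ x, ‖Θ₀ x - x‖ ≤ ρ)
    (hm : ∀ x, Tendsto (fun a => m a x) l (𝓝 (m₀ x)))
    (hΘ : ∀ x, Tendsto (fun a => Θ a x) l (𝓝 (Θ₀ x))) (v : L1) :
    Tendsto (fun a => (h a).op v) l (𝓝 (h₀.op v)) := by
  have hdense : ∀ g : Plane → ℝ, Continuous g → HasCompactSupport g →
      Tendsto (fun a => (h a).op (toL1 g)) l (𝓝 (h₀.op (toL1 g))) := by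
    intro g hg hgs
    have hgi : Integrable g := hg.integrable_of_hasCompactSupport hgs
    obtain ⟨G, hG⟩ := hg.bounded_above_of_compact_support hgs
    obtain ⟨r, hr⟩ := hgs.isCompact.isBounded.subset_closedBall 0
    have hG0 : 0 ≤ G := (norm_nonneg _).trans (hG 0)
    rw [tendsto_iff_norm_sub_tendsto_zero]
    have e : ∀ a, ‖(h a).op (toL1 g) - h₀.op (toL1 g)‖ =
        ∫ x, ‖m a x * g (Θ a x) - m₀ x * g (Θ₀ x)‖ := fun a => by
      rw [(h a).op_toL1 hgi, h₀.op_toL1 hgi, ← toL1_sub ((h a).integrable hgi) (h₀.integrable hgi),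
        norm_toL1 (f := fun x => m a x * g (Θ a x) - m₀ x * g (Θ₀ x))
          (((h a).integrable hgi).sub (h₀.integrable hgi))]
    simp only [e]
    -- All the maps displace points by at most ρ, so the composed functions vanish outside one
    -- common ball; this provides the dominating function.
    have hz : ∀ x y : Plane, r + ρ < ‖x‖ → ‖y - x‖ ≤ ρ → g y = 0 := by
      intro x y hx hy
      by_contra hne
      have h1 := hr (subset_tsupport g (Function.mem_support.2 hne))
      rw [mem_closedBall_zero_iff] at h1
      have h2 := norm_sub_norm_le x y
      rw [norm_sub_rev] at h2
      linarith
    have hlim := tendsto_integral_filter_of_dominated_convergence (μ := volume) (l := l)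
      (F := fun a x => ‖m a x * g (Θ a x) - m₀ x * g (Θ₀ x)‖) (f := fun _ => (0 : ℝ))
      (bound := (Metric.closedBall 0 (r + ρ)).indicator fun _ => B * G + b₀ * G) ?_ ?_ ?_ ?_
    · simpa using hlim
    · exact Eventually.of_forall fun a =>
        (((h a).integrable hgi).sub (h₀.integrable hgi)).1.norm
    · filter_upwards [hb, hρ] with a hba hρa
      refine Eventually.of_forall fun x => ?_
      rw [norm_norm]
      by_cases hx : x ∈ Metric.closedBall (0 : Plane) (r + ρ)
      · rw [indicator_of_mem hx]
        refine (norm_sub_le _ _).trans (add_le_add ?_ ?_)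
        · rw [norm_mul]
          exact mul_le_mul (((h a).norm_le x).trans hba) (hG _) (norm_nonneg _)
            ((h a).nonneg.trans hba)
        · rw [norm_mul]
          exact mul_le_mul (h₀.norm_le x) (hG _) (norm_nonneg _) h₀.nonneg
      · rw [mem_closedBall_zero_iff, not_le] at hx
        rw [hz x _ hx (hρa x), hz x _ hx (hρ₀ x), indicator_of_notMem (by simpa using hx)]
        simp
    · refine (integrable_indicator_iff Metric.isClosed_closedBall.measurableSet).2
        (integrableOn_const ?_)
      exact measure_closedBall_lt_top.ne
    · refine Eventually.of_forall fun x => ?_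
      have h1 := ((hm x).mul ((hg.tendsto _).comp (hΘ x))).sub_const (m₀ x * g (Θ₀ x))
      simpa using h1.norm
  rw [Metric.tendsto_nhds]
  intro ε hε
  have hD : ∀ᶠ a in l, ‖(h a).op‖ ≤ max (B * C) (b₀ * c₀) := by
    filter_upwards [hb, hc] with a hba hca
    exact (h a).norm_op_le.trans ((mul_le_mul hba hca (c a).2 ((h a).nonneg.trans hba)).trans
      (le_max_left _ _))
  set D := max (B * C) (b₀ * c₀)
  have hD₀ : ‖h₀.op‖ ≤ D := h₀.norm_op_le.trans (le_max_right _ _)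
  have hD0 : 0 ≤ D := (norm_nonneg _).trans hD₀
  -- Approximation by a continuous function with compact support. With `D` bounding all the operator
  -- norms, each of the two approximation errors is at most ε/3; D + 1 avoids a zero denominator.
  obtain ⟨g, hgs, hgv, hgc, hgi⟩ := (integrable_coe v).exists_hasCompactSupport_integral_sub_le
    (show 0 < ε / (3 * (D + 1)) by positivity)
  have hvg : ‖v - toL1 g‖ ≤ ε / (3 * (D + 1)) := by
    rw [← toL1_coe v, ← toL1_sub (integrable_coe v) hgi, 
      norm_toL1 (f := fun x => v x - g x) ((integrable_coe v).sub hgi)]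
    exact hgv
  have hDe : D * (ε / (3 * (D + 1))) ≤ ε / 3 := by
    have : D * (ε / (3 * (D + 1))) = D / (D + 1) * (ε / 3) := by field_simp
    rw [this]
    exact mul_le_of_le_one_left (by positivity) ((div_le_one (by positivity)).2 (by linarith))
  filter_upwards [hD, Metric.tendsto_nhds.1 (hdense g hgc hgs) (ε / 3) (by positivity)]
    with a ha hga
  rw [dist_eq_norm] at hga ⊢
  have h1 := ((h a).op.le_of_opNorm_le ha (v - toL1 g)).trans
    (mul_le_mul_of_nonneg_left hvg hD0)
  have h2 := (h₀.op.le_of_opNorm_le hD₀ (v - toL1 g)).trans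
    (mul_le_mul_of_nonneg_left hvg hD0)
  have h3 : (h a).op v - h₀.op v = (h a).op (v - toL1 g) +
      ((h a).op (toL1 g) - h₀.op (toL1 g)) - h₀.op (v - toL1 g) := by
    simp only [map_sub]; abel
  rw [h3]
  have h4 := norm_sub_le ((h a).op (v - toL1 g) + ((h a).op (toL1 g) - h₀.op (toL1 g)))
    (h₀.op (v - toL1 g))
  have h5 := norm_add_le ((h a).op (v - toL1 g)) ((h a).op (toL1 g) - h₀.op (toL1 g))
  linarith

lemma isWeight_translation (z : Plane) : IsWeight 1 1 (fun _ => 1) fun x => x - z where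
  measurable_weight := measurable_const
  measurable_map := by fun_prop
  norm_le _ := by simp
  map_le := by rw [(measurePreserving_sub_right volume z).map_eq, one_smul]

/-- Translation of `L¹` functions, `(translation z v) x = v (x - z)`. -/
def translation (z : Plane) : L1 →L[ℝ] L1 := (isWeight_translation z).op

lemma translation_toL1 (z : Plane) {f : Plane → ℝ} (hf : Integrable f) :
    translation z (toL1 f) = toL1 fun x => f (x - z) := by
  rw [translation, (isWeight_translation z).op_toL1 hf]
  simp

lemma norm_translation_apply_le (z : Plane) (v : L1) : ‖translation z v‖ ≤ ‖v‖ := by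
  have h := (translation z).le_of_opNorm_le (isWeight_translation z).norm_op_le v
  simpa using h

lemma continuous_translation (v : L1) : Continuous fun z => translation z v := by
  rw [continuous_iff_continuousAt]
  intro z₀
  refine tendsto_op isWeight_translation (isWeight_translation z₀) (B := 1) (C := 1)
    (ρ := ‖z₀‖ + 1) (Eventually.of_forall fun _ => le_rfl) (Eventually.of_forall fun _ => by simp)
    ?_ (fun x => by simp) (fun x => tendsto_const_nhds)
    (fun x => (continuous_const.sub continuous_id).tendsto z₀) v
  filter_upwards [(continuous_norm.tendsto z₀).eventually (gt_mem_nhds (lt_add_one ‖z₀‖))] with z hz x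
  simpa using le_of_lt hz

lemma translation_zero (v : L1) : translation 0 v = v := by
  conv_lhs => rw [← toL1_coe v]
  rw [translation_toL1 0 (integrable_coe v)]
  simp [toL1_coe]

lemma isWeight_mul {h : Plane → ℝ} {D : ℝ} (hm : Measurable h) (hD : ∀ x, ‖h x‖ ≤ D) :
    IsWeight D 1 h id where
  measurable_weight := hm
  measurable_map := measurable_id
  norm_le := hD
  map_le := by rw [Measure.map_id, one_smul]

end WeightedComposition

/-! ### Averages of vector-valued functions against L¹ weights -/

section Averages

variable {X : Type*} [NormedAddCommGroup X] [NormedSpace ℝ X]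

lemma integrable_smul_bounded {Ψ : Plane → X} (hc : Continuous Ψ) {D : ℝ}
    (hD : ∀ z, ‖Ψ z‖ ≤ D) {f : Plane → ℝ} (hf : Integrable f) : Integrable fun z => f z • Ψ z :=
  hf.smul_bdd D hc.aestronglyMeasurable (Eventually.of_forall hD)

/-- The operator `f ↦ ∫ f(z) Ψ(z) dz`, for a bounded continuous function `Ψ`. -/
def superposition (Ψ : Plane → X) (hc : Continuous Ψ) (D : ℝ) (hD : ∀ z, ‖Ψ z‖ ≤ D) :
    L1 →L[ℝ] X :=
  LinearMap.mkContinuous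
    { toFun := fun f => ∫ z, f z • Ψ z
      map_add' := fun f g => by
        rw [← integral_add (integrable_smul_bounded hc hD (integrable_coe f))
          (integrable_smul_bounded hc hD (integrable_coe g))]
        refine integral_congr_ae ?_
        filter_upwards [Lp.coeFn_add f g] with z hz
        rw [hz, Pi.add_apply, add_smul]
      map_smul' := fun c f => by
        rw [RingHom.id_apply, ← integral_smul]
        refine integral_congr_ae ?_
        filter_upwards [Lp.coeFn_smul c f] with z hz
        rw [hz, Pi.smul_apply, smul_eq_mul, mul_smul] } D
    (fun f => by
      rw [L1.norm_eq_integral_norm, ← integral_const_mul]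
      refine norm_integral_le_of_norm_le ((integrable_coe f).norm.const_mul D) ?_
      refine Eventually.of_forall fun z => ?_
      rw [norm_smul, mul_comm]
      exact mul_le_mul_of_nonneg_right (hD z) (norm_nonneg _))

lemma norm_superposition_le {Ψ : Plane → X} (hc : Continuous Ψ) {D : ℝ} (hD : ∀ z, ‖Ψ z‖ ≤ D) :
    ‖superposition Ψ hc D hD‖ ≤ D :=
  LinearMap.mkContinuous_norm_le _ ((norm_nonneg _).trans (hD 0)) _

end Averages

end

end ReturnHome

namespace ReturnHome

noncomputable section

/-! ### Global integral curves of bounded Lipschitz fields -/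

section GlobalFlow

variable {E : Type*} [NormedAddCommGroup E] [NormedSpace ℝ E] {F : E → E} {K : NNReal} {M : ℝ}

/-- A bounded Lipschitz vector field has global integral curves. -/
lemma exists_global_integralCurve [CompleteSpace E] (hK : LipschitzWith K F)
    (hM : ∀ x, ‖F x‖ ≤ M) (z : E) :
    ∃ γ : ℝ → E, γ 0 = z ∧ ∀ t, HasDerivAt γ (F (γ t)) t := by
  lift M to NNReal using (norm_nonneg _).trans (hM z)
  have hloc : ∀ n : ℕ, ∃ α : ℝ → E, α 0 = z ∧
      ∀ t ∈ Ioo (-(n + 1 : ℝ)) (n + 1), HasDerivAt α (F (α t)) t := by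
    intro n
    have h0 : (0 : ℝ) ∈ Icc (-(n + 1 : ℝ)) (n + 1) := by
      constructor <;> [(have : (0 : ℝ) ≤ n := n.cast_nonneg; linarith); positivity]
    -- At speed at most M a curve stays within distance M(n+1) up to time n+1, so the existence time
    -- is not limited by the radius.
    have hPL : IsPicardLindelof (fun _ => F) (⟨0, h0⟩ : Icc (-(n + 1 : ℝ)) (n + 1)) z
        (M * (n + 1)) 0 M K :=
      { lipschitzOnWith := fun _ _ => hK.lipschitzOnWith
        continuousOn := fun _ _ => continuousOn_const
        norm_le := fun _ _ x _ => hM x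
        mul_max_le := by simp }
    obtain ⟨α, h1, h2⟩ := hPL.exists_eq_forall_mem_Icc_hasDerivWithinAt₀
    exact ⟨α, h1, fun t ht => (h2 t (Ioo_subset_Icc_self ht)).hasDerivAt (Icc_mem_nhds ht.1 ht.2)⟩
  choose α hα0 hα using hloc
  have hle : ∀ n m : ℕ, n ≤ m → EqOn (α n) (α m) (Ioo (-(n + 1 : ℝ)) (n + 1)) := by
    intro n m hnm
    have hnm' : (n : ℝ) ≤ m := Nat.cast_le.2 hnm
    have hn : (0 : ℝ) ≤ n := n.cast_nonneg
    refine ODE_solution_unique_of_mem_Ioo (v := fun _ => F) (s := fun _ => univ) (K := K) (t₀ := 0)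
      (fun _ _ => hK.lipschitzOnWith) ⟨by linarith, by linarith⟩ (fun t ht => ⟨hα n t ht, trivial⟩)
      (fun t ht => ⟨hα m t ⟨by linarith [ht.1], by linarith [ht.2]⟩, trivial⟩) ?_
    rw [hα0, hα0]
  have heq : ∀ n m : ℕ, ∀ t : ℝ, |t| < n + 1 → |t| < m + 1 → α n t = α m t := by
    intro n m t hn hm
    rcases le_total n m with h | h
    · exact hle n m h (abs_lt.1 hn)
    · exact (hle m n h (abs_lt.1 hm)).symm
  -- The n-th curve is valid for |t| < n + 1, so every t is interior for the index ⌈|t|⌉. Nearby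
  -- times may have another index, but overlapping curves agree.
  refine ⟨fun t => α ⌈|t|⌉₊ t, hα0 _, fun t => ?_⟩
  have hc : ∀ s : ℝ, |s| < ⌈|s|⌉₊ + 1 := fun s => (Nat.le_ceil _).trans_lt (lt_add_one _)
  refine (hα _ t (abs_lt.1 (hc t))).congr_of_eventuallyEq ?_
  filter_upwards [(continuous_abs.tendsto t).eventually (gt_mem_nhds (hc t))] with s hs
  exact heq _ _ s (hc s) hs

variable {Φ : ℝ → E → E}

lemma dist_integralCurve_le (hK : LipschitzWith K F) {γ η : ℝ → E}
    (hγ : ∀ t, HasDerivAt γ (F (γ t)) t) (hη : ∀ t, HasDerivAt η (F (η t)) t) {s t : ℝ}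
    (hst : s ≤ t) : dist (γ t) (η t) ≤ dist (γ s) (η s) * Real.exp (K * (t - s)) :=
  dist_le_of_trajectories_ODE (v := fun _ => F) (fun _ => hK)
    (fun r _ => (hγ r).continuousAt.continuousWithinAt) (fun r _ => (hγ r).hasDerivWithinAt)
    (fun r _ => (hη r).continuousAt.continuousWithinAt) (fun r _ => (hη r).hasDerivWithinAt)
    le_rfl t ⟨hst, le_rfl⟩

/-- Backward in time, the reversed curves are integral curves of -F, which has the same Lipschitz
constant. -/
lemma dist_integralCurve_le_abs (hK : LipschitzWith K F) {γ η : ℝ → E}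
    (hγ : ∀ t, HasDerivAt γ (F (γ t)) t) (hη : ∀ t, HasDerivAt η (F (η t)) t) (s t : ℝ) :
    dist (γ t) (η t) ≤ dist (γ s) (η s) * Real.exp (K * |t - s|) := by
  rcases le_total s t with h | h
  · rw [abs_of_nonneg (sub_nonneg.2 h)]
    exact dist_integralCurve_le hK hγ hη h
  · have hrev : ∀ {γ : ℝ → E}, (∀ t, HasDerivAt γ (F (γ t)) t) → ∀ t,
        HasDerivAt (fun r => γ (-r)) (-F (γ (-t))) t := fun hγ t => by
      simpa [Function.comp_def] using (hγ (-t)).scomp t (hasDerivAt_neg t)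
    have h1 := dist_integralCurve_le (F := fun x => -F x) (K := K)
      (LipschitzWith.of_dist_le_mul fun x y => by rw [dist_neg_neg]; exact hK.dist_le_mul x y)
      (hrev hγ) (hrev hη) (neg_le_neg h)
    rw [abs_of_nonpos (sub_nonpos.2 h)]
    simp only [neg_neg] at h1
    convert h1 using 3
    ring

lemma dist_integralCurve_self_le (hM : ∀ x, ‖F x‖ ≤ M) {γ : ℝ → E}
    (hγ : ∀ t, HasDerivAt γ (F (γ t)) t) (s t : ℝ) : dist (γ t) (γ s) ≤ M * |t - s| := by
  rw [dist_eq_norm]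
  exact Convex.norm_image_sub_le_of_norm_hasDerivWithin_le (f := γ) (f' := fun r => F (γ r))
    (s := univ) (fun r _ => (hγ r).hasDerivWithinAt) (fun r _ => hM _) convex_univ trivial trivial

end GlobalFlow

/-! ### The flow and the transport density of an admissible field -/

section AdmissibleFields

variable {F : Plane → Plane}

lemma fderiv_apply_eq_sum {G : Type*} [NormedAddCommGroup G] [NormedSpace ℝ G] (L : Plane →L[ℝ] G)
    (v : Plane) : L v = ∑ i, v i • L (EuclideanSpace.single i 1) := by
  conv_lhs => rw [← (EuclideanSpace.basisFun (Fin 2) ℝ).sum_repr v]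
  simp

namespace Admissible

lemma exists_lipschitzWith (hF : Admissible F) : ∃ K, LipschitzWith K F := by
  choose M hM using hF.bounded_deriv
  have hM0 : ∀ i, 0 ≤ M i := fun i => (norm_nonneg _).trans (hM i 0)
  refine ⟨⟨∑ i, M i, Finset.sum_nonneg fun i _ => hM0 i⟩, lipschitzWith_of_nnnorm_fderiv_le
    (hF.contDiff.differentiable one_ne_zero) fun x => ?_⟩
  refine ContinuousLinearMap.opNorm_le_bound _ (NNReal.coe_nonneg _) fun v => ?_
  change _ ≤ (∑ i, M i) * ‖v‖
  rw [fderiv_apply_eq_sum, Finset.sum_mul]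
  refine norm_sum_le_of_le _ fun i _ => ?_
  rw [norm_smul, mul_comm]
  exact mul_le_mul (hM i x) (PiLp.norm_apply_le v i) (norm_nonneg _) (hM0 i)

lemma isFlow_flow (hF : Admissible F) : IsFlow F (flow F) := by
  obtain ⟨K, hK⟩ := hF.exists_lipschitzWith
  obtain ⟨M, hM⟩ := hF.bounded
  choose γ h0 h1 using exists_global_integralCurve hK hM
  have h : ∃ Φ, IsFlow F Φ := ⟨fun t z => γ z t, fun z => ⟨h0 z, h1 z⟩⟩
  rw [flow, dif_pos h]
  exact h.choose_spec

lemma continuous_divergence (hF : Admissible F) : Continuous (divergence F) :=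
  continuous_finsetSum _ fun i _ =>
    (EuclideanSpace.proj (𝕜 := ℝ) i).continuous.comp (hF.uniformContinuous_deriv i).continuous

lemma exists_divergence_le (hF : Admissible F) : ∃ D, ∀ x, ‖divergence F x‖ ≤ D := by
  choose M hM using hF.bounded_deriv
  refine ⟨∑ i, M i, fun x => norm_sum_le_of_le _ fun i _ => ?_⟩
  exact (PiLp.norm_apply_le _ i).trans (hM i x)

/-- Grönwall controls the dependence on the starting point, the speed bound the dependence on time.
-/
lemma continuous_flow (hF : Admissible F) : Continuous fun p : ℝ × Plane => flow F p.1 p.2 := by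
  obtain ⟨K, hK⟩ := hF.exists_lipschitzWith
  obtain ⟨M, hM⟩ := hF.bounded
  have hΦ := hF.isFlow_flow
  rw [continuous_iff_continuousAt]
  rintro ⟨t₀, x₀⟩
  rw [ContinuousAt, tendsto_iff_dist_tendsto_zero]
  refine squeeze_zero (fun _ => dist_nonneg) (g := fun p : ℝ × Plane =>
    dist p.2 x₀ * Real.exp (K * |p.1|) + M * |p.1 - t₀|) (fun p => ?_) ?_
  · refine (dist_triangle _ (flow F p.1 x₀) _).trans (add_le_add ?_ ?_)
    · have h := dist_integralCurve_le_abs hK (hΦ p.2).2 (hΦ x₀).2 0 p.1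
      rwa [(hΦ p.2).1, (hΦ x₀).1, sub_zero] at h
    · exact dist_integralCurve_self_le hM (hΦ x₀).2 t₀ p.1
  · have h : Continuous fun p : ℝ × Plane =>
        dist p.2 x₀ * Real.exp (K * |p.1|) + M * |p.1 - t₀| := by fun_prop
    have := h.tendsto (t₀, x₀)
    simpa using this

end Admissible

/-- An antilipschitz map enlarges the two-dimensional Hausdorff measure of preimages by at most K²,
and Lebesgue measure is a multiple of that measure. This stands in for a change of variables, and no
derivative of Θ is used. -/
lemma map_le_of_antilipschitzWith {K : NNReal} {Θ : Plane → Plane} (hΘ : Measurable Θ)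
    (hK : AntilipschitzWith K Θ) :
    Measure.map Θ volume ≤ (K ^ 2) • (volume : Measure Plane) := by
  have hd : Module.finrank ℝ Plane = 2 := finrank_euclideanSpace_fin
  set μ : Measure Plane := Measure.hausdorffMeasure (Module.finrank ℝ Plane : ℝ) with hμ
  have hvol := Measure.isAddLeftInvariant_eq_smul (volume : Measure Plane) μ
  set r := (volume : Measure Plane).addHaarScalarFactor μ
  refine Measure.le_iff.2 fun s hs => ?_
  rw [Measure.map_apply hΘ hs, Measure.smul_apply, hvol, Measure.smul_apply, Measure.smul_apply]
  have h := hK.hausdorffMeasure_preimage_le (d := (Module.finrank ℝ Plane : ℝ)) (by positivity) s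
  rw [hd] at h
  have h2 : ((K : ENNReal) ^ ((2 : ℕ) : ℝ)) = ((K ^ 2 : NNReal) : ENNReal) := by
    rw [ENNReal.rpow_natCast, ENNReal.coe_pow]
  rw [h2] at h
  rw [hμ, hd, smul_comm]
  exact smul_le_smul_of_nonneg_left h zero_le

/-- The density of the transport semigroup. -/
def transportWeight (F : Plane → Plane) (t : ℝ) (x : Plane) : ℝ :=
  Real.exp (-∫ s in (0 : ℝ)..t, divergence F (flow F (-s) x))

namespace Admissible

lemma continuous_divergence_flow (hF : Admissible F) :
    Continuous (Function.uncurry fun (p : ℝ × Plane) (s : ℝ) => divergence F (flow F (-s) p.2)) :=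
  hF.continuous_divergence.comp (hF.continuous_flow.comp
    ((continuous_snd.neg).prodMk (continuous_snd.comp continuous_fst)))

lemma continuous_transportWeight (hF : Admissible F) :
    Continuous fun p : ℝ × Plane => transportWeight F p.1 p.2 :=
  (intervalIntegral.continuous_parametric_intervalIntegral_of_continuous (a₀ := 0)
    hF.continuous_divergence_flow continuous_fst).neg.rexp

/-- The bound on the divergence controls the density. Flowing back from time -t to 0 expands
distances by at most exp(K|t|), so the flow at time -t is antilipschitz; the square is the
dimension. -/
lemma exists_isWeight (hF : Admissible F) : ∃ (D : ℝ) (K : NNReal), ∀ t,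
    IsWeight (Real.exp (D * |t|)) ((Real.toNNReal (Real.exp (K * |t|))) ^ 2)
      (transportWeight F t) (flow F (-t)) := by
  obtain ⟨K, hK⟩ := hF.exists_lipschitzWith
  obtain ⟨D, hD⟩ := hF.exists_divergence_le
  have hΦ := hF.isFlow_flow
  have hmeas : ∀ t, Measurable (flow F t) := fun t =>
    (hF.continuous_flow.comp (by fun_prop : Continuous fun x : Plane => (t, x))).measurable
  refine ⟨D, K, fun t => ⟨?_, hmeas _, fun x => ?_, map_le_of_antilipschitzWith (hmeas _) ?_⟩⟩
  · exact (hF.continuous_transportWeight.comp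
      (by fun_prop : Continuous fun x : Plane => (t, x))).measurable
  · rw [transportWeight, Real.norm_of_nonneg (Real.exp_pos _).le, Real.exp_le_exp]
    have h := intervalIntegral.norm_integral_le_of_norm_le_const (a := 0) (b := t)
      (f := fun s => divergence F (flow F (-s) x)) (C := D) fun s _ => hD _
    rw [sub_zero] at h
    exact (neg_le_abs _).trans h
  · refine AntilipschitzWith.of_le_mul_dist fun x y => ?_
    have h := dist_integralCurve_le_abs hK (hΦ x).2 (hΦ y).2 (-t) 0
    rw [(hΦ x).1, (hΦ y).1, zero_sub, neg_neg] at h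
    rw [Real.coe_toNNReal _ (Real.exp_pos _).le, mul_comm]
    exact h

end Admissible

lemma divergence_smul {φ : Plane → ℝ} {x : Plane} (hφ : DifferentiableAt ℝ φ x)
    (hF : DifferentiableAt ℝ F x) :
    divergence (fun x' => φ x' • F x') x = φ x * divergence F x + fderiv ℝ φ x (F x) := by
  rw [fderiv_apply_eq_sum (fderiv ℝ φ x) (F x)]
  simp only [divergence, partialDeriv, fderiv_fun_smul hφ hF, Finset.mul_sum,
    ← Finset.sum_add_distrib]
  refine Finset.sum_congr rfl fun i _ => ?_
  simp [mul_comm]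

end AdmissibleFields

end

end ReturnHome

namespace ReturnHome

noncomputable section

/-! ### The transport family and its closed integrated graph -/

section Transport

variable {F : Plane → Plane}

/-- The operators of the transport semigroup. -/
def transportOp (hF : Admissible F) (t : ℝ) : L1 →L[ℝ] L1 :=
  (hF.exists_isWeight.choose_spec.choose_spec t).op

lemma transportOp_toL1 (hF : Admissible F) (t : ℝ) {f : Plane → ℝ} (hf : Integrable f) :
    transportOp hF t (toL1 f) = toL1 fun x => transportWeight F t x * f (flow F (-t) x) :=
  (hF.exists_isWeight.choose_spec.choose_spec t).op_toL1 hf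

lemma continuous_transportOp (hF : Admissible F) (v : L1) :
    Continuous fun t => transportOp hF t v := by
  have h := hF.exists_isWeight.choose_spec.choose_spec
  set D := hF.exists_isWeight.choose
  set K := hF.exists_isWeight.choose_spec.choose
  obtain ⟨M, hM⟩ := hF.bounded
  have hM0 : 0 ≤ M := (norm_nonneg _).trans (hM 0)
  have hflow : ∀ t x, ‖flow F t x - x‖ ≤ M * |t| := fun t x => by
    have h1 := dist_integralCurve_self_le hM (hF.isFlow_flow x).2 0 t
    rwa [(hF.isFlow_flow x).1, dist_eq_norm, sub_zero] at h1
  rw [continuous_iff_continuousAt]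
  intro t₀
  have hnear : ∀ᶠ t in 𝓝 t₀, |t| < |t₀| + 1 :=
    (continuous_abs.tendsto t₀).eventually (gt_mem_nhds (lt_add_one _))
  have hb : ContinuousAt (fun t : ℝ => Real.exp (D * |t|)) t₀ := by fun_prop
  have hc : ContinuousAt (fun t : ℝ => (((Real.toNNReal (Real.exp (K * |t|))) ^ 2 : NNReal) : ℝ))
      t₀ := by fun_prop
  refine tendsto_op h (h t₀) (ρ := M * (|t₀| + 1))
    ((hb.eventually (gt_mem_nhds (lt_add_one _))).mono fun _ => le_of_lt)
    ((hc.eventually (gt_mem_nhds (lt_add_one _))).mono fun _ => le_of_lt) ?_ ?_ ?_ ?_ v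
  · filter_upwards [hnear] with t ht x
    refine (hflow _ x).trans (mul_le_mul_of_nonneg_left ?_ hM0)
    rw [abs_neg]
    exact ht.le
  · intro x
    refine (hflow _ x).trans (mul_le_mul_of_nonneg_left ?_ hM0)
    rw [abs_neg]
    linarith
  · intro x
    exact (hF.continuous_transportWeight.comp
      (by fun_prop : Continuous fun t : ℝ => (t, x))).tendsto t₀
  · intro x
    exact (hF.continuous_flow.comp
      (by fun_prop : Continuous fun t : ℝ => (-t, x))).tendsto t₀

lemma transportOp_zero (hF : Admissible F) (v : L1) : transportOp hF 0 v = v := by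
  conv_lhs => rw [← toL1_coe v]
  rw [transportOp_toL1 hF 0 (integrable_coe v)]
  simp [transportWeight, (hF.isFlow_flow _).1, toL1_coe]

lemma exists_isIntegrableFamily_transportOp (hF : Admissible F) :
    ∃ k, IsIntegrableFamily (transportOp hF) k := by
  have h := hF.exists_isWeight.choose_spec.choose_spec
  refine ⟨_, fun v => (continuous_transportOp hF v).continuousOn,
    fun t _ => (h t).norm_op_le, fun τ => ?_⟩
  refine (Continuous.integrableOn_Icc ?_).mono_set Ioc_subset_Icc_self
  fun_prop

lemma stronglyContinuous_const (L : L1 →L[ℝ] L1) : StronglyContinuous fun _ => L :=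
  fun _ => continuousOn_const

/-- The operator `v ↦ ∫ s in 0..t, T(s) v` for the transport semigroup `T`. -/
def transportIntegral (hF : Admissible F) (t : ℝ) : L1 →L[ℝ] L1 :=
  convolution _ _ (stronglyContinuous_const (ContinuousLinearMap.id ℝ L1))
    (exists_isIntegrableFamily_transportOp hF).choose_spec t

lemma transportIntegral_apply (hF : Admissible F) (t : ℝ) (v : L1) :
    transportIntegral hF t v = ∫ s in Ioc 0 t, transportOp hF s v := rfl

/-- A closed subspace in the graph of the convection operator: the pairs `(v, f)` with
`T(t) v - v = ∫ s in 0..t, T(s) f` for `0 ≤ t ≤ 1`. -/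
def transportGraph (hF : Admissible F) : Submodule ℝ (L1 × L1) :=
  ⨅ t : Icc (0 : ℝ) 1, LinearMap.ker
    (((transportOp hF t).comp (ContinuousLinearMap.fst ℝ L1 L1) - ContinuousLinearMap.fst ℝ L1 L1
      - (transportIntegral hF t).comp (ContinuousLinearMap.snd ℝ L1 L1) :
        L1 × L1 →L[ℝ] L1) : L1 × L1 →ₗ[ℝ] L1)

lemma mem_transportGraph (hF : Admissible F) {v f : L1} :
    (v, f) ∈ transportGraph hF ↔ ∀ t ∈ Icc (0 : ℝ) 1,
      transportOp hF t v - v = ∫ s in Ioc 0 t, transportOp hF s f := by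
  simp only [transportGraph, Submodule.mem_iInf, LinearMap.mem_ker, Subtype.forall]
  refine forall₂_congr fun t _ => ?_
  rw [← sub_eq_zero (b := ∫ s in Ioc 0 t, transportOp hF s f), ← transportIntegral_apply]
  rfl

/-- An intersection of kernels of bounded operators. Closedness is the reason for using the
integrated equation in place of the generator. -/
lemma isClosed_transportGraph (hF : Admissible F) :
    IsClosed (transportGraph hF : Set (L1 × L1)) := by
  rw [transportGraph, Submodule.coe_iInf]
  exact isClosed_iInter fun t => ContinuousLinearMap.isClosed_ker _

lemma transportGraph_subset_convectionOp (hF : Admissible F) :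
    (transportGraph hF : Set (L1 × L1)) ⊆ convectionOp F := by
  rintro ⟨v, f⟩ h
  refine mem_generator_of_sub_eq_integral (T := fun t v => transportOp hF t v)
    (continuous_transportOp hF f).continuousOn (transportOp_zero hF f) one_pos fun t ht => ?_
  rw [intervalIntegral.integral_of_le ht.1.le]
  exact (mem_transportGraph hF).1 h t ⟨ht.1.le, ht.2⟩

lemma convectionOp_unique {v a b : L1} (ha : (v, a) ∈ convectionOp F)
    (hb : (v, b) ∈ convectionOp F) : a = b :=
  generator_unique ha hb

lemma eq_zero_of_mem_transportGraph (hF : Admissible F) (b : L1)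
    (h : ((0 : L1), b) ∈ transportGraph hF) : b = 0 :=
  convectionOp_unique (transportGraph_subset_convectionOp hF h)
    (transportGraph_subset_convectionOp hF (transportGraph hF).zero_mem)

/-- On `C¹` functions the convection operator is `φ ↦ -∇ · (φ F)`. -/
lemma mem_transportGraph_of_contDiff (hF : Admissible F) {φ : Plane → ℝ} (hφ : ContDiff ℝ 1 φ)
    (hφi : Integrable φ) (hψi : Integrable fun x => -divergence (fun x' => φ x' • F x') x) :
    (toL1 φ, toL1 fun x => -divergence (fun x' => φ x' • F x') x) ∈ transportGraph hF := by
  set ψ : Plane → ℝ := fun x => -divergence (fun x' => φ x' • F x') x with hψ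
  have hφd : Differentiable ℝ φ := hφ.differentiable one_ne_zero
  have hψe : ∀ x, ψ x = -(φ x * divergence F x + fderiv ℝ φ x (F x)) := fun x => by
    rw [hψ]
    simp only
    rw [divergence_smul (hφd x) (hF.contDiff.differentiable one_ne_zero x)]
  have hψc : Continuous ψ := by
    rw [funext hψe]
    exact ((hφ.continuous.mul hF.continuous_divergence).add
      ((hφ.continuous_fderiv one_ne_zero).clm_apply hF.contDiff.continuous)).neg
  set κ : ℝ → Plane → ℝ := fun s x => transportWeight F s x * ψ (flow F (-s) x) with hκ
  have hflowc : Continuous fun p : ℝ × Plane => flow F (-p.1) p.2 :=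
    hF.continuous_flow.comp (continuous_fst.neg.prodMk continuous_snd)
  have hκc : Continuous (Function.uncurry κ) :=
    hF.continuous_transportWeight.mul (hψc.comp hflowc)
  -- Along a characteristic the density contributes -φ ∇·F and the moving point -∇φ·F, which
  -- together give ψ. The flow is differentiated only in time.
  have hder : ∀ x s, HasDerivAt (fun s => transportWeight F s x * φ (flow F (-s) x)) (κ s x) s := by
    intro x s
    have h1 : HasDerivAt (fun s => flow F (-s) x) (-F (flow F (-s) x)) s := by
      simpa [Function.comp_def] using ((hF.isFlow_flow x).2 (-s)).scomp s (hasDerivAt_neg s)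
    have h2 : HasDerivAt (fun s => φ (flow F (-s) x))
        (fderiv ℝ φ (flow F (-s) x) (-F (flow F (-s) x))) s :=
      (hφd (flow F (-s) x)).hasFDerivAt.comp_hasDerivAt s h1
    have hcont : Continuous fun s => divergence F (flow F (-s) x) :=
      hF.continuous_divergence.comp
        (hflowc.comp (by fun_prop : Continuous fun s : ℝ => (s, x)))
    have h3 : HasDerivAt (fun s => transportWeight F s x)
        (transportWeight F s x * -divergence F (flow F (-s) x)) s :=
      (hcont.integral_hasStrictDerivAt 0 s).hasDerivAt.neg.exp
    refine (h3.mul h2).congr_deriv ?_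
    simp only [hκ, hψe, map_neg]
    ring
  have hint : ∀ x, ∀ t, 0 ≤ t → ∫ s in Ioc 0 t, κ s x =
      transportWeight F t x * φ (flow F (-t) x) - φ x := by
    intro x t ht
    rw [← intervalIntegral.integral_of_le ht,
      intervalIntegral.integral_eq_sub_of_hasDerivAt (fun s _ => hder x s)
      ((hκc.comp (by fun_prop : Continuous fun s : ℝ => (s, x))).intervalIntegrable _ _)]
    simp [transportWeight, (hF.isFlow_flow x).1]
  rw [mem_transportGraph]
  intro t ht
  have hw := hF.exists_isWeight.choose_spec.choose_spec
  have hκi : ∀ s, Integrable (κ s) := fun s => (hw s).integrable hψi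
  have hΨ : Integrable (fun s => transportOp hF s (toL1 ψ)) (volume.restrict (Ioc 0 t)) :=
    ((continuous_transportOp hF (toL1 ψ)).integrableOn_Icc).mono_set Ioc_subset_Icc_self
  -- The L¹ norm of κ s is that of the orbit of ψ, which is continuous in s.
  have hprod : Integrable (Function.uncurry κ) ((volume.restrict (Ioc 0 t)).prod volume) := by
    refine (integrable_prod_iff hκc.aestronglyMeasurable).2
      ⟨Eventually.of_forall hκi, hΨ.norm.congr (Eventually.of_forall fun s => ?_)⟩
    simp only
    rw [transportOp_toL1 hF s hψi]
    exact norm_toL1 (hκi s)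
  rw [integral_eq_toL1 hprod hΨ (Eventually.of_forall fun s => ?_), transportOp_toL1 hF t hφi,
    ← toL1_sub ((hw t).integrable hφi) hφi]
  · exact congrArg toL1 (funext fun x => (hint x t ht.1).symm)
  · rw [transportOp_toL1 hF s hψi]
    exact coeFn_toL1 (hκi s)

end Transport

end

end ReturnHome

namespace ReturnHome

noncomputable section

/-! ### Gaussian kernels and their derivatives -/

section GaussianKernels

open Real

/-- The Gaussian kernel `exp (-|x|² / c) / (π c)`. -/
def gaussKernel (c : ℝ) (x : Plane) : ℝ := 1 / (π * c) * rexp (-‖x‖ ^ 2 / c)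

lemma heatKernel_eq (ε t : ℝ) : heatKernel ε t = gaussKernel (4 * ε ^ 2 * t) := by
  funext x
  rw [heatKernel, gaussKernel]
  congr 2
  ring

lemma gaussian_eq (σ : ℝ) : gaussian σ = gaussKernel (2 * σ ^ 2) := by
  funext x
  rw [gaussian, gaussKernel]
  congr 2
  ring

lemma integral_exp_neg_mul_sq_norm {b : ℝ} (hb : 0 < b) :
    ∫ x : Plane, rexp (-b * ‖x‖ ^ 2) = π / b := by
  rw [GaussianFourier.integral_rexp_neg_mul_sq_norm hb, finrank_euclideanSpace_fin]
  simp

variable {c : ℝ}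

lemma gaussKernel_nonneg (hc : 0 < c) (x : Plane) : 0 ≤ gaussKernel c x := by
  unfold gaussKernel; positivity

lemma integral_gaussKernel (hc : 0 < c) : ∫ x, gaussKernel c x = 1 := by
  have h := integral_exp_neg_mul_sq_norm (inv_pos.2 hc)
  have h2 : ∀ x : Plane, gaussKernel c x = 1 / (π * c) * rexp (-c⁻¹ * ‖x‖ ^ 2) := fun x => by
    rw [gaussKernel]
    congr 2
    ring
  simp only [h2]
  rw [integral_const_mul, h]
  have := pi_pos.ne'
  field_simp

lemma integrable_gaussKernel (hc : 0 < c) : Integrable (gaussKernel c) := by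
  -- The integral of a nonintegrable function is 0 by convention, but this one is 1.
  by_contra h
  have h1 := integral_gaussKernel hc
  rw [integral_undef h] at h1
  exact zero_ne_one h1

lemma contDiff_gaussKernel (c : ℝ) {n : WithTop ℕ∞} : ContDiff ℝ n (gaussKernel c) := by
  unfold gaussKernel
  exact contDiff_const.mul (((contDiff_norm_sq ℝ).neg.div_const c).exp)

lemma continuous_gaussKernel (c : ℝ) : Continuous (gaussKernel c) :=
  (contDiff_gaussKernel c (n := 0)).continuous

/-- Completing the square in z; the remaining kernel is centered at bx/(a+b) and has unit mass,
whence the semigroup law. -/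
lemma gaussKernel_mul_gaussKernel {a b : ℝ} (ha : 0 < a) (hb : 0 < b) (x z : Plane) :
    gaussKernel a (x - z) * gaussKernel b z =
      gaussKernel (a + b) x * gaussKernel (a * b / (a + b)) (z - (b / (a + b)) • x) := by
  have hπ := pi_pos.ne'
  have hab : a + b ≠ 0 := by positivity
  have hE : -‖x - z‖ ^ 2 / a + -‖z‖ ^ 2 / b =
      -‖x‖ ^ 2 / (a + b) + -‖z - (b / (a + b)) • x‖ ^ 2 / (a * b / (a + b)) := by
    rw [norm_sub_sq_real, norm_sub_sq_real, inner_smul_right, norm_smul, real_inner_comm x z,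
      mul_pow, norm_eq_abs, sq_abs]
    field_simp
    ring
  simp only [gaussKernel]
  calc 1 / (π * a) * rexp (-‖x - z‖ ^ 2 / a) * (1 / (π * b) * rexp (-‖z‖ ^ 2 / b))
      = 1 / (π * a) * (1 / (π * b)) * rexp (-‖x - z‖ ^ 2 / a + -‖z‖ ^ 2 / b) := by
        rw [exp_add]; ring
    _ = 1 / (π * (a + b)) * (1 / (π * (a * b / (a + b)))) *
        rexp (-‖x‖ ^ 2 / (a + b) + -‖z - (b / (a + b)) • x‖ ^ 2 / (a * b / (a + b))) := by
        rw [hE]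
        congr 1
        field_simp
    _ = _ := by rw [exp_add]; ring

/-- The semigroup law of the Gaussian kernels. -/
lemma integral_gaussKernel_mul_gaussKernel {a b : ℝ} (ha : 0 < a) (hb : 0 < b) (x z : Plane) :
    ∫ y, gaussKernel b (y - z) * gaussKernel a (x - y) = gaussKernel (a + b) (x - z) := by
  have h1 : ∫ y, gaussKernel b (y - z) * gaussKernel a (x - y) =
      ∫ y, gaussKernel b y * gaussKernel a (x - z - y) := by
    rw [← integral_sub_right_eq_self (fun y => gaussKernel b y * gaussKernel a (x - z - y)) z]
    simp only [sub_sub_sub_cancel_right]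
  rw [h1]
  simp only [mul_comm (gaussKernel b _), gaussKernel_mul_gaussKernel ha hb]
  rw [integral_const_mul, integral_sub_right_eq_self
    (fun y => gaussKernel (a * b / (a + b)) y), integral_gaussKernel (by positivity), mul_one]

/-- The partial derivatives of the Gaussian kernel. -/
def gaussKernelDeriv (c : ℝ) (i : Fin 2) (x : Plane) : ℝ := -(2 / c) * x i * gaussKernel c x

lemma hasFDerivAt_gaussKernel (c : ℝ) (x : Plane) :
    HasFDerivAt (gaussKernel c) ((-(2 / c) * gaussKernel c x) • innerSL ℝ x) x := by
  have h1 := (hasStrictFDerivAt_norm_sq x).hasFDerivAt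
  have h2 := ((h1.const_mul (-c⁻¹)).exp).const_mul (1 / (π * c))
  have h3 : gaussKernel c = fun x => 1 / (π * c) * rexp (-c⁻¹ * ‖x‖ ^ 2) := by
    funext x
    rw [gaussKernel]
    congr 2
    ring
  rw [h3]
  refine h2.congr_fderiv ?_
  ext v
  simp
  ring

lemma fderiv_gaussKernel_single (c : ℝ) (i : Fin 2) (x : Plane) :
    fderiv ℝ (gaussKernel c) x (EuclideanSpace.single i 1) = gaussKernelDeriv c i x := by
  rw [(hasFDerivAt_gaussKernel c x).fderiv, gaussKernelDeriv]
  simp [EuclideanSpace.inner_single_right]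
  ring

lemma continuous_gaussKernelDeriv (c : ℝ) (i : Fin 2) : Continuous (gaussKernelDeriv c i) := by
  unfold gaussKernelDeriv
  exact (continuous_const.mul (EuclideanSpace.proj (𝕜 := ℝ) i).continuous).mul
    (continuous_gaussKernel c)

/-- With u = ‖x‖/√c, half of the Gaussian decay absorbs the linear factor, as u exp(-u²/2) ≤ 1. The
other half is the kernel of parameter 2c, whose normalization doubles the factor 2. Integrating
leaves the singularity 4/√c. -/
lemma norm_gaussKernelDeriv_le (hc : 0 < c) (i : Fin 2) (x : Plane) :
    ‖gaussKernelDeriv c i x‖ ≤ 4 / √c * gaussKernel (2 * c) x := by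
  have hsc : 0 < √c := sqrt_pos.2 hc
  have hcs : c = √c ^ 2 := (sq_sqrt hc.le).symm
  have hπ := pi_pos
  set u := ‖x‖ / √c with hu
  have hu0 : 0 ≤ u := by positivity
  have hux : ‖x‖ = √c * u := by rw [hu]; field_simp
  have h1 : u * rexp (-(u ^ 2 / 2)) ≤ 1 := by
    rw [exp_neg, ← div_eq_mul_inv, div_le_one (exp_pos _)]
    have := add_one_le_exp (u ^ 2 / 2)
    nlinarith [sq_nonneg (u - 1)]
  have h2 : ‖gaussKernelDeriv c i x‖ ≤ 2 / c * ‖x‖ * gaussKernel c x := by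
    rw [gaussKernelDeriv, norm_mul, norm_mul, norm_neg, norm_of_nonneg (gaussKernel_nonneg hc x),
      norm_of_nonneg (by positivity : 0 ≤ 2 / c)]
    gcongr
    · exact gaussKernel_nonneg hc x
    · exact PiLp.norm_apply_le x i
  refine h2.trans ?_
  have h3 : rexp (-‖x‖ ^ 2 / c) = rexp (-(u ^ 2 / 2)) * rexp (-(u ^ 2 / 2)) := by
    rw [← exp_add, hux, mul_pow, ← hcs]
    congr 1
    field_simp
    ring
  have h4 : rexp (-‖x‖ ^ 2 / (2 * c)) = rexp (-(u ^ 2 / 2)) := by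
    rw [hux, mul_pow, ← hcs]
    congr 1
    field_simp
  have h5 : 2 / c * ‖x‖ * gaussKernel c x =
      (4 / √c * (1 / (π * (2 * c)) * rexp (-(u ^ 2 / 2)))) * (u * rexp (-(u ^ 2 / 2))) := by
    rw [gaussKernel, h3, hux]
    have hcc : 1 / √c * c = √c := by
      rw [div_mul_eq_mul_div, one_mul, div_sqrt]
    rw [← hcc]
    field_simp
    rw [sq_sqrt hc.le]
    ring
  rw [h5, gaussKernel, h4]
  exact mul_le_of_le_one_right (by positivity) h1

lemma integrable_gaussKernelDeriv (hc : 0 < c) (i : Fin 2) : Integrable (gaussKernelDeriv c i) :=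
  Integrable.mono' ((integrable_gaussKernel (by positivity : 0 < 2 * c)).const_mul (4 / √c))
    (continuous_gaussKernelDeriv c i).aestronglyMeasurable
    (Eventually.of_forall (norm_gaussKernelDeriv_le hc i))

lemma norm_toL1_gaussKernelDeriv_le (hc : 0 < c) (i : Fin 2) :
    ‖toL1 (gaussKernelDeriv c i)‖ ≤ 4 / √c := by
  have h2c : 0 < 2 * c := by positivity
  rw [norm_toL1 (integrable_gaussKernelDeriv hc i)]
  refine (integral_mono (integrable_gaussKernelDeriv hc i).norm
    ((integrable_gaussKernel h2c).const_mul (4 / √c)) (norm_gaussKernelDeriv_le hc i)).trans ?_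
  rw [integral_const_mul, integral_gaussKernel h2c, mul_one]

lemma norm_toL1_gaussKernel (hc : 0 < c) : ‖toL1 (gaussKernel c)‖ = 1 := by
  rw [norm_toL1 (integrable_gaussKernel hc), ← integral_gaussKernel hc]
  exact integral_congr_ae (Eventually.of_forall fun x => norm_of_nonneg (gaussKernel_nonneg hc x))

/-- The derivative of the Gaussian kernel in its parameter; a quarter of its Laplacian. -/
def gaussKernelRate (c : ℝ) (x : Plane) : ℝ := (‖x‖ ^ 2 / c ^ 2 - 1 / c) * gaussKernel c x

lemma hasDerivAt_gaussKernel_param (hc : 0 < c) (x : Plane) :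
    HasDerivAt (fun c => gaussKernel c x) (gaussKernelRate c x) c := by
  have hπ := pi_pos.ne'
  have h1 : HasDerivAt (fun c : ℝ => 1 / π * c⁻¹) (1 / π * (-(c ^ 2)⁻¹)) c :=
    (hasDerivAt_inv hc.ne').const_mul _
  have h2 : HasDerivAt (fun c : ℝ => rexp (-‖x‖ ^ 2 * c⁻¹))
      (rexp (-‖x‖ ^ 2 * c⁻¹) * (-‖x‖ ^ 2 * (-(c ^ 2)⁻¹))) c :=
    ((hasDerivAt_inv hc.ne').const_mul _).exp
  have h3 := h1.mul h2
  refine (h3.congr_deriv ?_).congr_of_eventuallyEq (Eventually.of_forall fun c => ?_)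
  · rw [gaussKernelRate, gaussKernel, div_eq_mul_inv (-‖x‖ ^ 2) c]
    field_simp
    ring
  · simp only [gaussKernel, Pi.mul_apply]
    rw [div_eq_mul_inv (-‖x‖ ^ 2) c, one_div, mul_inv, one_div]

lemma continuous_gaussKernelRate (c : ℝ) : Continuous (gaussKernelRate c) := by
  unfold gaussKernelRate
  exact (by fun_prop : Continuous fun x : Plane => ‖x‖ ^ 2 / c ^ 2 - 1 / c).mul
    (continuous_gaussKernel c)

lemma gaussKernel_le (hc : 0 < c) (x : Plane) : gaussKernel c x ≤ 1 / (π * c) := by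
  have hπ := pi_pos
  refine mul_le_of_le_one_right (by positivity) (exp_le_one_iff.2 ?_)
  rw [neg_div]
  exact neg_nonpos.2 (by positivity)

lemma norm_gaussKernelRate_le (hc : 0 < c) (x : Plane) :
    ‖gaussKernelRate c x‖ ≤ 2 / (π * c ^ 2) := by
  have hπ := pi_pos
  have h0 := gaussKernel_nonneg hc x
  have h1 : ‖x‖ ^ 2 / c * gaussKernel c x ≤ 1 / (π * c) := by
    have h2 : ‖x‖ ^ 2 / c * rexp (-(‖x‖ ^ 2 / c)) ≤ 1 := by
      rw [exp_neg, ← div_eq_mul_inv, div_le_one (exp_pos _)]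
      linarith [add_one_le_exp (‖x‖ ^ 2 / c)]
    rw [gaussKernel, neg_div, mul_left_comm]
    exact mul_le_of_le_one_right (by positivity) h2
  have h3 := gaussKernel_le hc x
  have h4 : gaussKernelRate c x = 1 / c * (‖x‖ ^ 2 / c * gaussKernel c x) - 1 / c * gaussKernel c x := by
    rw [gaussKernelRate]
    field_simp
  rw [h4]
  refine (norm_sub_le _ _).trans ?_
  rw [norm_of_nonneg (by positivity), norm_of_nonneg (by positivity)]
  have h5 : 2 / (π * c ^ 2) = 1 / c * (1 / (π * c)) + 1 / c * (1 / (π * c)) := by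
    field_simp
    ring
  rw [h5]
  gcongr

lemma hasFDerivAt_gaussKernelDeriv (c : ℝ) (i : Fin 2) (x : Plane) :
    HasFDerivAt (gaussKernelDeriv c i)
      ((-(2 / c) * x i) • ((-(2 / c) * gaussKernel c x) • innerSL ℝ x) +
        gaussKernel c x • (-(2 / c)) • (EuclideanSpace.proj i : Plane →L[ℝ] ℝ)) x :=
  ((EuclideanSpace.proj (𝕜 := ℝ) i).hasFDerivAt.const_mul (-(2 / c))).mul
    (hasFDerivAt_gaussKernel c x)

/-- The heat equation of the kernel: its Laplacian is four times its derivative in c. -/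
lemma sum_fderiv_gaussKernelDeriv (hc : 0 < c) (x : Plane) :
    ∑ i, fderiv ℝ (gaussKernelDeriv c i) x (EuclideanSpace.single i 1) =
      4 * gaussKernelRate c x := by
  have hn : ‖x‖ ^ 2 = x 0 ^ 2 + x 1 ^ 2 := by
    rw [EuclideanSpace.real_norm_sq_eq, Fin.sum_univ_two]
  simp only [(hasFDerivAt_gaussKernelDeriv c _ x).fderiv, Fin.sum_univ_two]
  simp [EuclideanSpace.inner_single_right]
  rw [gaussKernelRate, hn]
  field_simp
  ring

end GaussianKernels

end

end ReturnHome

namespace ReturnHome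

noncomputable section

/-! ### The heat semigroup on L¹ -/

section Heat

open Real

variable {c : ℝ}

lemma norm_translation_toL1_gaussKernel_le (hc : 0 < c) (z : Plane) :
    ‖translation z (toL1 (gaussKernel c))‖ ≤ 1 :=
  (norm_translation_apply_le _ _).trans (norm_toL1_gaussKernel hc).le

/-- Convolution with a Gaussian kernel. -/
def gaussConvolution (c : ℝ) (hc : 0 < c) : L1 →L[ℝ] L1 :=
  superposition (fun z => translation z (toL1 (gaussKernel c)))
    (continuous_translation _) 1 (norm_translation_toL1_gaussKernel_le hc)

lemma gaussConvolution_apply (hc : 0 < c) (f : L1) :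
    gaussConvolution c hc f = ∫ z, f z • translation z (toL1 (gaussKernel c)) := rfl

lemma integrable_convolution_kernel {f g : Plane → ℝ} (hf : Integrable f) (hg : Integrable g) :
    Integrable (Function.uncurry fun z x => f z * g (x - z))
      ((volume : Measure Plane).prod (volume : Measure Plane)) :=
  (hf.convolution_integrand (ContinuousLinearMap.mul ℝ ℝ) hg).swap

lemma integral_smul_translation {f g : Plane → ℝ} (hf : Integrable f) (hg : Integrable g) :
    ∫ z, f z • translation z (toL1 g) = toL1 fun x => ∫ z, f z * g (x - z) := by
  refine integral_eq_toL1 (κ := fun z x => f z * g (x - z)) (integrable_convolution_kernel hf hg)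
    (integrable_smul_bounded (continuous_translation _)
    (fun z => norm_translation_apply_le z (toL1 g)) hf) (Eventually.of_forall fun z => ?_)
  have h : (translation z (toL1 g) : Plane → ℝ) =ᵐ[volume] fun x => g (x - z) := by
    rw [translation_toL1 z hg]
    exact coeFn_toL1 (hg.comp_sub_right z)
  filter_upwards [Lp.coeFn_smul (f z) (translation z (toL1 g)), h] with x h1 h2
  rw [h1, Pi.smul_apply, h2, smul_eq_mul]

lemma integral_convolution_comm (f g : Plane → ℝ) (x : Plane) :
    ∫ z, f z * g (x - z) = ∫ z, g z * f (x - z) := by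
  rw [← integral_sub_left_eq_self (fun z => f z * g (x - z)) volume x]
  simp [mul_comm]

lemma gaussConvolution_toL1 (hc : 0 < c) {f : Plane → ℝ} (hf : Integrable f) :
    gaussConvolution c hc (toL1 f) = toL1 fun x => ∫ z, f z * gaussKernel c (x - z) := by
  rw [gaussConvolution_apply, ← integral_smul_translation hf (integrable_gaussKernel hc)]
  refine integral_congr_ae ?_
  filter_upwards [coeFn_toL1 hf] with z hz
  rw [hz]

lemma gaussConvolution_eq_integral_translation (hc : 0 < c) (f : L1) :
    gaussConvolution c hc f = ∫ z, gaussKernel c z • translation z f := by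
  have h := integral_smul_translation (integrable_gaussKernel hc) (integrable_coe f)
  rw [toL1_coe] at h
  rw [h, ← toL1_coe f, gaussConvolution_toL1 hc (integrable_coe f), toL1_coe]
  exact congrArg toL1 (funext fun x => integral_convolution_comm _ _ x)

lemma gaussConvolution_translation {a b : ℝ} (ha : 0 < a) (hb : 0 < b) (z : Plane) :
    gaussConvolution a ha (translation z (toL1 (gaussKernel b))) =
      translation z (toL1 (gaussKernel (a + b))) := by
  rw [translation_toL1 z (integrable_gaussKernel hb),
    translation_toL1 z (integrable_gaussKernel (add_pos ha hb)),
    gaussConvolution_toL1 ha ((integrable_gaussKernel hb).comp_sub_right z)]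
  exact congrArg toL1 (funext fun x => integral_gaussKernel_mul_gaussKernel ha hb x z)

/-- A bounded operator passes through the Bochner integral, so the law need only be known on
translated kernels. -/
lemma gaussConvolution_gaussConvolution {a b : ℝ} (ha : 0 < a) (hb : 0 < b) (f : L1) :
    gaussConvolution a ha (gaussConvolution b hb f) = gaussConvolution (a + b) (add_pos ha hb) f := by
  rw [gaussConvolution_apply hb, ← (gaussConvolution a ha).integral_comp_comm
    (integrable_smul_bounded (continuous_translation _)
      (norm_translation_toL1_gaussKernel_le hb) (integrable_coe f)), gaussConvolution_apply]
  simp only [map_smul, gaussConvolution_translation ha hb]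

/-- Convolution with a Gaussian kernel as an average of translations with a fixed weight. -/
lemma gaussConvolution_eq_integral_rescaled (hc : 0 < c) (f : L1) :
    gaussConvolution c hc f = ∫ z, gaussKernel 1 z • translation (√c • z) f := by
  have h := Measure.integral_comp_smul (volume : Measure Plane)
    (fun z => gaussKernel c z • translation z f) (√c)
  have h1 : ∀ z : Plane, gaussKernel c (√c • z) = c⁻¹ * gaussKernel 1 z := fun z => by
    rw [gaussKernel, gaussKernel, norm_smul, mul_pow, norm_of_nonneg (sqrt_nonneg c), sq_sqrt hc.le]
    have := pi_pos.ne'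
    field_simp
  simp only [h1, mul_smul, finrank_euclideanSpace_fin, sq_sqrt hc.le, abs_inv, abs_of_pos hc] at h
  rw [integral_smul] at h
  rw [gaussConvolution_eq_integral_translation hc f]
  exact (smul_right_injective _ (inv_ne_zero hc.ne') h).symm

/-- The weight no longer depends on the scale, so dominated convergence works at r = 0 too; this is
the strong continuity of the heat semigroup at time 0. -/
lemma continuous_integral_rescaled (f : L1) :
    Continuous fun r : ℝ => ∫ z, gaussKernel 1 z • translation (r • z) f := by
  refine continuous_of_dominated (bound := fun z => gaussKernel 1 z * ‖f‖) (fun r => ?_)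
    (fun r => Eventually.of_forall fun z => ?_)
    ((integrable_gaussKernel one_pos).mul_const _) (Eventually.of_forall fun z => ?_)
  · exact ((continuous_gaussKernel 1).smul
      ((continuous_translation f).comp (continuous_const_smul r))).aestronglyMeasurable
  · rw [norm_smul, norm_of_nonneg (gaussKernel_nonneg one_pos z)]
    exact mul_le_mul_of_nonneg_left (norm_translation_apply_le _ _)
      (gaussKernel_nonneg one_pos z)
  · have h : Continuous fun r : ℝ => translation (r • z) f :=
      (continuous_translation f).comp (by fun_prop : Continuous fun r : ℝ => r • z)
    exact h.const_smul (gaussKernel 1 z)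

variable {ε : ℝ}

lemma heat_param_pos (hε : ε ≠ 0) {t : ℝ} (ht : 0 < t) : 0 < 4 * ε ^ 2 * t := by positivity

/-- The operators of the heat semigroup. -/
def heatOp (hε : ε ≠ 0) (t : ℝ) : L1 →L[ℝ] L1 :=
  if ht : 0 < t then gaussConvolution (4 * ε ^ 2 * t) (heat_param_pos hε ht)
  else ContinuousLinearMap.id ℝ L1

lemma heatOp_of_pos (hε : ε ≠ 0) {t : ℝ} (ht : 0 < t) :
    heatOp hε t = gaussConvolution (4 * ε ^ 2 * t) (heat_param_pos hε ht) := dif_pos ht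

lemma heatOp_of_nonpos (hε : ε ≠ 0) {t : ℝ} (ht : t ≤ 0) :
    heatOp hε t = ContinuousLinearMap.id ℝ L1 := dif_neg (not_lt.2 ht)

lemma heatSemigroup_eq (hε : ε ≠ 0) (t : ℝ) (v : L1) : heatSemigroup ε t v = heatOp hε t v := by
  rcases lt_or_ge 0 t with ht | ht
  · rw [heatSemigroup, if_pos ht, heatOp_of_pos hε ht]
    conv_rhs => rw [← toL1_coe v]
    rw [gaussConvolution_toL1 _ (integrable_coe v), heatKernel_eq]
    simp only [mul_comm]
  · rw [heatSemigroup, if_neg (not_lt.2 ht), heatOp_of_nonpos hε ht]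
    rfl

lemma diffusionOp_eq (hε : ε ≠ 0) : diffusionOp ε = generator fun t v => heatOp hε t v := by
  rw [diffusionOp]
  congr 1
  funext t v
  exact heatSemigroup_eq hε t v

lemma heatOp_eq_integral (hε : ε ≠ 0) (t : ℝ) (f : L1) :
    heatOp hε t f = ∫ z, gaussKernel 1 z • translation (√(4 * ε ^ 2 * t) • z) f := by
  rcases lt_or_ge 0 t with ht | ht
  · rw [heatOp_of_pos hε ht, gaussConvolution_eq_integral_rescaled]
  -- The square root of a nonpositive number is 0, so the formula gives the identity for t ≤ 0.
  · have h : √(4 * ε ^ 2 * t) = 0 :=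
      sqrt_eq_zero_of_nonpos (mul_nonpos_of_nonneg_of_nonpos (by positivity) ht)
    simp only [h, zero_smul, translation_zero, heatOp_of_nonpos hε ht]
    rw [integral_smul_const, integral_gaussKernel one_pos, one_smul]
    rfl

lemma continuous_heatOp (hε : ε ≠ 0) (f : L1) : Continuous fun t => heatOp hε t f := by
  simp only [heatOp_eq_integral hε]
  exact (continuous_integral_rescaled f).comp
    (by fun_prop : Continuous fun t : ℝ => √(4 * ε ^ 2 * t))

lemma isC0Semigroup_heatOp (hε : ε ≠ 0) : IsC0Semigroup (heatOp hε) where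
  map_zero := heatOp_of_nonpos hε le_rfl
  map_add s t hs ht := by
    rcases hs.eq_or_lt with rfl | hs
    · rw [zero_add, heatOp_of_nonpos hε (le_refl (0 : ℝ))]
      rfl
    rcases ht.eq_or_lt with rfl | ht
    · rw [add_zero, heatOp_of_nonpos hε (le_refl (0 : ℝ))]
      rfl
    ext1 f
    rw [ContinuousLinearMap.comp_apply, heatOp_of_pos hε hs, heatOp_of_pos hε ht,
      gaussConvolution_gaussConvolution, heatOp_of_pos hε (add_pos hs ht)]
    congr 2
    ring
  continuousOn f := (continuous_heatOp hε f).continuousOn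

end Heat

/-! ### The heat equation for smooth data -/

section HeatEquation

open Real

variable {c : ℝ}

lemma integrable_mul_gaussKernel_sub (hc : 0 < c) {w : Plane → ℝ} (hw : Integrable w) (x : Plane) :
    Integrable fun z => w z * gaussKernel c (x - z) :=
  hw.mul_bdd (c := 1 / (π * c))
    ((continuous_gaussKernel c).comp
      (by fun_prop : Continuous fun z : Plane => x - z)).aestronglyMeasurable
    (Eventually.of_forall fun z => by
      rw [norm_of_nonneg (gaussKernel_nonneg hc _)]
      exact gaussKernel_le hc _)

lemma hasDerivAt_integral_gaussKernel (hc : 0 < c) {w : Plane → ℝ} (hw : Integrable w)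
    (x : Plane) :
    HasDerivAt (fun c => ∫ z, w z * gaussKernel c (x - z))
      (∫ z, w z * gaussKernelRate c (x - z)) c := by
  have hc2 : 0 < c / 2 := half_pos hc
  -- Keeping the parameter above c/2 makes the bound on the derivative uniform.
  have hball : ∀ c' ∈ Metric.ball c (c / 2), c / 2 < c' := fun c' h => by
    rw [Metric.mem_ball, Real.dist_eq, abs_lt] at h
    linarith [h.1]
  refine (hasDerivAt_integral_of_dominated_loc_of_deriv_le (s := Metric.ball c (c / 2))
    (bound := fun z => ‖w z‖ * (2 / (π * (c / 2) ^ 2)))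
    (F' := fun c z => w z * gaussKernelRate c (x - z))
    (Metric.ball_mem_nhds c hc2) ?_ (integrable_mul_gaussKernel_sub hc hw x) ?_ ?_ ?_ ?_).2
  · filter_upwards [lt_mem_nhds hc] with c' hc'
    exact (integrable_mul_gaussKernel_sub hc' hw x).1
  · exact hw.1.mul ((continuous_gaussKernelRate c).comp
      (by fun_prop : Continuous fun z : Plane => x - z)).aestronglyMeasurable
  · refine Eventually.of_forall fun z c' h => ?_
    have h1 := hball c' h
    have hc' : 0 < c' := hc2.trans h1
    have hπ := pi_pos
    rw [norm_mul]
    refine mul_le_mul_of_nonneg_left ((norm_gaussKernelRate_le hc' _).trans ?_) (norm_nonneg _)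
    gcongr
  · exact hw.norm.mul_const _
  · refine Eventually.of_forall fun z c' h => ?_
    exact (hasDerivAt_gaussKernel_param (hc2.trans (hball c' h)) _).const_mul _

lemma laplacian_eq_sum {v : Plane → ℝ} (hv : ContDiff ℝ 2 v) (x : Plane) :
    Laplacian.laplacian v x = ∑ i, fderiv ℝ (fun z => fderiv ℝ v z (EuclideanSpace.single i 1)) x
      (EuclideanSpace.single i 1) := by
  rw [InnerProductSpace.laplacian_eq_iteratedFDeriv_orthonormalBasis v
    (EuclideanSpace.basisFun (Fin 2) ℝ)]
  refine Finset.sum_congr rfl fun i _ => ?_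
  have h1 : DifferentiableAt ℝ (fderiv ℝ v) x :=
    (hv.fderiv_right (m := 1) (by norm_num)).differentiable one_ne_zero x
  rw [iteratedFDeriv_two_apply, fderiv_clm_apply h1 (differentiableAt_const _)]
  simp

lemma contDiff_fderiv_apply {v : Plane → ℝ} (hv : ContDiff ℝ 2 v) (e : Plane) :
    ContDiff ℝ 1 fun z => fderiv ℝ v z e :=
  (hv.fderiv_right (m := 1) (by norm_num)).clm_apply contDiff_const

lemma continuous_laplacian {v : Plane → ℝ} (hv : ContDiff ℝ 2 v) :
    Continuous (Laplacian.laplacian v) := by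
  rw [funext (laplacian_eq_sum hv)]
  exact continuous_finsetSum _ fun i _ =>
    ((contDiff_fderiv_apply hv _).continuous_fderiv one_ne_zero).clm_apply continuous_const

lemma hasCompactSupport_laplacian {v : Plane → ℝ} (hv : ContDiff ℝ 2 v)
    (hs : HasCompactSupport v) : HasCompactSupport (Laplacian.laplacian v) := by
  rw [funext (laplacian_eq_sum hv)]
  simp only [Fin.sum_univ_two]
  exact ((hs.fderiv_apply ℝ _).fderiv_apply ℝ _).add ((hs.fderiv_apply ℝ _).fderiv_apply ℝ _)

lemma fderiv_comp_const_sub {g : Plane → ℝ} (hg : Differentiable ℝ g) (x z e : Plane) :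
    fderiv ℝ (fun z => g (x - z)) z e = -fderiv ℝ g (x - z) e := by
  have h := (hg (x - z)).hasFDerivAt.comp z ((hasFDerivAt_id z).const_sub x)
  rw [show (fun z => g (x - z)) = g ∘ fun z => x - z from rfl]
  rw [HasFDerivAt.fderiv h]
  simp

/-- Integration by parts against a `C¹` function with compact support. -/
lemma integral_fderiv_mul_comp_sub {w g : Plane → ℝ} (hw : ContDiff ℝ 1 w)
    (hs : HasCompactSupport w) (hg : Differentiable ℝ g) (e : Plane)
    (hgc : Continuous fun z => fderiv ℝ g z e) (x : Plane) :
    ∫ z, fderiv ℝ w z e * g (x - z) = ∫ z, w z * fderiv ℝ g (x - z) e := by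
  have hsub : Continuous fun z : Plane => x - z := by fun_prop
  have hd := hg.comp (by fun_prop : Differentiable ℝ fun z : Plane => x - z)
  have hw' : Continuous fun z => fderiv ℝ w z e :=
    (hw.continuous_fderiv one_ne_zero).clm_apply continuous_const
  have h := integral_mul_fderiv_eq_neg_fderiv_mul_of_integrable (μ := (volume : Measure Plane))
    (f := fun z => g (x - z)) (g := w) (v := e) ?_ ?_ ?_ (fun z _ => hd z)
    (fun z _ => hw.differentiable one_ne_zero z)
  · simp only [fderiv_comp_const_sub hg, neg_mul, integral_neg, neg_neg] at h
    simpa only [mul_comm] using h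
  · simp only [fderiv_comp_const_sub hg]
    exact ((hgc.comp hsub).neg.mul hw.continuous).integrable_of_hasCompactSupport hs.mul_left
  · exact ((hg.continuous.comp hsub).mul hw').integrable_of_hasCompactSupport
      (hs.fderiv_apply ℝ e).mul_left
  · exact ((hg.continuous.comp hsub).mul hw.continuous).integrable_of_hasCompactSupport hs.mul_left

/-- Two integrations by parts carry the derivatives from `v` to the kernel, where the Laplacian
becomes a parameter derivative; the signs cancel because the kernel is evaluated at x - z. -/
lemma integral_laplacian_mul_gaussKernel (hc : 0 < c) {v : Plane → ℝ} (hv : ContDiff ℝ 2 v)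
    (hs : HasCompactSupport v) (x : Plane) :
    ∫ z, Laplacian.laplacian v z * gaussKernel c (x - z) =
      4 * ∫ z, v z * gaussKernelRate c (x - z) := by
  have hsub : Continuous fun z : Plane => x - z := by fun_prop
  have hk : Differentiable ℝ (gaussKernel c) :=
    (contDiff_gaussKernel c (n := 1)).differentiable one_ne_zero
  have hkd : ∀ i, Differentiable ℝ (gaussKernelDeriv c i) := fun i z =>
    (hasFDerivAt_gaussKernelDeriv c i z).differentiableAt
  have hkdc : ∀ i : Fin 2, Continuous fun z =>
      fderiv ℝ (gaussKernelDeriv c i) z (EuclideanSpace.single i 1) := by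
    intro i
    have h : ContDiff ℝ 1 (gaussKernelDeriv c i) := by
      unfold gaussKernelDeriv
      exact (contDiff_const.mul (EuclideanSpace.proj (𝕜 := ℝ) i).contDiff).mul
        (contDiff_gaussKernel c)
    exact (h.continuous_fderiv one_ne_zero).clm_apply continuous_const
  have key : ∀ i : Fin 2,
      ∫ z, fderiv ℝ (fun z => fderiv ℝ v z (EuclideanSpace.single i 1)) z
        (EuclideanSpace.single i 1) * gaussKernel c (x - z) =
      ∫ z, v z * fderiv ℝ (gaussKernelDeriv c i) (x - z) (EuclideanSpace.single i 1) := by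
    intro i
    rw [integral_fderiv_mul_comp_sub (contDiff_fderiv_apply hv _) (hs.fderiv_apply ℝ _) hk _
      (by simp only [fderiv_gaussKernel_single]; exact continuous_gaussKernelDeriv c i)]
    simp only [fderiv_gaussKernel_single]
    exact integral_fderiv_mul_comp_sub (hv.of_le (by norm_num)) hs (hkd i) _ (hkdc i) x
  have hint1 : ∀ i : Fin 2, Integrable fun z =>
      fderiv ℝ (fun z => fderiv ℝ v z (EuclideanSpace.single i 1)) z
        (EuclideanSpace.single i 1) * gaussKernel c (x - z) := fun i =>
    ((((contDiff_fderiv_apply hv _).continuous_fderiv one_ne_zero).clm_apply continuous_const).mul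
      ((continuous_gaussKernel c).comp hsub)).integrable_of_hasCompactSupport
      ((hs.fderiv_apply ℝ _).fderiv_apply ℝ _).mul_right
  have hint2 : ∀ i : Fin 2, Integrable fun z =>
      v z * fderiv ℝ (gaussKernelDeriv c i) (x - z) (EuclideanSpace.single i 1) := fun i =>
    (hv.continuous.mul ((hkdc i).comp hsub)).integrable_of_hasCompactSupport hs.mul_right
  simp only [laplacian_eq_sum hv, Finset.sum_mul]
  rw [integral_finsetSum _ fun i _ => hint1 i, Finset.sum_congr rfl fun i _ => key i,
    ← integral_finsetSum _ fun i _ => hint2 i, ← integral_const_mul]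
  refine integral_congr_ae (Eventually.of_forall fun z => ?_)
  simp only
  rw [← Finset.mul_sum, sum_fderiv_gaussKernelDeriv hc]
  ring

variable {ε : ℝ}

/-- The heat semigroup solves the heat equation for `C²` data with compact support. -/
lemma mem_diffusionOp_of_contDiff (hε : ε ≠ 0) {v : Plane → ℝ} (hv : ContDiff ℝ 2 v)
    (hs : HasCompactSupport v) :
    (toL1 v, toL1 fun x => ε ^ 2 * Laplacian.laplacian v x) ∈ diffusionOp ε := by
  have hvi : Integrable v := hv.continuous.integrable_of_hasCompactSupport hs
  have hLi : Integrable (Laplacian.laplacian v) :=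
    (continuous_laplacian hv).integrable_of_hasCompactSupport (hasCompactSupport_laplacian hv hs)
  set w : Plane → ℝ := fun x => ε ^ 2 * Laplacian.laplacian v x with hw
  have hwi : Integrable w := hLi.const_mul _
  set κ : ℝ → Plane → ℝ := fun r x => ∫ z, w z * gaussKernel (4 * ε ^ 2 * r) (x - z) with hκ
  have hop : ∀ {f : Plane → ℝ}, Integrable f → ∀ r, 0 < r → heatOp hε r (toL1 f) =
      toL1 fun x => ∫ z, f z * gaussKernel (4 * ε ^ 2 * r) (x - z) := fun hf r hr => by
    rw [heatOp_of_pos hε hr, gaussConvolution_toL1 _ hf]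
  have hcomp : ∀ {f : Plane → ℝ}, Integrable f → ∀ x r, 0 < r →
      HasDerivAt (fun r => ∫ z, f z * gaussKernel (4 * ε ^ 2 * r) (x - z))
        ((∫ z, f z * gaussKernelRate (4 * ε ^ 2 * r) (x - z)) * (4 * ε ^ 2)) r := by
    intro f hf x r hr
    have h1 : HasDerivAt (fun r : ℝ => 4 * ε ^ 2 * r) (4 * ε ^ 2) r := by
      simpa using (hasDerivAt_id r).const_mul (4 * ε ^ 2)
    exact (hasDerivAt_integral_gaussKernel (heat_param_pos hε hr) hf x).comp r h1
  have hder : ∀ x r, 0 < r →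
      HasDerivAt (fun r => ∫ z, v z * gaussKernel (4 * ε ^ 2 * r) (x - z)) (κ r x) r := by
    intro x r hr
    refine (hcomp hvi x r hr).congr_deriv ?_
    simp only [hκ, hw, mul_assoc (ε ^ 2)]
    rw [integral_const_mul, integral_laplacian_mul_gaussKernel (heat_param_pos hε hr) hv hs]
    ring
  have hκc : ∀ x, ContinuousOn (fun r => κ r x) (Ioi 0) := fun x r hr =>
    (hcomp hwi x r hr).continuousAt.continuousWithinAt
  have hκi : ∀ r, 0 < r → Integrable (κ r) := fun r hr =>
    (integrable_convolution_kernel hwi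
      (integrable_gaussKernel (heat_param_pos hε hr))).integral_prod_right
  have hκm : StronglyMeasurable (Function.uncurry κ) := by
    have hwm : StronglyMeasurable w := ((continuous_laplacian hv).const_mul _).stronglyMeasurable
    have hm : Measurable fun q : (ℝ × Plane) × Plane =>
        w q.2 * gaussKernel (4 * ε ^ 2 * q.1.1) (q.1.2 - q.2) := by
      unfold gaussKernel
      refine (hwm.measurable.comp measurable_snd).mul ?_
      fun_prop
    exact hm.stronglyMeasurable.integral_prod_right'
  -- The kernel is singular at time 0, so the fundamental theorem is applied pointwise on [s, t]
  -- with s > 0 and lifted to L¹; strong continuity then allows s ↘ 0.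
  have hstep : ∀ s t, 0 < s → s ≤ t → heatOp hε t (toL1 v) - heatOp hε s (toL1 v) =
      ∫ r in s..t, heatOp hε r (toL1 w) := by
    intro s t hs0 hst
    have ht0 : 0 < t := hs0.trans_le hst
    have hΨ : Integrable (fun r => heatOp hε r (toL1 w)) (volume.restrict (Ioc s t)) :=
      ((continuous_heatOp hε (toL1 w)).integrableOn_Icc).mono_set Ioc_subset_Icc_self
    have hpos : ∀ᵐ r ∂(volume.restrict (Ioc s t)), 0 < r := by
      filter_upwards [ae_restrict_mem measurableSet_Ioc] with r hr using hs0.trans hr.1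
    have hprod : Integrable (Function.uncurry κ) ((volume.restrict (Ioc s t)).prod volume) := by
      refine (integrable_prod_iff hκm.aestronglyMeasurable).2 ⟨hpos.mono hκi, hΨ.norm.congr ?_⟩
      filter_upwards [hpos] with r hr
      rw [hop hwi r hr]
      exact norm_toL1 (hκi r hr)
    rw [intervalIntegral.integral_of_le hst, integral_eq_toL1 hprod hΨ, hop hvi t ht0,
      hop hvi s hs0, ← toL1_sub]
    · refine congrArg toL1 (funext fun x => ?_)
      rw [← intervalIntegral.integral_of_le hst,
        intervalIntegral.integral_eq_sub_of_hasDerivAt (f := fun r =>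
          ∫ z, v z * gaussKernel (4 * ε ^ 2 * r) (x - z))]
      · intro r hr
        rw [uIcc_of_le hst] at hr
        exact hder x r (hs0.trans_le hr.1)
      · refine ContinuousOn.intervalIntegrable ((hκc x).mono ?_)
        rw [uIcc_of_le hst]
        exact fun r hr => hs0.trans_le hr.1
    · exact (integrable_convolution_kernel hvi
        (integrable_gaussKernel (heat_param_pos hε ht0))).integral_prod_right
    · exact (integrable_convolution_kernel hvi
        (integrable_gaussKernel (heat_param_pos hε hs0))).integral_prod_right
    · filter_upwards [hpos] with r hr
      rw [hop hwi r hr]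
      exact coeFn_toL1 (hκi r hr)
  rw [diffusionOp_eq hε]
  refine mem_generator_of_sub_eq_integral (T := fun t v => heatOp hε t v)
    (continuous_heatOp hε _).continuousOn ((isC0Semigroup_heatOp hε).zero_apply _) one_pos
    fun t ht => ?_
  have hlim1 : Tendsto (fun s => heatOp hε t (toL1 v) - heatOp hε s (toL1 v)) (𝓝[>] 0)
      (𝓝 (heatOp hε t (toL1 v) - toL1 v)) := by
    have h := ((continuous_heatOp hε (toL1 v)).tendsto 0).mono_left
      (nhdsWithin_le_nhds (s := Ioi 0))
    rw [(isC0Semigroup_heatOp hε).zero_apply] at h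
    exact h.const_sub _
  have hlim2 : Tendsto (fun s => ∫ r in s..t, heatOp hε r (toL1 w)) (𝓝[>] 0)
      (𝓝 (∫ r in (0 : ℝ)..t, heatOp hε r (toL1 w))) := by
    have h : Tendsto (fun s => -∫ r in t..s, heatOp hε r (toL1 w)) (𝓝[>] 0)
        (𝓝 (-∫ r in t..0, heatOp hε r (toL1 w))) :=
      ((intervalIntegral.continuous_primitive (μ := volume)
      (fun a b => (continuous_heatOp hε (toL1 w)).intervalIntegrable a b) t).neg.tendsto
        0).mono_left (nhdsWithin_le_nhds (s := Ioi 0))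
    simpa only [← intervalIntegral.integral_symm] using h
  refine tendsto_nhds_unique (hlim1.congr' ?_) hlim2
  filter_upwards [Ioc_mem_nhdsGT ht.1] with s hs' using hstep s t hs'.1 hs'.2

end HeatEquation

end

end ReturnHome

namespace ReturnHome

noncomputable section

/-! ### Diffusion with convection -/

section Travel

variable {F : Plane → Plane}

lemma continuous_divergence_smul (hF : Admissible F) {φ : Plane → ℝ} (hφ : ContDiff ℝ 1 φ) :
    Continuous (divergence fun x => φ x • F x) := by
  have h : (divergence fun x => φ x • F x) =
      fun x => φ x * divergence F x + fderiv ℝ φ x (F x) := funext fun x =>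
    divergence_smul (hφ.differentiable one_ne_zero x)
      (hF.contDiff.differentiable one_ne_zero x)
  rw [h]
  exact (hφ.continuous.mul hF.continuous_divergence).add
    ((hφ.continuous_fderiv one_ne_zero).clm_apply hF.contDiff.continuous)

lemma hasCompactSupport_divergence_smul (hF : Admissible F) {φ : Plane → ℝ} (hφ : ContDiff ℝ 1 φ)
    (hs : HasCompactSupport φ) : HasCompactSupport (divergence fun x => φ x • F x) := by
  have h : (divergence fun x => φ x • F x) =
      fun x => φ x * divergence F x + fderiv ℝ φ x (F x) := funext fun x =>
    divergence_smul (hφ.differentiable one_ne_zero x)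
      (hF.contDiff.differentiable one_ne_zero x)
  rw [h]
  refine HasCompactSupport.add hs.mul_right ?_
  exact (hs.fderiv ℝ).mono fun x hx => by
    contrapose! hx
    simp only [Function.mem_support, not_not] at hx ⊢
    rw [hx]
    rfl

/-- Convolution with a Gaussian kernel maps into the domain of the convection operator. -/
lemma exists_convection_gaussConvolution (hF : Admissible F) :
    ∃ D : ℝ, ∀ c (hc : 0 < c), ∃ Q : L1 →L[ℝ] L1, ‖Q‖ ≤ D + D / √c ∧
      ∀ f, (gaussConvolution c hc f, Q f) ∈ transportGraph hF := by
  obtain ⟨D, hD⟩ := hF.exists_divergence_le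
  obtain ⟨M, hM⟩ := hF.bounded
  have hM' : ∀ i x, ‖F x i‖ ≤ M := fun i x => (PiLp.norm_apply_le _ i).trans (hM x)
  have hD0 : 0 ≤ D := (norm_nonneg _).trans (hD 0)
  have hM0 : 0 ≤ M := (norm_nonneg _).trans (hM 0)
  have hFi : ∀ i : Fin 2, Measurable fun x => F x i := fun i =>
    ((EuclideanSpace.proj (𝕜 := ℝ) i).continuous.comp hF.contDiff.continuous).measurable
  have hwD := isWeight_mul hF.continuous_divergence.measurable hD
  have hwM : ∀ i, IsWeight M 1 (fun x => F x i) id := fun i => isWeight_mul (hFi i) (hM' i)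
  -- Two coordinates, each contributing M · 4/√c, give 8M/√c.
  refine ⟨max D (8 * M), fun c hc => ?_⟩
  have hki := integrable_gaussKernel hc
  have hkdi := fun i => integrable_gaussKernelDeriv hc i
  -- By the product rule this is -∇·(kF), with k the kernel translated by z.
  set Ψ : Plane → L1 := fun z => -(hwD.op (translation z (toL1 (gaussKernel c))) +
    ∑ i, (hwM i).op (translation z (toL1 (gaussKernelDeriv c i)))) with hΨ
  have hΨc : Continuous Ψ := by
    refine (Continuous.add (hwD.op.continuous.comp (continuous_translation _))
      (continuous_finsetSum _ fun i _ => ?_)).neg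
    exact (hwM i).op.continuous.comp (continuous_translation _)
  have hΨb : ∀ z, ‖Ψ z‖ ≤ max D (8 * M) + max D (8 * M) / √c := by
    intro z
    have h1 : ‖hwD.op (translation z (toL1 (gaussKernel c)))‖ ≤ D := by
      have h := hwD.op.le_of_opNorm_le hwD.norm_op_le (translation z (toL1 (gaussKernel c)))
      rw [NNReal.coe_one, mul_one] at h
      exact h.trans (mul_le_of_le_one_right hD0 (norm_translation_toL1_gaussKernel_le hc z))
    have h2 : ∀ i, ‖(hwM i).op (translation z (toL1 (gaussKernelDeriv c i)))‖ ≤ M * (4 / √c) := by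
      intro i
      have h := (hwM i).op.le_of_opNorm_le (hwM i).norm_op_le
        (translation z (toL1 (gaussKernelDeriv c i)))
      rw [NNReal.coe_one, mul_one] at h
      exact h.trans (mul_le_mul_of_nonneg_left
        ((norm_translation_apply_le _ _).trans (norm_toL1_gaussKernelDeriv_le hc i)) hM0)
    have h3 : ‖∑ i, (hwM i).op (translation z (toL1 (gaussKernelDeriv c i)))‖ ≤
        8 * M / √c := by
      refine (norm_sum_le_of_le _ fun i _ => h2 i).trans (le_of_eq ?_)
      simp
      ring
    rw [hΨ, norm_neg]
    refine (norm_add_le _ _).trans (add_le_add (h1.trans (le_max_left _ _)) (h3.trans ?_))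
    gcongr
    exact le_max_right _ _
  refine ⟨superposition Ψ hΨc _ hΨb, norm_superposition_le hΨc hΨb, fun f => ?_⟩
  have hmem : ∀ z, (translation z (toL1 (gaussKernel c)), Ψ z) ∈ transportGraph hF := by
    intro z
    set φ : Plane → ℝ := fun x => gaussKernel c (x - z) with hφ
    have hφc : ContDiff ℝ 1 φ := (contDiff_gaussKernel c).comp (contDiff_id.sub contDiff_const)
    have hφi : Integrable φ := hki.comp_sub_right z
    have hφd : ∀ i x, fderiv ℝ φ x (EuclideanSpace.single i 1) = gaussKernelDeriv c i (x - z) := by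
      intro i x
      rw [hφ, fderiv_comp_sub, fderiv_gaussKernel_single]
    have hdiv : ∀ x, -divergence (fun x' => φ x' • F x') x =
        -(divergence F x * gaussKernel c (x - z) +
          ∑ i, F x i * gaussKernelDeriv c i (x - z)) := by
      intro x
      rw [divergence_smul (hφc.differentiable one_ne_zero x)
        (hF.contDiff.differentiable one_ne_zero x), fderiv_apply_eq_sum, mul_comm]
      simp only [hφd, smul_eq_mul]
      rfl
    have hi1 : Integrable fun x => divergence F x * gaussKernel c (x - z) :=
      hwD.integrable (hki.comp_sub_right z)
    have hi2 : ∀ i : Fin 2, Integrable fun x => F x i * gaussKernelDeriv c i (x - z) := fun i =>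
      (hwM i).integrable ((hkdi i).comp_sub_right z)
    have hi3 : Integrable fun x => ∑ i, F x i * gaussKernelDeriv c i (x - z) :=
      integrable_finsetSum _ fun i _ => hi2 i
    have hψ : Ψ z = toL1 fun x => -divergence (fun x' => φ x' • F x') x := by
      have hi4 : Integrable fun x => divergence F x * gaussKernel c (x - z) +
          ∑ i, F x i * gaussKernelDeriv c i (x - z) := hi1.add hi3
      rw [funext hdiv, toL1_neg hi4, toL1_add hi1 hi3]
      simp only [Fin.sum_univ_two]
      rw [toL1_add (hi2 0) (hi2 1), hΨ]
      simp only [Fin.sum_univ_two, translation_toL1 z hki, translation_toL1 z (hkdi _),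
        hwD.op_toL1 (hki.comp_sub_right z), (hwM _).op_toL1 ((hkdi _).comp_sub_right z)]
      rfl
    rw [translation_toL1 z hki, hψ]
    refine mem_transportGraph_of_contDiff hF hφc hφi ?_
    rw [funext hdiv]
    exact (hi1.add hi3).neg
  -- The convolution is an average of translated kernels, and the closed graph is stable under
  -- averaging.
  refine integral_prodMk_mem_of_isClosed (isClosed_transportGraph hF)
    (integrable_smul_bounded (continuous_translation _)
      (norm_translation_toL1_gaussKernel_le hc) (integrable_coe f))
    (integrable_smul_bounded hΨc hΨb (integrable_coe f)) (Eventually.of_forall fun z => ?_)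
  exact (transportGraph hF).smul_mem _ (hmem z)

lemma integrableOn_const_add_div_sqrt (D a : ℝ) (ha : 0 < a) (τ : ℝ) :
    IntegrableOn (fun s : ℝ => D + D / √(a * s)) (Ioc 0 τ) := by
  refine Integrable.add (integrableOn_const (by simp)) ?_
  have h := (intervalIntegral.intervalIntegrable_rpow' (a := 0) (b := τ)
    (r := -(1 / 2)) (by norm_num)).1.const_mul (D / √a)
  refine IntegrableOn.congr_fun h (fun s hs => ?_) measurableSet_Ioc
  rw [Real.sqrt_mul ha.le, Real.rpow_neg hs.1.le, ← Real.sqrt_eq_rpow]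
  field_simp

variable {ε : ℝ}

/-- The perturbation theorem, applied to diffusion and convection. -/
lemma exists_travel_semigroup (hε : ε ≠ 0) (hF : Admissible F) :
    dom (diffusionOp ε) ⊆ dom (convectionOp F) ∧
      ∃ S : ℝ → L1 →L[ℝ] L1, Generates (travelOp ε F) S := by
  obtain ⟨D, hD⟩ := exists_convection_gaussConvolution hF
  choose Q hQn hQ using hD
  have ha : 0 < 4 * ε ^ 2 := by positivity
  set P : ℝ → L1 →L[ℝ] L1 := fun s => if hs : 0 < s then Q _ (heat_param_pos hε hs) else 0 with hP
  have hPs : ∀ {s} (hs : 0 < s), P s = Q _ (heat_param_pos hε hs) := fun hs => dif_pos hs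
  have hT := isC0Semigroup_heatOp hε
  have hc := isClosed_transportGraph hF
  have h0 := eq_zero_of_mem_transportGraph hF
  have hPR : ∀ s, 0 < s → ∀ f, (heatOp hε s f, P s f) ∈ transportGraph hF := by
    intro s hs f
    rw [heatOp_of_pos hε hs, hPs hs]
    exact hQ _ _ f
  have hPn : ∀ s, 0 < s → ‖P s‖ ≤ D + D / √(4 * ε ^ 2 * s) := by
    intro s hs
    rw [hPs hs]
    exact hQn _ _
  have hk : ∀ τ, IntegrableOn (fun s : ℝ => D + D / √(4 * ε ^ 2 * s)) (Ioc 0 τ) :=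
    integrableOn_const_add_div_sqrt D _ ha
  have hdom : ∀ {v a}, (v, a) ∈ diffusionOp ε → ∃ b, (v, b) ∈ transportGraph hF := by
    intro v a h
    rw [diffusionOp_eq hε] at h
    obtain ⟨b, hb, -⟩ := exists_mem_and_tendsto hT hc h0 hPR
      (isIntegrableFamily_of_mem hT h0 hPR hPn hk) h
    exact ⟨b, hb⟩
  refine ⟨?_, ?_⟩
  · rintro v ⟨a, h⟩
    obtain ⟨b, hb⟩ := hdom h
    exact ⟨b, transportGraph_subset_convectionOp hF hb⟩
  · obtain ⟨S, hS, -⟩ := exists_perturbed_semigroup hT hc h0 hPR hPn hk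
    -- On D(A) the closed graph and `convectionOp F` have the same values, since the former is
    -- defined there and the latter is single-valued.
    have hG : opAdd (generator fun t v => heatOp hε t v) (transportGraph hF : Set (L1 × L1)) =
        travelOp ε F := by
      rw [← diffusionOp_eq hε, travelOp]
      ext ⟨v, f⟩
      constructor
      · rintro ⟨a, b, h1, h2, h3⟩
        exact ⟨a, b, h1, transportGraph_subset_convectionOp hF h2, h3⟩
      · rintro ⟨a, b, h1, h2, h3⟩
        obtain ⟨b', hb'⟩ := hdom h1
        obtain rfl := convectionOp_unique h2 (transportGraph_subset_convectionOp hF hb')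
        exact ⟨a, b, h1, hb', h3⟩
    rw [hG] at hS
    exact ⟨S, hS⟩

/-- On `C²` functions with compact support, `A + B` is `v ↦ ε² Δ v - ∇ · (v F)`. -/
lemma mem_travelOp_of_contDiff (hε : ε ≠ 0) (hF : Admissible F) {v : Plane → ℝ}
    (hv : ContDiff ℝ 2 v) (hs : HasCompactSupport v) :
    (toL1 v, toL1 fun x => ε ^ 2 * Laplacian.laplacian v x -
      divergence (fun x' => v x' • F x') x) ∈ travelOp ε F := by
  have hv1 : ContDiff ℝ 1 v := hv.of_le (by norm_num)
  have hd : Integrable (divergence fun x => v x • F x) :=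
    (continuous_divergence_smul hF hv1).integrable_of_hasCompactSupport
      (hasCompactSupport_divergence_smul hF hv1 hs)
  have hL : Integrable (Laplacian.laplacian v) :=
    (continuous_laplacian hv).integrable_of_hasCompactSupport (hasCompactSupport_laplacian hv hs)
  refine ⟨_, _, mem_diffusionOp_of_contDiff hε hv hs,
    transportGraph_subset_convectionOp hF (mem_transportGraph_of_contDiff hF hv1
      (hv.continuous.integrable_of_hasCompactSupport hs) hd.neg), ?_⟩
  simp only
  rw [toL1_neg hd, toL1_sub (hL.const_mul _) hd, sub_eq_add_neg]

end Travel

end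

end ReturnHome

namespace ReturnHome

noncomputable section

/-! ### Rescaled and product semigroups -/

section Products

variable {X Y : Type*} [NormedAddCommGroup X] [NormedSpace ℝ X] [NormedAddCommGroup Y]
  [NormedSpace ℝ Y]

lemma IsC0Semigroup.mem_generator_exp_smul {T : ℝ → X →L[ℝ] X} (hT : IsC0Semigroup T) (c : ℝ)
    {x a : X} : (x, a) ∈ generator (fun t x => (Real.exp (c * t) • T t) x) ↔
      (x, a - c • x) ∈ generator fun t x => T t x := by
  constructor
  · intro h
    have h1 := (hT.exp_smul c).generator_exp_smul_of_mem (-c) h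
    have h2 : (fun (t : ℝ) (x : X) => (Real.exp (-c * t) • Real.exp (c * t) • T t) x) =
        fun t x => T t x := by
      funext t x
      rw [smul_smul, ← Real.exp_add]
      simp
    rwa [h2, neg_smul, ← sub_eq_add_neg] at h1
  · intro h
    have h1 := hT.generator_exp_smul_of_mem c h
    rwa [sub_add_cancel] at h1

lemma isC0Semigroup_id : IsC0Semigroup fun _ : ℝ => ContinuousLinearMap.id ℝ X where
  map_zero := rfl
  map_add _ _ _ _ := rfl
  continuousOn _ := continuousOn_const

lemma mem_generator_id {x a : X} :
    (x, a) ∈ generator (fun (_ : ℝ) x => ContinuousLinearMap.id ℝ X x) ↔ a = 0 := by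
  have h : (x, (0 : X)) ∈ generator fun (_ : ℝ) x => ContinuousLinearMap.id ℝ X x := by
    simp [generator]
  refine ⟨fun h' => generator_unique h' h, ?_⟩
  rintro rfl
  exact h

/-- Scalar multiplication by `exp (c t)`. -/
lemma generates_exp_smul_id (c : ℝ) :
    Generates (graphOf fun x : X => c • x)
      fun t => Real.exp (c * t) • ContinuousLinearMap.id ℝ X := by
  refine ⟨isC0Semigroup_id.exp_smul c, ?_⟩
  ext ⟨x, a⟩
  rw [isC0Semigroup_id.mem_generator_exp_smul, mem_generator_id, sub_eq_zero]
  rfl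

lemma IsC0Semigroup.prodMap {T : ℝ → X →L[ℝ] X} {S : ℝ → Y →L[ℝ] Y} (hT : IsC0Semigroup T)
    (hS : IsC0Semigroup S) : IsC0Semigroup fun t => (T t).prodMap (S t) where
  map_zero := by
    rw [hT.map_zero, hS.map_zero]
    rfl
  map_add s t hs ht := by
    rw [hT.map_add s t hs ht, hS.map_add s t hs ht]
    rfl
  continuousOn x := (hT.continuousOn x.1).prodMk (hS.continuousOn x.2)

lemma mem_generator_prodMap {T : ℝ → X →L[ℝ] X} {S : ℝ → Y →L[ℝ] Y} {p q : X × Y} :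
    (p, q) ∈ generator (fun t x => (T t).prodMap (S t) x) ↔
      (p.1, q.1) ∈ generator (fun t x => T t x) ∧ (p.2, q.2) ∈ generator fun t x => S t x := by
  simp only [generator, mem_ofPred_eq]
  rw [Prod.tendsto_iff]
  rfl

end Products

/-! ### The three-compartment model -/

section Model

variable {ε σ α γ χ : ℝ} {F : Plane → Plane} {y : Plane} {S : ℝ → L1 →L[ℝ] L1}

/-- The semigroup `(exp (-γ t), exp (-α t) S(t), exp (-χ t))` of the decoupled compartments. -/
def diagonalSemigroup (α γ χ : ℝ) (S : ℝ → L1 →L[ℝ] L1) (t : ℝ) : State →L[ℝ] State :=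
  (Real.exp (-γ * t) • ContinuousLinearMap.id ℝ ℝ).prodMap
    ((Real.exp (-α * t) • S t).prodMap (Real.exp (-χ * t) • ContinuousLinearMap.id ℝ L1))

lemma diagonalSemigroup_apply (t : ℝ) (p : State) : diagonalSemigroup α γ χ S t p =
    (Real.exp (-γ * t) * p.1, Real.exp (-α * t) • S t p.2.1, Real.exp (-χ * t) • p.2.2) := rfl

/-- The operator `(u, v, w) ↦ (-γ u, (A + B) v - α v, -χ w)`. -/
def diagonalOp (ε α γ χ : ℝ) (F : Plane → Plane) : Set (State × State) :=
  {p | ∃ f : L1, (p.1.2.1, f) ∈ travelOp ε F ∧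
    p.2 = (-γ * p.1.1, f - α • p.1.2.1, -(χ • p.1.2.2))}

lemma generates_diagonalOp (hS : Generates (travelOp ε F) S) :
    Generates (diagonalOp ε α γ χ F) (diagonalSemigroup α γ χ S) := by
  have h1 := generates_exp_smul_id (X := ℝ) (-γ)
  have h2 := hS.1.exp_smul (-α)
  have h3 := generates_exp_smul_id (X := L1) (-χ)
  refine ⟨h1.1.prodMap (h2.prodMap h3.1), ?_⟩
  ext ⟨⟨u, v, w⟩, ⟨a, b, c⟩⟩
  refine mem_generator_prodMap.trans ?_
  rw [h1.2]
  refine (and_congr_right fun _ => mem_generator_prodMap).trans ?_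
  rw [h3.2, hS.1.mem_generator_exp_smul, hS.2]
  simp only [graphOf, diagonalOp, mem_ofPred_eq, Prod.mk.injEq, smul_eq_mul, neg_smul, sub_neg_eq_add]
  constructor
  · rintro ⟨ha, hb, hc⟩
    exact ⟨_, hb, ha, by abel, hc⟩
  · rintro ⟨f, hf, ha, hb, hc⟩
    refine ⟨ha, ?_, hc⟩
    rw [hb, sub_add_cancel]
    exact hf

/-- The transition `(u, v, w) ↦ (0, 0, α v)`. -/
def transitionL (α : ℝ) : State →L[ℝ] State :=
  (0 : State →L[ℝ] ℝ).prod ((0 : State →L[ℝ] L1).prod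
    (α • (ContinuousLinearMap.fst ℝ L1 L1).comp (ContinuousLinearMap.snd ℝ ℝ (L1 × L1))))

lemma transitionL_apply (p : State) : transitionL α p = (0, 0, α • p.2.1) := rfl

/-- The coupling operator, as a bounded linear operator. -/
def couplingL (σ γ χ : ℝ) (y : Plane) : State →L[ℝ] State :=
  (χ • ((setIntegralL univ).comp
    ((ContinuousLinearMap.snd ℝ L1 L1).comp (ContinuousLinearMap.snd ℝ ℝ (L1 × L1))))).prod
    (((γ • ContinuousLinearMap.fst ℝ ℝ (L1 × L1)).smulRight
      (toL1 fun x => gaussian σ (x - y))).prod 0)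

lemma coe_couplingL : (couplingL σ γ χ y : State → State) = couplingOp σ γ χ y := by
  funext p
  simp [couplingL, couplingOp, setIntegralL_apply]

lemma opAdd_diagonalOp : opAdd (diagonalOp ε α γ χ F) (graphOf (transitionL α)) =
    uncoupledOp ε α γ χ F := by
  ext ⟨p, q⟩
  constructor
  · rintro ⟨a, b, ⟨f, hf, ha⟩, hb, hq⟩
    refine ⟨f, hf, ?_⟩
    simp only [graphOf, mem_ofPred_eq] at ha hb hq
    rw [hq, ha, hb, transitionL_apply]
    simp only [Prod.mk_add_mk, add_zero]
    rw [neg_add_eq_sub]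
  · rintro ⟨f, hf, hq⟩
    refine ⟨(-γ * p.1, f - α • p.2.1, -(χ • p.2.2)), transitionL α p, ⟨f, hf, rfl⟩, rfl, ?_⟩
    simp only at hq
    rw [hq, transitionL_apply]
    simp only [Prod.mk_add_mk, add_zero]
    rw [neg_add_eq_sub]

lemma opAdd_diagonalOp_add : opAdd (diagonalOp ε α γ χ F)
    (graphOf (transitionL α + couplingL σ γ χ y)) = fullOp ε σ α γ χ F y := by
  rw [fullOp, ← opAdd_diagonalOp, ← coe_couplingL]
  ext ⟨p, q⟩
  constructor
  · rintro ⟨a, b, ha, hb, hq⟩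
    refine ⟨a + transitionL α p, couplingL σ γ χ y p, ⟨a, transitionL α p, ha, rfl, rfl⟩, rfl, ?_⟩
    rw [hq, add_assoc]
    exact congrArg (a + ·) hb
  · rintro ⟨a, b, ⟨c, d, hc, hd, ha⟩, hb, hq⟩
    refine ⟨c, d + b, hc, ?_, ?_⟩
    · simp only [graphOf, mem_ofPred_eq] at hd hb ⊢
      rw [hd, hb]
      rfl
    · simp only at ha hq ⊢
      rw [hq, ha, add_assoc]

/-- The explicit semigroup generated by the uncoupled operator. -/
lemma exists_uncoupled_semigroup (hS : Generates (travelOp ε F) S) :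
    ∃ TA : ℝ → State →L[ℝ] State, Generates (uncoupledOp ε α γ χ F) TA ∧
      ∀ t : ℝ, 0 ≤ t → ∀ x₀ : State, TA t x₀ =
        (Real.exp (-γ * t) * x₀.1, Real.exp (-α * t) • S t x₀.2.1,
          Real.exp (-χ * t) • x₀.2.2 + ∫ s in (0 : ℝ)..t,
            (Real.exp (-χ * (t - s)) * α) • (Real.exp (-α * s) • S s x₀.2.1)) := by
  have hD := generates_diagonalOp (α := α) (γ := γ) (χ := χ) hS
  obtain ⟨TA, hTA, h⟩ := exists_bounded_perturbation hD (transitionL α)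
  rw [opAdd_diagonalOp] at hTA
  refine ⟨TA, hTA, fun t ht x₀ => ?_⟩
  -- The transition annihilates states without travelers, so on these the perturbed and the diagonal
  -- semigroups agree. As the transition maps into such states, the Volterra integral becomes
  -- explicit.
  have hw : ∀ r, 0 ≤ r → ∀ w : L1, TA r ((0 : ℝ), (0 : L1), w) =
      ((0 : ℝ), (0 : L1), Real.exp (-χ * r) • w) := by
    intro r hr w
    rw [h r hr]
    have h0 : ∀ s, TA (r - s) ((0 : ℝ), (0 : L1), (0 : L1)) = 0 := fun s => map_zero _
    simp [diagonalSemigroup_apply, transitionL_apply, h0]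
  have hSc : ContinuousOn (fun s => S s x₀.2.1) (Ici 0) := hS.1.continuousOn _
  have hint : IntervalIntegrable (fun s =>
      (Real.exp (-χ * (t - s)) * α) • (Real.exp (-α * s) • S s x₀.2.1)) volume 0 t := by
    refine intervalIntegrable_of_continuousOn_Ici ?_ le_rfl ht
    exact (by fun_prop : Continuous fun s => Real.exp (-χ * (t - s)) * α).continuousOn.smul
      ((by fun_prop : Continuous fun s => Real.exp (-α * s)).continuousOn.smul hSc)
  have hI : ∫ s in (0 : ℝ)..t, TA (t - s) (transitionL α (diagonalSemigroup α γ χ S s x₀)) =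
      ((0 : ℝ), (0 : L1), ∫ s in (0 : ℝ)..t,
        (Real.exp (-χ * (t - s)) * α) • (Real.exp (-α * s) • S s x₀.2.1)) := by
    have h1 := ((ContinuousLinearMap.inr ℝ ℝ (L1 × L1)).comp
      (ContinuousLinearMap.inr ℝ L1 L1)).intervalIntegral_comp_comm hint
    refine Eq.trans (intervalIntegral.integral_congr fun s hs => ?_) h1
    rw [uIcc_of_le ht] at hs
    simp only [transitionL_apply, diagonalSemigroup_apply, hw _ (sub_nonneg.2 hs.2), mul_smul]
    rfl
  rw [h t ht, hI, diagonalSemigroup_apply]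
  simp

/-- The third formula has v(s) under the integral, so the three together are the formula for the
diagonal semigroup perturbed by transition plus coupling, read componentwise. -/
lemma componentFormulas_iff (x₀ : State) {z : ℝ → State}
    (hD : IsC0Semigroup (diagonalSemigroup α γ χ S)) (hz : ContinuousOn z (Ici 0)) :
    ComponentFormulas σ α γ χ y S x₀ z ↔
      ∀ t, 0 ≤ t → z t = diagonalSemigroup α γ χ S t x₀ + ∫ s in (0 : ℝ)..t,
        diagonalSemigroup α γ χ S (t - s) ((transitionL α + couplingL σ γ χ y) (z s)) := by
  refine forall₂_congr fun t ht => ?_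
  have hint := hD.intervalIntegrable_convolution
    ((transitionL α + couplingL σ γ χ y).continuous.comp_continuousOn hz) ht
  simp only [Function.comp_apply] at hint
  have happ : ∀ s, diagonalSemigroup α γ χ S (t - s) ((transitionL α + couplingL σ γ χ y) (z s)) =
      (Real.exp (-γ * (t - s)) * (χ * ∫ x, (z s).2.2 x),
        Real.exp (-α * (t - s)) •
          S (t - s) ((γ * (z s).1) • toL1 (fun x => gaussian σ (x - y))),
        (Real.exp (-χ * (t - s)) * α) • (z s).2.1) := by
    intro s
    rw [add_apply, coe_couplingL, transitionL_apply, couplingOp, diagonalSemigroup_apply]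
    simp only [Prod.mk_add_mk, zero_add, add_zero, smul_smul]
  have h1 := (ContinuousLinearMap.fst ℝ ℝ (L1 × L1)).intervalIntegral_comp_comm hint
  have h2 := ((ContinuousLinearMap.fst ℝ L1 L1).comp
    (ContinuousLinearMap.snd ℝ ℝ (L1 × L1))).intervalIntegral_comp_comm hint
  have h3 := ((ContinuousLinearMap.snd ℝ L1 L1).comp
    (ContinuousLinearMap.snd ℝ ℝ (L1 × L1))).intervalIntegral_comp_comm hint
  simp only [happ, ContinuousLinearMap.comp_apply, ContinuousLinearMap.coe_fst',
    ContinuousLinearMap.coe_snd'] at h1 h2 h3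
  simp only [happ]
  rw [h1, h2, h3, Prod.ext_iff, Prod.ext_iff]
  rfl

lemma mem_fullOp_of_contDiff (hε : ε ≠ 0) (hσ : 0 < σ) (hF : Admissible F) (u : ℝ)
    {v : Plane → ℝ} (w : L1) (hv : ContDiff ℝ 2 v) (hs : HasCompactSupport v) :
    ((u, toL1 v, w), systemRHS ε σ α γ χ F y u v w) ∈ fullOp ε σ α γ χ F y := by
  refine ⟨(-γ * u, toL1 (fun x => ε ^ 2 * Laplacian.laplacian v x -
      divergence (fun x' => v x' • F x') x) - α • toL1 v, α • toL1 v - χ • w),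
    couplingOp σ γ χ y (u, toL1 v, w),
    ⟨_, mem_travelOp_of_contDiff hε hF hv hs, rfl⟩, rfl, ?_⟩
  have hv1 : ContDiff ℝ 1 v := hv.of_le (by norm_num)
  have hvi : Integrable v := hv.continuous.integrable_of_hasCompactSupport hs
  have hd : Integrable (divergence fun x => v x • F x) :=
    (continuous_divergence_smul hF hv1).integrable_of_hasCompactSupport
      (hasCompactSupport_divergence_smul hF hv1 hs)
  have hL : Integrable (Laplacian.laplacian v) :=
    (continuous_laplacian hv).integrable_of_hasCompactSupport (hasCompactSupport_laplacian hv hs)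
  have hg : Integrable fun x => gaussian σ (x - y) := by
    rw [gaussian_eq]
    exact (integrable_gaussKernel (by positivity)).comp_sub_right y
  have h1 : Integrable fun x => ε ^ 2 * Laplacian.laplacian v x -
      divergence (fun x' => v x' • F x') x := (hL.const_mul _).sub hd
  have h2 : Integrable fun x => ε ^ 2 * Laplacian.laplacian v x -
      divergence (fun x' => v x' • F x') x - α * v x := h1.sub (hvi.const_mul α)
  have h3 : (fun x => ε ^ 2 * Laplacian.laplacian v x - divergence (fun x' => v x' • F x') x
      - α * v x + γ * gaussian σ (x - y) * u) = fun x => (ε ^ 2 * Laplacian.laplacian v x -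
      divergence (fun x' => v x' • F x') x - α * v x) + (γ * u) * gaussian σ (x - y) := by
    funext x
    ring
  rw [systemRHS, couplingOp, h3, toL1_add h2 (hg.const_mul _), toL1_sub h1 (hvi.const_mul α),
    toL1_const_mul _ hvi, toL1_const_mul _ hg]
  simp only [Prod.mk_add_mk, add_zero]
  congr 1
  ring

end Model

end

end ReturnHome

open ReturnHome in
theorem theorem4p1 (ε σ α γ χ : ℝ) (hε : ε ≠ 0) (hσ : 0 < σ)
    (C : Plane → Plane → Plane) (y : Plane) (hC : Admissible (C y)) :
    -- the operators are well defined, `A + B` and `𝒜` with domains `D(A)` and `ℝ × D(A) × L¹`,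
    -- `𝒞` is a bounded linear operator, and `𝒜 + 𝒞` realizes the right-hand side of the system
    dom (diffusionOp ε) ⊆ dom (convectionOp (C y)) ∧
    dom (uncoupledOp ε α γ χ (C y)) = {x | x.2.1 ∈ dom (diffusionOp ε)} ∧
    IsBoundedLinearMap ℝ (couplingOp σ γ χ y) ∧
    (∀ (u : ℝ) (v : Plane → ℝ) (w : L1), ContDiff ℝ 2 v → HasCompactSupport v →
      ((u, toL1 v, w), systemRHS ε σ α γ χ (C y) y u v w) ∈ fullOp ε σ α γ χ (C y) y) ∧
    -- the semigroups generated by `A + B`, by `𝒜` (with its explicit formula) and by `𝒜 + 𝒞`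
    ∃ (S : ℝ → L1 →L[ℝ] L1) (TA T : ℝ → State →L[ℝ] State),
      Generates (travelOp ε (C y)) S ∧
      Generates (uncoupledOp ε α γ χ (C y)) TA ∧
      (∀ t : ℝ, 0 ≤ t → ∀ x₀ : State, TA t x₀ =
        (Real.exp (-γ * t) * x₀.1,
          Real.exp (-α * t) • S t x₀.2.1,
          Real.exp (-χ * t) • x₀.2.2 + ∫ s in (0 : ℝ)..t,
            (Real.exp (-χ * (t - s)) * α) • (Real.exp (-α * s) • S s x₀.2.1))) ∧
      Generates (fullOp ε σ α γ χ (C y) y) T ∧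
      (∀ T' : ℝ → State →L[ℝ] State, Generates (fullOp ε σ α γ χ (C y) y) T' →
        ∀ t : ℝ, 0 ≤ t → T' t = T t) ∧
      ∀ x₀ : State,
        -- the orbit is the unique mild solution
        IsMildSolution (fullOp ε σ α γ χ (C y) y) x₀ (fun t => T t x₀) ∧
        (∀ z : ℝ → State, IsMildSolution (fullOp ε σ α γ χ (C y) y) x₀ z →
          EqOn z (fun t => T t x₀) (Ici 0)) ∧
        -- it satisfies the variation of constants formulas, and is characterized by each of them
        VariationOfConstants TA (couplingOp σ γ χ y) x₀ (fun t => T t x₀) ∧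
        ComponentFormulas σ α γ χ y S x₀ (fun t => T t x₀) ∧
        (∀ z : ℝ → State, ContinuousOn z (Ici 0) →
          (VariationOfConstants TA (couplingOp σ γ χ y) x₀ z ↔
            ComponentFormulas σ α γ χ y S x₀ z)) ∧
        (∀ z : ℝ → State, ContinuousOn z (Ici 0) →
          VariationOfConstants TA (couplingOp σ γ χ y) x₀ z →
          EqOn z (fun t => T t x₀) (Ici 0)) := by
  have hF := hC
  obtain ⟨hdom, S, hS⟩ := exists_travel_semigroup hε hF
  obtain ⟨TA, hTA, hTAf⟩ := exists_uncoupled_semigroup (α := α) (γ := γ) (χ := χ) hS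
  have hD := generates_diagonalOp (α := α) (γ := γ) (χ := χ) hS
  obtain ⟨T, hT, -⟩ := exists_bounded_perturbation hTA (couplingL σ γ χ y)
  have hTf : Generates (fullOp ε σ α γ χ (C y) y) T := by
    rwa [coe_couplingL] at hT
  -- The same semigroup `T`, now seen as a perturbation of the diagonal one: this characterizes its
  -- orbits by the component formulas.
  have hTd := hTf
  rw [← opAdd_diagonalOp_add] at hTd
  have hvoc : ∀ x₀ z, ContinuousOn z (Ici 0) →
      (VariationOfConstants TA (couplingOp σ γ χ y) x₀ z ↔ EqOn z (fun t => T t x₀) (Ici 0)) := by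
    intro x₀ z hz
    rw [← hTA.variationOfConstants_iff hT x₀ hz, coe_couplingL]
    rfl
  have hcomp : ∀ x₀ z, ContinuousOn z (Ici 0) →
      (ComponentFormulas σ α γ χ y S x₀ z ↔ EqOn z (fun t => T t x₀) (Ici 0)) := by
    intro x₀ z hz
    rw [componentFormulas_iff x₀ hD.1 hz, hD.variationOfConstants_iff hTd x₀ hz]
  refine ⟨hdom, ?_, ?_, fun u v w hv hs => mem_fullOp_of_contDiff hε hσ hF u w hv hs,
    S, TA, T, hS, hTA, hTAf, hTf, fun T' hT' t ht => hTf.eq hT' ht, fun x₀ => ?_⟩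
  · ext x
    constructor
    · rintro ⟨_, f, ⟨a, b, ha, -, -⟩, -⟩
      exact ⟨a, ha⟩
    · rintro ⟨a, ha⟩
      obtain ⟨b, hb⟩ := hdom ⟨a, ha⟩
      exact ⟨(-γ * x.1, a + b - α • x.2.1, α • x.2.1 - χ • x.2.2), a + b,
        ⟨a, b, ha, hb, rfl⟩, rfl⟩
  · rw [← coe_couplingL]
    exact (couplingL σ γ χ y).isBoundedLinearMap
  · have hTc := hTf.1.continuousOn x₀
    refine ⟨?_, ?_, (hvoc x₀ _ hTc).2 fun _ _ => rfl, (hcomp x₀ _ hTc).2 fun _ _ => rfl,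
      fun z hz => (hvoc x₀ z hz).trans (hcomp x₀ z hz).symm, fun z hz => (hvoc x₀ z hz).1⟩
    · rw [← hTf.2]
      exact hTf.1.isMildSolution x₀
    · intro z hz
      rw [← hTf.2] at hz
      exact hTf.1.eqOn_of_isMildSolution hz (hTf.1.isMildSolution x₀)
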